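/- Proposition (lower semicontinuity of mass for $k$-chains). Let $X$ be a real Banach space, let $(G,|\cdot|)$ be a normed abelian group that is complete in the metric of its norm, and let $k\ge 0$. Polyhedral chains. A convex $k$-polyhedron is a nonempty bounded set of affine dimension $k$ that is the intersection of a finite-dimensional affine subspace of $X$ with finitely many closed half-spaces. The group $\mathcal P_k=\mathcal P_k(X,G)$ of polyhedral $k$-chains consists of the finite formal sums $\sum_i g_i[P_i]$, with $g_i\in G$ and $P_i$ an oriented convex $k$-polyhedron, modulo the relations $(g+h)[P]=g[P]+h[P]$, $(-g)[P]=g[-P]$ (where $-P$ is $P$ with the opposite orientation), and $g[P_1\cup P_2]=g[P_1]+g[P_2]$ whenever $P_1$, $P_2$ and $P_1\cup P_2$ are convex $k$-polyhedra with the same orientation and $P_1,P_2$ have disjoint relative interiors. The boundary $\partial:\mathcal P_{k+1}\to\mathcal P_k$ is the additive map that sends $g[P]$ to $\sum_F g[F]$, where $F$ runs over the facets of $P$ with the orientations induced by $P$. For $f\in X^*$ and $r\in\mathbb R$, let $P_r$ be the part of the chain $P$ in $f^{-1}((-\infty,r))$; the slice of a chain $P\in\mathcal P_{k+1}$ by $f$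 at $r$ is $P\cap f^{-1}(r)=\partial(P_r)-(\partial P)_r\in\mathcal P_k$, which is defined for almost every $r$. Mass. The mass $M$ is defined by induction on $k$. For a single point, $M(g[x])=|g|$. For $k\ge 1$ and a simple chain $g[P]$, $$M(g[P])=\sup_{f\in X^*,\ \|f\|=1}\ \int_{-\infty}^{\infty}M\big(g[P]\cap f^{-1}(r)\big)\,dr .$$ For $k\ge 0$ and an arbitrary $P\in\mathcal P_k$, $M(P)=\sum_i M(g_i[P_i])$, where $P=\sum_i g_i[P_i]$ is any representation in which the polyhedra $P_i$ have pairwise disjoint relative interiors. The flat norm of $P\in\mathcal P_k$ is $$F(P)=\inf_{Q\in\mathcal P_{k+1}}\big(M(Q)+M(\partial Q-P)\big).$$ Statement. If $P_1,P_2,\dots$ and $P$ are polyhedral $k$-chains in $X$ with coefficients in $G$ and $F(P_j-P)\to 0$ as $j\to\infty$, then $$M(P)\le\liminf_{j\to\infty}M(P_j).$$ -/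

import Mathlib

open Set Filter Topology MeasureTheory
open scoped ENNReal

noncomputable section

namespace FlatChains

variable {X : Type*} [NormedAddCommGroup X] [NormedSpace ℝ X]

/-- A (closed, bounded) convex polyhedron: a bounded set that is the intersection of a
finite-dimensional affine subspace with finitely many closed half-spaces. -/
def IsConvexPolyhedron (S : Set X) : Prop :=
  Bornology.IsBounded S ∧
    ∃ (A : AffineSubspace ℝ X) (L : Finset ((X →L[ℝ] ℝ) × ℝ)),
      FiniteDimensional ℝ A.direction ∧ S = {x | x ∈ A ∧ ∀ p ∈ L, p.1 x ≤ p.2}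

theorem IsConvexPolyhedron.inter_halfspace {S : Set X} (hS : IsConvexPolyhedron S)
    (f : X →L[ℝ] ℝ) (r : ℝ) : IsConvexPolyhedron (S ∩ {x | f x ≤ r}) := by
  classical
  obtain ⟨hb, A, L, hA, rfl⟩ := hS
  refine ⟨hb.subset inter_subset_left, A, insert (f, r) L, hA, ?_⟩
  ext x
  simp only [mem_inter_iff, mem_ofPred_eq, Finset.mem_insert, forall_eq_or_imp]
  tauto

theorem IsConvexPolyhedron.convex {S : Set X} (hS : IsConvexPolyhedron S) : Convex ℝ S := by
  obtain ⟨-, A, L, -, rfl⟩ := hS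
  intro x hx y hy a b ha hb hab
  refine ⟨A.convex hx.1 hy.1 ha hb hab, fun p hp => ?_⟩
  have h1 := hx.2 p hp
  have h2 := hy.2 p hp
  simp only [map_add, map_smul, smul_eq_mul]
  calc a * p.1 x + b * p.1 y ≤ a * p.2 + b * p.2 := by gcongr
    _ = p.2 := by rw [← add_mul, hab, one_mul]

theorem IsConvexPolyhedron.finiteDimensional {S : Set X} (hS : IsConvexPolyhedron S) :
    FiniteDimensional ℝ (vectorSpan ℝ S) := by
  obtain ⟨-, A, L, hA, rfl⟩ := hS
  have : vectorSpan ℝ {x | x ∈ A ∧ ∀ p ∈ L, p.1 x ≤ p.2} ≤ A.direction :=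
    vectorSpan_mono ℝ (fun x hx => hx.1)
  exact Submodule.finiteDimensional_of_le this

theorem vectorSpan_inter_halfspace {S : Set X} (hS : Convex ℝ S) (f : X →L[ℝ] ℝ) (r : ℝ)
    (h : (S ∩ {x | f x < r}).Nonempty) :
    vectorSpan ℝ (S ∩ {x | f x ≤ r}) = vectorSpan ℝ S := by
  refine le_antisymm (vectorSpan_mono ℝ inter_subset_left) ?_
  obtain ⟨p, hpS, hp⟩ := h
  simp only [mem_ofPred_eq] at hp
  rw [vectorSpan_eq_span_vsub_set_right ℝ hpS, Submodule.span_le]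
  rintro _ ⟨q, hq, rfl⟩
  obtain ⟨t, ht0, ht1, ht⟩ : ∃ t : ℝ, 0 < t ∧ t ≤ 1 ∧ f p + t * (f q - f p) ≤ r := by
    by_cases hqr : f q ≤ r
    · exact ⟨1, one_pos, le_rfl, by linarith⟩
    · push Not at hqr
      refine ⟨(r - f p) / (f q - f p), div_pos (by linarith) (by linarith), ?_, ?_⟩
      · rw [div_le_one (by linarith)]; linarith
      · rw [div_mul_cancel₀ _ (by linarith)]; linarith
  have hm : p + t • (q - p) ∈ S ∩ {x | f x ≤ r} := by
    refine ⟨hS.add_smul_sub_mem hpS hq ⟨ht0.le, ht1⟩, ?_⟩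
    simpa using ht
  have hmp : p ∈ S ∩ {x | f x ≤ r} := ⟨hpS, hp.le⟩
  have := vsub_mem_vectorSpan ℝ hm hmp
  simp only [vsub_eq_sub, add_sub_cancel_left] at this
  simpa using (Submodule.smul_mem_iff _ ht0.ne').1 this

/-- A `k`-dimensional convex polyhedron in `X`, oriented by an ordered basis `frame` of its
direction space. -/
structure OrientedPolyhedron (X : Type*) [NormedAddCommGroup X] [NormedSpace ℝ X] (k : ℕ) where
  carrier : Set X
  isPolyhedron : IsConvexPolyhedron carrier
  nonempty : carrier.Nonempty
  frame : Fin k → X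
  linearIndependent : LinearIndependent ℝ frame
  span_frame : Submodule.span ℝ (Set.range frame) = vectorSpan ℝ carrier

/-- The ordered bases `v` and `w` (of one subspace) define the same orientation. -/
def SameOrientation {k : ℕ} (v w : Fin k → X) : Prop :=
  ∃ A : Matrix (Fin k) (Fin k) ℝ, (∀ j, w j = ∑ i, A i j • v i) ∧ 0 < A.det

/-- The ordered bases `v` and `w` (of one subspace) define opposite orientations. -/
def OppositeOrientation {k : ℕ} (v w : Fin k → X) : Prop :=
  ∃ A : Matrix (Fin k) (Fin k) ℝ, (∀ j, w j = ∑ i, A i j • v i) ∧ A.det < 0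

/-! ### Polyhedral chains -/

/-- Finite formal sums `∑ gᵢ [Pᵢ]` of oriented convex `k`-polyhedra with coefficients in `G`
(the rule `(g₁ + g₂)[P] = g₁[P] + g₂[P]` is built in). -/
abbrev FormalSum (X G : Type*) [NormedAddCommGroup X] [NormedSpace ℝ X]
    [NormedAddCommGroup G] (k : ℕ) : Type _ :=
  OrientedPolyhedron X k →₀ G

section Chains

variable {G : Type*} [NormedAddCommGroup G]

/-- The relations between formal sums: a polyhedron only depends on the orientation that its
frame defines, `(-g)[P] = g[-P]`, and `g[P₁ ∪ P₂] = g[P₁] + g[P₂]` if `P₁`, `P₂` have disjoint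
relative interiors (and `P₁`, `P₂`, `P₁ ∪ P₂` carry the same orientation). -/
inductive Relation {k : ℕ} : FormalSum X G k → Prop
  | same (S T : OrientedPolyhedron X k) (g : G) (hc : S.carrier = T.carrier)
      (ho : SameOrientation S.frame T.frame) :
      Relation (Finsupp.single S g - Finsupp.single T g)
  | opposite (S T : OrientedPolyhedron X k) (g : G) (hc : S.carrier = T.carrier)
      (ho : OppositeOrientation S.frame T.frame) :
      Relation (Finsupp.single S (-g) - Finsupp.single T g)
  | union (S S₁ S₂ : OrientedPolyhedron X k) (g : G)
      (hc : S.carrier = S₁.carrier ∪ S₂.carrier)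
      (hd : Disjoint (intrinsicInterior ℝ S₁.carrier) (intrinsicInterior ℝ S₂.carrier))
      (h₁ : SameOrientation S.frame S₁.frame) (h₂ : SameOrientation S.frame S₂.frame) :
      Relation (Finsupp.single S g - (Finsupp.single S₁ g + Finsupp.single S₂ g))

/-- The subgroup of formal sums that represent the zero chain. -/
def relations (X G : Type*) [NormedAddCommGroup X] [NormedSpace ℝ X] [NormedAddCommGroup G]
    (k : ℕ) : AddSubgroup (FormalSum X G k) :=
  AddSubgroup.closure {P | Relation P}

/-- The group `𝒫ₖ(X, G)` of polyhedral `k`-chains in `X` with coefficients in `G`. -/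
abbrev PolyhedralChain (X G : Type*) [NormedAddCommGroup X] [NormedSpace ℝ X]
    [NormedAddCommGroup G] (k : ℕ) : Type _ :=
  FormalSum X G k ⧸ relations X G k

/-- The polyhedral chain represented by a formal sum. -/
def FormalSum.toChain {k : ℕ} (P : FormalSum X G k) : PolyhedralChain X G k :=
  QuotientAddGroup.mk P

/-! ### Boundary -/

/-- The facets of a `(k+1)`-dimensional polyhedron: its `k`-dimensional exposed faces. -/
def facets {k : ℕ} (S : OrientedPolyhedron X (k + 1)) : Set (Set X) :=
  {F | IsExposed ℝ S.carrier F ∧ F.Nonempty ∧ Module.finrank ℝ (vectorSpan ℝ F) = k}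

theorem isPolyhedron_of_mem_facets {k : ℕ} {S : OrientedPolyhedron X (k + 1)} {F : Set X}
    (hF : F ∈ facets S) : IsConvexPolyhedron F := by
  obtain ⟨he, ⟨x, hx⟩, -⟩ := hF
  obtain ⟨l, hl⟩ := he ⟨x, hx⟩
  have : F = S.carrier ∩ {y | (-l) y ≤ -(l x)} := by
    rw [hl] at hx
    rw [hl]
    ext y
    simp only [mem_ofPred_eq, mem_inter_iff, neg_apply, neg_le_neg_iff]
    exact ⟨fun h => ⟨h.1, h.2 x hx.1⟩, fun h => ⟨h.1, fun z hz => (hx.2 z hz).trans h.2⟩⟩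
  rw [this]
  exact S.isPolyhedron.inter_halfspace _ _

theorem exists_frame {k : ℕ} {F : Set X} (hF : IsConvexPolyhedron F)
    (hk : Module.finrank ℝ (vectorSpan ℝ F) = k) :
    ∃ w : Fin k → X, LinearIndependent ℝ w ∧
      Submodule.span ℝ (Set.range w) = vectorSpan ℝ F := by
  have := hF.finiteDimensional
  let b := Module.finBasisOfFinrankEq ℝ (vectorSpan ℝ F) hk
  refine ⟨fun i => (b i : X), b.linearIndependent.map' (vectorSpan ℝ F).subtype
    (Submodule.ker_subtype _), ?_⟩
  have : Set.range (fun i => (b i : X)) = (vectorSpan ℝ F).subtype '' Set.range b := by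
    rw [← Set.range_comp]; rfl
  rw [this, Submodule.span_image, b.span_eq, Submodule.map_top, Submodule.range_subtype]

/-- A facet, with an arbitrarily chosen orientation. -/
def facet {k : ℕ} (S : OrientedPolyhedron X (k + 1)) (F : facets S) :
    OrientedPolyhedron X k where
  carrier := F
  isPolyhedron := isPolyhedron_of_mem_facets F.2
  nonempty := F.2.2.1
  frame := (exists_frame (isPolyhedron_of_mem_facets F.2) F.2.2.2).choose
  linearIndependent := (exists_frame (isPolyhedron_of_mem_facets F.2) F.2.2.2).choose_spec.1
  span_frame := (exists_frame (isPolyhedron_of_mem_facets F.2) F.2.2.2).choose_spec.2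

/-- The chosen orientation of the facet `F` is the one induced by `S`: an outward pointing vector
followed by the frame of `F` is a positively oriented basis. -/
def IsInducedOrientation {k : ℕ} (S : OrientedPolyhedron X (k + 1)) (F : facets S) : Prop :=
  ∃ y ∈ (F : Set X), ∃ x ∈ S.carrier \ (F : Set X),
    SameOrientation S.frame (Fin.cons (y - x) (facet S F).frame : Fin (k + 1) → X)

theorem facets_finite {k : ℕ} (S : OrientedPolyhedron X (k + 1)) : (facets S).Finite := by
  classical
  have hfd := S.isPolyhedron.finiteDimensional
  have hrank : Module.finrank ℝ (vectorSpan ℝ S.carrier) = k + 1 := by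
    rw [← S.span_frame, finrank_span_eq_card S.linearIndependent, Fintype.card_fin]
  obtain ⟨-, A, L, hA, hS⟩ := S.isPolyhedron
  refine (L.finite_toSet.image (fun p => {x ∈ S.carrier | p.1 x = p.2})).subset ?_
  intro F hF
  have hFconv : Convex ℝ F := (isPolyhedron_of_mem_facets hF).convex
  obtain ⟨he, hne, hk⟩ := hF
  obtain ⟨l, hl⟩ := he hne
  have hFS : F ⊆ S.carrier := fun x hx => by rw [hl] at hx; exact hx.1
  have hle : ∀ x ∈ S.carrier, ∀ p ∈ L, p.1 x ≤ p.2 := fun x hx => by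
    rw [hS] at hx; exact hx.2
  have key : ∃ p ∈ L, (∀ x ∈ F, p.1 x = p.2) ∧ ∃ q ∈ S.carrier, p.1 q ≠ p.2 := by
    by_contra hcon
    push Not at hcon
    have hp : ∀ L' : Finset ((X →L[ℝ] ℝ) × ℝ), L' ⊆ L →
        ∃ x ∈ F, ∀ p ∈ L', (∀ q ∈ S.carrier, p.1 q = p.2) ∨ p.1 x < p.2 := by
      intro L'
      induction L' using Finset.induction_on with
      | empty => exact fun _ => ⟨hne.choose, hne.choose_spec, by simp⟩
      | insert p L' _ ih =>
        intro hsub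
        obtain ⟨x, hx, hxL⟩ := ih ((Finset.subset_insert _ _).trans hsub)
        have hpL : p ∈ L := hsub (Finset.mem_insert_self _ _)
        by_cases hc : ∀ x ∈ F, p.1 x = p.2
        · refine ⟨x, hx, fun p' hp' => ?_⟩
          rcases Finset.mem_insert.1 hp' with rfl | h
          · exact Or.inl (hcon _ hpL hc)
          · exact hxL _ h
        · push Not at hc
          obtain ⟨y, hy, hyp⟩ := hc
          refine ⟨(1 / 2 : ℝ) • x + (1 / 2 : ℝ) • y,
            hFconv hx hy (by norm_num) (by norm_num) (by norm_num), fun p' hp' => ?_⟩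
          have hp'L : p' ∈ L := hsub hp'
          have h1 := hle x (hFS hx) p' hp'L
          have h2 := hle y (hFS hy) p' hp'L
          simp only [map_add, map_smul, smul_eq_mul]
          rcases Finset.mem_insert.1 hp' with rfl | h
          · right
            have := lt_of_le_of_ne h2 hyp
            linarith
          · rcases hxL _ h with h | h
            · exact Or.inl h
            · right; linarith
    obtain ⟨x, hx, hxL⟩ := hp L subset_rfl
    have hxS := hFS hx
    have hFS' : ∃ q ∈ S.carrier, q ∉ F := by
      by_contra hcon
      push Not at hcon
      have : F = S.carrier := Subset.antisymm hFS hcon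
      rw [this] at hk
      omega
    obtain ⟨q, hq, hqF⟩ := hFS'
    have hxmax : ∀ y ∈ S.carrier, l y ≤ l x := by
      have := hx; rw [hl] at this; exact this.2
    have hlq : l q < l x := by
      by_contra hcon
      push Not at hcon
      refine hqF ?_
      rw [hl]
      exact ⟨hq, fun y hy => (hxmax y hy).trans hcon⟩
    have hev : ∀ᶠ t in 𝓝[>] (0 : ℝ), x + t • (x - q) ∈ S.carrier := by
      have h1 : ∀ᶠ t in 𝓝[>] (0 : ℝ), ∀ p ∈ L, p.1 (x + t • (x - q)) ≤ p.2 := by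
        rw [Filter.eventually_all_finset]
        intro p hpL
        rcases hxL p hpL with h | h
        · refine Eventually.of_forall fun t => ?_
          simp [h x hxS, h q hq]
        · have hcont : Continuous fun t : ℝ => p.1 (x + t • (x - q)) := by fun_prop
          have : ∀ᶠ t in 𝓝 (0 : ℝ), p.1 (x + t • (x - q)) < p.2 :=
            hcont.continuousAt.eventually_lt continuousAt_const (by simpa using h)
          exact (this.filter_mono nhdsWithin_le_nhds).mono fun t ht => ht.le
      filter_upwards [h1] with t ht
      rw [hS]
      refine ⟨?_, ht⟩
      have hxA : x ∈ A := by rw [hS] at hxS; exact hxS.1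
      have hqA : q ∈ A := by rw [hS] at hq; exact hq.1
      have := A.smul_vsub_vadd_mem t hxA hqA hxA
      simpa [add_comm] using this
    obtain ⟨t, ht, ht0⟩ := (hev.and self_mem_nhdsWithin).exists
    have := hxmax _ ht
    simp only [map_add, map_smul, map_sub, smul_eq_mul] at this
    have : 0 < t * (l x - l q) := mul_pos ht0 (by linarith)
    linarith
  obtain ⟨p, hpL, hpF, q, hq, hpq⟩ := key
  refine ⟨p, hpL, ?_⟩
  set E : Set X := {x ∈ S.carrier | p.1 x = p.2} with hE
  have hFE : F ⊆ E := fun x hx => ⟨hFS hx, hpF x hx⟩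
  obtain ⟨x, hx⟩ := hne
  have hxE := hFE hx
  have hEker : vectorSpan ℝ E ≤ LinearMap.ker (p.1 : X →ₗ[ℝ] ℝ) := by
    rw [vectorSpan_eq_span_vsub_set_right ℝ hxE, Submodule.span_le]
    rintro _ ⟨y, hy, rfl⟩
    simp [hy.2, hxE.2]
  have hES : vectorSpan ℝ E < vectorSpan ℝ S.carrier := by
    refine lt_of_le_of_ne (vectorSpan_mono ℝ (fun y hy => hy.1)) fun h => ?_
    have h1 : q -ᵥ x ∈ vectorSpan ℝ E := h ▸ vsub_mem_vectorSpan ℝ hq hxE.1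
    have h2 := hEker h1
    simp only [vsub_eq_sub, LinearMap.mem_ker, map_sub, sub_eq_zero] at h2
    exact hpq (by simpa [hxE.2] using h2)
  have hlt := Submodule.finrank_lt_finrank_of_lt hES
  have hEfd : FiniteDimensional ℝ (vectorSpan ℝ E) := Submodule.finiteDimensional_of_le hES.le
  have heq : vectorSpan ℝ F = vectorSpan ℝ E :=
    Submodule.eq_of_le_of_finrank_le (vectorSpan_mono ℝ hFE) (by omega)
  refine Subset.antisymm (fun y hy => ?_) hFE
  have hFker : vectorSpan ℝ F ≤ LinearMap.ker (l : X →ₗ[ℝ] ℝ) := by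
    rw [vectorSpan_eq_span_vsub_set_right ℝ hx, Submodule.span_le]
    rintro _ ⟨z, hz, rfl⟩
    have hx' := hx
    rw [hl] at hz hx'
    simp [le_antisymm (hx'.2 z hz.1) (hz.2 x hx'.1)]
  have h1 : y -ᵥ x ∈ vectorSpan ℝ F := heq ▸ vsub_mem_vectorSpan ℝ hy hxE
  have h2 := hFker h1
  simp only [vsub_eq_sub, LinearMap.mem_ker, map_sub, sub_eq_zero] at h2
  have h3 : l y = l x := h2
  have hx' := hx
  rw [hl] at hx' ⊢
  exact ⟨hy.1, fun z hz => h3 ▸ hx'.2 z hz⟩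

instance {k : ℕ} (S : OrientedPolyhedron X (k + 1)) : Finite (facets S) :=
  (facets_finite S).to_subtype

instance {k : ℕ} (S : OrientedPolyhedron X (k + 1)) : Fintype (facets S) :=
  Fintype.ofFinite _

open Classical in
/-- The boundary of a formal sum: `∂(g[S])` is the sum of the facets of `S` with the induced
orientations and coefficient `g`. -/
def boundary {k : ℕ} (P : FormalSum X G (k + 1)) : FormalSum X G k :=
  P.sum fun S g => ∑ F : facets S,
    if IsInducedOrientation S F then Finsupp.single (facet S F) g
    else Finsupp.single (facet S F) (-g)

/-! ### Restriction to half-spaces and slices -/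

/-- The part of the polyhedron `S` in the half-space `{f < r}` (if it is not empty), as a closed
polyhedron with the orientation of `S`. -/
def cut {k : ℕ} (S : OrientedPolyhedron X k) (f : X →L[ℝ] ℝ) (r : ℝ)
    (h : (S.carrier ∩ {x | f x < r}).Nonempty) : OrientedPolyhedron X k where
  carrier := S.carrier ∩ {x | f x ≤ r}
  isPolyhedron := S.isPolyhedron.inter_halfspace f r
  nonempty := by
    obtain ⟨x, hx, hr⟩ := h
    exact ⟨x, hx, le_of_lt (show f x < r from hr)⟩
  frame := S.frame
  linearIndependent := S.linearIndependent
  span_frame := by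
    rw [S.span_frame, vectorSpan_inter_halfspace S.isPolyhedron.convex f r h]

open Classical in
/-- The portion of `P` in `f⁻¹((-∞, r))`. -/
def restrict {k : ℕ} (f : X →L[ℝ] ℝ) (r : ℝ) (P : FormalSum X G k) : FormalSum X G k :=
  P.sum fun S g =>
    if h : (S.carrier ∩ {x | f x < r}).Nonempty then Finsupp.single (cut S f r h) g else 0

/-- The slice `P ∩ f⁻¹(r) = ∂(P_r) - (∂P)_r`. -/
def slice {k : ℕ} (f : X →L[ℝ] ℝ) (r : ℝ) (P : FormalSum X G (k + 1)) : FormalSum X G k :=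
  boundary (restrict f r P) - restrict f r (boundary P)

/-! ### Mass and flat norm -/

/-- The summands of the formal sum are pairwise disjoint as relatively open polyhedra. -/
def IsDisjointSum {k : ℕ} (P : FormalSum X G k) : Prop :=
  (P.support : Set (OrientedPolyhedron X k)).Pairwise fun S T =>
    Disjoint (intrinsicInterior ℝ S.carrier) (intrinsicInterior ℝ T.carrier)

/-- Extension of a mass `m S g` of simple chains `g[S]` to arbitrary chains: the value
`∑ m Sᵢ gᵢ` for the representations `∑ gᵢ [Sᵢ]` of the chain with disjoint summands. (For the mass
below this value does not depend on the representation; the infimum picks it.) -/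
def massOfSimple {k : ℕ} (m : OrientedPolyhedron X k → G → ℝ≥0∞) (P : PolyhedralChain X G k) :
    ℝ≥0∞ :=
  ⨅ (Q : FormalSum X G k) (_ : IsDisjointSum Q ∧ Q.toChain = P), Q.sum m

/-- The mass of the simple chain `g[S]`. -/
def simpleMass : (k : ℕ) → OrientedPolyhedron X k → G → ℝ≥0∞
  | 0, _, g => ‖g‖ₑ
  | k + 1, S, g => ⨆ (f : X →L[ℝ] ℝ) (_ : ‖f‖ = 1),
      ∫⁻ r : ℝ, massOfSimple (simpleMass k) (slice f r (Finsupp.single S g)).toChain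

/-- The mass `M(P)` of a polyhedral chain. -/
def mass {k : ℕ} (P : PolyhedralChain X G k) : ℝ≥0∞ :=
  massOfSimple (simpleMass k) P

/-- The flat norm `F(P) = inf_Q M(Q) + M(∂Q - P)`, over all polyhedral `(k+1)`-chains, given by
formal sums `Q`. -/
def flatNorm {k : ℕ} (P : PolyhedralChain X G k) : ℝ≥0∞ :=
  ⨅ Q : FormalSum X G (k + 1), mass Q.toChain + mass ((boundary Q).toChain - P)

end Chains

end FlatChains

end

/-!
Let `π : X → ℝᵏ` be a linear map whose coordinates have norm one. At almost every point `x` a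
`k`-chain has a density relative to `π`: the signed sum of the coefficients of the polyhedra that
contain `x`. The densities determine the chain, and the density of `∂Q` at `x` is the difference of
the coefficients of `Q` on the two sides of `x` along the fibre of `π` through `x`. Induction on `k`
and Fubini show that the mass of `g[S]` is `|g|` times the largest measure of a projection `π(S)`.

Write `P₀` as a sum of simple chains `g[S]` with disjoint interiors. In each `S` choose a compact
part `K` that misses the other summands, a projection `π` that measures it, and a `1`-Lipschitz
function `h` that is nonpositive on `K` and exceeds some `δ > 0` on the other summands. If
`P₀ = P + R - ∂Q`, add up the densities over the points of a fibre of `π` where `h ≤ t`. On the left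
this gives `± g` over `π(K)`, while the part of `Q` in the fibre contributes only where a segment of
`Q` crosses the level `h = t`. Integration over `t ∈ (0, δ)` and over the fibres shows that
`δ |g| vol(π(K))` is at most `δ` times the mass of `P + R` near `K`, plus the mass of `Q`. The sets
`{h ≤ δ}` of different summands are disjoint, so the masses of `P` near them add up to at most
`M(P)`. Hence `M(P₀)` is at most the lower limit up to an arbitrarily small error.
-/

noncomputable section

namespace FlatChains

variable {X : Type*} [NormedAddCommGroup X] [NormedSpace ℝ X]
variable {G : Type*} [NormedAddCommGroup G] {k : ℕ}

/-! ### Coordinate projections and minors -/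

section Minors

variable {ι : Type*}

/-- The continuous linear map `X → ℝ^ι` with coordinates `π i`. Masses are measured by the Lebesgue
volume of the images of polyhedra under such maps with `‖π i‖ = 1`. -/
def proj (π : ι → X →L[ℝ] ℝ) : X →L[ℝ] (ι → ℝ) :=
  ContinuousLinearMap.pi π

@[simp] theorem proj_apply (π : ι → X →L[ℝ] ℝ) (x : X) (i : ι) : proj π x i = π i x := rfl

theorem exists_dual_family [Finite ι] [DecidableEq ι] {v : ι → X}
    (hv : LinearIndependent ℝ v) :
    ∃ π : ι → X →L[ℝ] ℝ, ∀ i j, π i (v j) = if i = j then 1 else 0 := by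
  have := Fintype.ofFinite ι
  have hinj : Function.Injective (Fintype.linearCombination ℝ v) :=
    linearIndependent_iff_injective_fintypeLinearCombination.1 hv
  choose π hπ using fun i : ι =>
    (SeparatingDual.dualMap_surjective_iff (R := ℝ)).2 hinj (LinearMap.proj i)
  refine ⟨π, fun i j => ?_⟩
  have := congrArg (fun φ : Module.Dual ℝ (ι → ℝ) => φ (Pi.single j 1)) (hπ i)
  simpa [Pi.single_apply] using this

variable [Fintype ι] [DecidableEq ι] {π : ι → X →L[ℝ] ℝ} {v w : ι → X}

/-- The determinant of `proj π` on the span of `v`, with respect to the frame `v`. It controls the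
volume of projections, and its sign compares the orientation of `v` with that of `ℝ^ι`. -/
def minor (π : ι → X →L[ℝ] ℝ) (v : ι → X) : ℝ :=
  (Matrix.of fun i j => π i (v j)).det

theorem minor_change_of_frame (π : ι → X →L[ℝ] ℝ) {A : Matrix ι ι ℝ}
    (h : ∀ j, w j = ∑ i, A i j • v i) : minor π w = A.det * minor π v := by
  rw [minor, minor, mul_comm, ← Matrix.det_mul]
  congr 1
  ext i j
  simp [Matrix.mul_apply, h, mul_comm]

theorem proj_add_sum_smul (π : ι → X →L[ℝ] ℝ) (v : ι → X) (x₀ : X) (t : ι → ℝ) :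
    proj π (x₀ + ∑ j, t j • v j) =
      proj π x₀ + Matrix.toLin' (Matrix.of fun i j => π i (v j)) t := by
  ext i
  simp [Matrix.mulVec, dotProduct, mul_comm]

theorem volume_proj_image (π : ι → X →L[ℝ] ℝ) (v : ι → X) (x₀ : X) {T : Set X}
    (hT : ∀ x ∈ T, x - x₀ ∈ Submodule.span ℝ (range v)) :
    volume (proj π '' T) =
      ENNReal.ofReal |minor π v| * volume {t : ι → ℝ | x₀ + ∑ j, t j • v j ∈ T} := by
  have himage : proj π '' T = (fun y => proj π x₀ + y) ''
      (Matrix.toLin' (Matrix.of fun i j => π i (v j)) ''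
        {t : ι → ℝ | x₀ + ∑ j, t j • v j ∈ T}) := by
    ext y
    simp only [mem_image, mem_ofPred_eq, exists_exists_and_eq_and, ← proj_add_sum_smul]
    constructor
    · rintro ⟨x, hx, rfl⟩
      obtain ⟨t, ht⟩ := (Submodule.mem_span_range_iff_exists_fun ℝ).1 (hT x hx)
      have hx' : x₀ + ∑ j, t j • v j = x := by rw [ht]; abel
      exact ⟨t, by rwa [hx'], by rw [hx']⟩
    · rintro ⟨t, ht, rfl⟩
      exact ⟨_, ht, rfl⟩
  rw [himage, image_add_left, measure_preimage_add, Measure.addHaar_image_linearMap,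
    LinearMap.det_toLin']
  rfl

theorem exists_minor_eq_one (hv : LinearIndependent ℝ v) :
    ∃ π : ι → X →L[ℝ] ℝ, minor π v = 1 := by
  obtain ⟨π, hπ⟩ := exists_dual_family hv
  have hmat : (Matrix.of fun i j => π i (v j)) = 1 := by
    ext i j
    simp [hπ, Matrix.one_apply]
  exact ⟨π, by rw [minor, hmat, Matrix.det_one]⟩

theorem exists_change_of_frame (hw : LinearIndependent ℝ w)
    (h : ∀ j, w j ∈ Submodule.span ℝ (range v)) :
    ∃ A : Matrix ι ι ℝ, (∀ j, w j = ∑ i, A i j • v i) ∧ A.det ≠ 0 := by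
  choose A hA using fun j => (Submodule.mem_span_range_iff_exists_fun ℝ).1 (h j)
  have hA' : ∀ j, w j = ∑ i, (Matrix.of fun i j => A j i) i j • v i := fun j => (hA j).symm
  refine ⟨_, hA', fun h0 => ?_⟩
  obtain ⟨π, hπ⟩ := exists_minor_eq_one hw
  rw [minor_change_of_frame π hA', h0, zero_mul] at hπ
  exact zero_ne_one hπ

theorem eq_zero_of_proj_eq_zero (h : minor π v ≠ 0) {x : X}
    (hx : x ∈ Submodule.span ℝ (range v)) (h0 : proj π x = 0) : x = 0 := by
  obtain ⟨t, rfl⟩ := (Submodule.mem_span_range_iff_exists_fun ℝ).1 hx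
  have ht : t = 0 := by
    refine Matrix.eq_zero_of_mulVec_eq_zero h ?_
    rw [← Matrix.toLin'_apply]
    simpa [h0] using (proj_add_sum_smul π v 0 t).symm
  simp [ht]

end Minors

section FiberDirection

variable {π : Fin k → X →L[ℝ] ℝ} {v w : Fin (k + 1) → X}

/-- The direction of the fibres of `proj π` in the span of `v`, given by the generalised cross
product. For a linearly independent `v` it vanishes exactly when these fibres have dimension
greater than one. -/
def fiberDir (π : Fin k → X →L[ℝ] ℝ) (v : Fin (k + 1) → X) : X :=
  ∑ j : Fin (k + 1), ((-1) ^ (j : ℕ) * minor π (fun i => v (j.succAbove i))) • v j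

theorem minor_cons (h : X →L[ℝ] ℝ) (π : Fin k → X →L[ℝ] ℝ) (v : Fin (k + 1) → X) :
    minor (Fin.cons h π : Fin (k + 1) → X →L[ℝ] ℝ) v =
      ∑ j : Fin (k + 1), (-1) ^ (j : ℕ) * h (v j) * minor π (fun i => v (j.succAbove i)) := by
  rw [minor, Matrix.det_succ_row_zero]
  refine Finset.sum_congr rfl fun j _ => congrArg _ (congrArg Matrix.det ?_)
  ext i l
  simp

theorem apply_fiberDir (π : Fin k → X →L[ℝ] ℝ) (v : Fin (k + 1) → X) (h : X →L[ℝ] ℝ) :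
    h (fiberDir π v) = minor (Fin.cons h π : Fin (k + 1) → X →L[ℝ] ℝ) v := by
  rw [minor_cons, fiberDir, map_sum]
  refine Finset.sum_congr rfl fun j _ => ?_
  rw [map_smul, smul_eq_mul]
  ring

theorem fiberDir_mem_span (π : Fin k → X →L[ℝ] ℝ) (v : Fin (k + 1) → X) :
    fiberDir π v ∈ Submodule.span ℝ (range v) :=
  Submodule.sum_mem _ fun j _ => Submodule.smul_mem _ _ (Submodule.subset_span ⟨j, rfl⟩)

theorem proj_fiberDir (π : Fin k → X →L[ℝ] ℝ) (v : Fin (k + 1) → X) :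
    proj π (fiberDir π v) = 0 := by
  ext i
  rw [proj_apply, apply_fiberDir, Pi.zero_apply, minor]
  refine Matrix.det_zero_of_row_eq (i := 0) (j := i.succ) (Fin.succ_ne_zero i).symm ?_
  ext j
  simp

theorem fiberDir_change_of_frame (π : Fin k → X →L[ℝ] ℝ)
    {A : Matrix (Fin (k + 1)) (Fin (k + 1)) ℝ} (h : ∀ j, w j = ∑ i, A i j • v i) :
    fiberDir π w = A.det • fiberDir π v := by
  refine (SeparatingDual.eq_iff_forall_dual_eq (R := ℝ)).2 fun f => ?_
  rw [map_smul, apply_fiberDir, apply_fiberDir, minor_change_of_frame _ h, smul_eq_mul]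

theorem exists_eq_smul_fiberDir (hd : fiberDir π v ≠ 0) {x : X}
    (hx : x ∈ Submodule.span ℝ (range v)) (h0 : proj π x = 0) :
    ∃ c : ℝ, x = c • fiberDir π v := by
  obtain ⟨h, hh⟩ := SeparatingDual.exists_ne_zero (R := ℝ) hd
  refine ⟨h x / h (fiberDir π v), sub_eq_zero.1 ?_⟩
  have hminor : minor (Fin.cons h π : Fin (k + 1) → X →L[ℝ] ℝ) v ≠ 0 := by
    rwa [← apply_fiberDir]
  refine eq_zero_of_proj_eq_zero hminor
    (Submodule.sub_mem _ hx (Submodule.smul_mem _ _ (fiberDir_mem_span π v))) ?_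
  ext i
  refine Fin.cases ?_ (fun i => ?_) i
  · simp [hh]
  · have h1 : π i x = 0 := congrFun h0 i
    have h2 : π i (fiberDir π v) = 0 := congrFun (proj_fiberDir π v) i
    simp [h1, h2]

theorem minor_cons_cons (π : Fin k → X →L[ℝ] ℝ) {h : X →L[ℝ] ℝ} (n : X) {w : Fin k → X}
    (hw : ∀ i, h (w i) = 0) :
    minor (Fin.cons h π : Fin (k + 1) → X →L[ℝ] ℝ) (Fin.cons n w : Fin (k + 1) → X) =
      h n * minor π w := by
  simp [minor_cons, Fin.sum_univ_succ, hw]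

end FiberDirection

/-! ### Generic points of a projection -/

section Generic

variable {ι : Type*} [Fintype ι] {π : ι → X →L[ℝ] ℝ} {N : Set X}

/-- The filter of sets of generic points: a property holds for generic `x` if it holds on the whole
fibre of `proj π` over almost every point of `ℝ^ι`. -/
def generic (π : ι → X →L[ℝ] ℝ) : Filter X :=
  comap (proj π) (ae volume)

theorem eventually_generic {p : X → Prop} :
    (∀ᶠ x in generic π, p x) ↔ ∀ᵐ y, ∀ x, proj π x = y → p x :=
  eventually_comap

theorem eventually_notMem_generic :
    (∀ᶠ x in generic π, x ∉ N) ↔ volume (proj π '' N) = 0 := by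
  rw [eventually_generic, ae_iff]
  congr! 2
  ext y
  simp [and_comm]

theorem volume_proj_image_eq_zero
    (h : (vectorSpan ℝ N).map (proj π : X →ₗ[ℝ] (ι → ℝ)) ≠ ⊤) : volume (proj π '' N) = 0 := by
  rcases N.eq_empty_or_nonempty with rfl | ⟨x₀, hx₀⟩
  · simp
  · set W := (vectorSpan ℝ N).map (proj π : X →ₗ[ℝ] (ι → ℝ))
    refine measure_mono_null (t := AffineSubspace.mk' (proj π x₀) W) ?_
      (Measure.addHaar_affineSubspace volume _ fun hW => h ?_)
    · rintro _ ⟨x, hx, rfl⟩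
      exact AffineSubspace.mem_mk'.2 ⟨x - x₀, vsub_mem_vectorSpan ℝ hx hx₀, by simp⟩
    · simpa using congrArg AffineSubspace.direction hW

theorem volume_proj_image_eq_zero_of_finrank_lt [FiniteDimensional ℝ (vectorSpan ℝ N)]
    (h : Module.finrank ℝ (vectorSpan ℝ N) < Fintype.card ι) : volume (proj π '' N) = 0 := by
  refine volume_proj_image_eq_zero fun htop => ?_
  have := Submodule.finrank_map_le (proj π : X →ₗ[ℝ] (ι → ℝ)) (vectorSpan ℝ N)
  rw [htop, finrank_top, Module.finrank_fintype_fun_eq_card] at this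
  lia

theorem volume_proj_image_eq_zero_of_mem [FiniteDimensional ℝ (vectorSpan ℝ N)]
    (h : Module.finrank ℝ (vectorSpan ℝ N) ≤ Fintype.card ι)
    {d : X} (hd : d ∈ vectorSpan ℝ N) (hd0 : d ≠ 0) (hπ : proj π d = 0) :
    volume (proj π '' N) = 0 := by
  refine volume_proj_image_eq_zero fun htop => ?_
  have hrank := LinearMap.finrank_range_add_finrank_ker
    ((proj π : X →ₗ[ℝ] (ι → ℝ)).domRestrict (vectorSpan ℝ N))
  rw [LinearMap.range_domRestrict, htop, finrank_top, Module.finrank_fintype_fun_eq_card] at hrank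
  have hker : 0 < Module.finrank ℝ (LinearMap.ker
      ((proj π : X →ₗ[ℝ] (ι → ℝ)).domRestrict (vectorSpan ℝ N))) :=
    Module.finrank_pos_iff_exists_ne_zero.2
      ⟨⟨⟨d, hd⟩, by simpa using hπ⟩, by simpa [Subtype.ext_iff] using hd0⟩
  lia

end Generic

/-! ### Convex polyhedra -/

section ConvexPolyhedra

variable {S T : Set X} {f : X →L[ℝ] ℝ} {c : ℝ}

theorem IsConvexPolyhedron.isClosed (hS : IsConvexPolyhedron S) : IsClosed S := by
  obtain ⟨-, A, L, _, rfl⟩ := hS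
  have hA : IsClosed (A : Set X) := A.closed_of_finiteDimensional
  have hL : IsClosed {x : X | ∀ p ∈ L, p.1 x ≤ p.2} := by
    simp only [ofPred_forall]
    exact isClosed_biInter fun p _ => isClosed_le p.1.continuous continuous_const
  exact hA.inter hL

theorem IsConvexPolyhedron.isCompact (hS : IsConvexPolyhedron S) : IsCompact S := by
  rcases S.eq_empty_or_nonempty with rfl | ⟨x₀, hx₀⟩
  · exact isCompact_empty
  have := hS.finiteDimensional
  have : ProperSpace (vectorSpan ℝ S) := FiniteDimensional.proper ℝ _
  have hiso : Isometry fun d : vectorSpan ℝ S => x₀ + (d : X) :=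
    (IsometryEquiv.addLeft x₀).isometry.comp isometry_subtype_coe
  have hpre : IsCompact ((fun d : vectorSpan ℝ S => x₀ + (d : X)) ⁻¹' S) :=
    Metric.isCompact_of_isClosed_isBounded (hS.isClosed.preimage hiso.continuous)
      (hiso.antilipschitz.isBounded_preimage hS.1)
  have hrange : S ⊆ range fun d : vectorSpan ℝ S => x₀ + (d : X) := fun x hx =>
    ⟨⟨x - x₀, vsub_mem_vectorSpan ℝ hx hx₀⟩, add_sub_cancel _ _⟩
  simpa only [image_preimage_eq_of_subset hrange] using hpre.image hiso.continuous

theorem IsConvexPolyhedron.inter (hS : IsConvexPolyhedron S) (hT : IsConvexPolyhedron T) :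
    IsConvexPolyhedron (S ∩ T) := by
  classical
  obtain ⟨hb, A, L, hA, rfl⟩ := hS
  obtain ⟨-, B, M, -, rfl⟩ := hT
  refine ⟨hb.subset inter_subset_left, A ⊓ B, L ∪ M,
    Submodule.finiteDimensional_of_le (AffineSubspace.direction_le inf_le_left), ?_⟩
  ext x
  simp only [mem_inter_iff, mem_ofPred_eq, Finset.mem_union, AffineSubspace.mem_inf_iff, or_imp,
    forall_and]
  tauto

theorem apply_eq_of_mem_affineSpan (h : ∀ z ∈ S, f z = c) {x : X} (hx : x ∈ affineSpan ℝ S) :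
    f x = c := by
  have hle : affineSpan ℝ S ≤ (affineSpan ℝ {c}).comap (f : X →ₗ[ℝ] ℝ).toAffineMap :=
    affineSpan_le.2 fun z hz => by simp [h z hz]
  simpa using hle hx

theorem apply_eq_zero_of_mem_vectorSpan (h : ∀ z ∈ S, f z = c) {d : X}
    (hd : d ∈ vectorSpan ℝ S) : f d = 0 := by
  have hle : vectorSpan ℝ S ≤ LinearMap.ker (f : X →ₗ[ℝ] ℝ) := by
    rw [vectorSpan, Submodule.span_le]
    rintro _ ⟨x, hx, y, hy, rfl⟩
    simp [h x hx, h y hy]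
  exact hle hd

theorem exists_forall_lt_or_eqOn_of_convex (hS : Convex ℝ S) (hne : S.Nonempty)
    (L : Finset ((X →L[ℝ] ℝ) × ℝ)) (hL : ∀ x ∈ S, ∀ p ∈ L, p.1 x ≤ p.2) :
    ∃ x ∈ S, ∀ p ∈ L, p.1 x < p.2 ∨ ∀ z ∈ S, p.1 z = p.2 := by
  classical
  induction L using Finset.induction_on with
  | empty => exact ⟨hne.choose, hne.choose_spec, by simp⟩
  | insert p L _ ih =>
    obtain ⟨x, hx, hxL⟩ := ih fun x hx q hq => hL x hx q (Finset.mem_insert_of_mem hq)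
    by_cases hc : ∀ z ∈ S, p.1 z = p.2
    · exact ⟨x, hx, (Finset.forall_mem_insert _ _ _).2 ⟨Or.inr hc, hxL⟩⟩
    · push Not at hc
      obtain ⟨y, hy, hyp⟩ := hc
      have hmid : ∀ q : (X →L[ℝ] ℝ) × ℝ,
          q.1 ((1 / 2 : ℝ) • x + (1 / 2 : ℝ) • y) = (q.1 x + q.1 y) / 2 := fun q => by
        simp only [map_add, map_smul, smul_eq_mul]
        ring
      refine ⟨(1 / 2 : ℝ) • x + (1 / 2 : ℝ) • y,
        hS hx hy (by norm_num) (by norm_num) (by norm_num),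
        (Finset.forall_mem_insert _ _ _).2 ⟨Or.inl ?_, fun q hq => (hxL q hq).imp_left fun h => ?_⟩⟩
      · have hpx := hL x hx p (Finset.mem_insert_self _ _)
        have hpy := (hL y hy p (Finset.mem_insert_self _ _)).lt_of_ne hyp
        rw [hmid]
        linarith
      · have hqy := hL y hy q (Finset.mem_insert_of_mem hq)
        rw [hmid]
        linarith

theorem mem_intrinsicInterior_of_forall_lt_or_eqOn {A : AffineSubspace ℝ X}
    {L : Finset ((X →L[ℝ] ℝ) × ℝ)} (hS : S = {x | x ∈ A ∧ ∀ p ∈ L, p.1 x ≤ p.2})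
    {x : X} (hx : x ∈ S) (hL : ∀ p ∈ L, p.1 x < p.2 ∨ ∀ z ∈ S, p.1 z = p.2) :
    x ∈ intrinsicInterior ℝ S := by
  have hSA : affineSpan ℝ S ≤ A := affineSpan_le.2 fun y hy => (hS.le hy).1
  refine ⟨⟨x, subset_affineSpan ℝ S hx⟩, mem_interior.2
    ⟨{z | ∀ p ∈ L, p.1 x < p.2 → p.1 z < p.2}, fun z hz => hS.ge ⟨hSA z.2, fun p hp => ?_⟩, ?_,
      fun p _ h => h⟩, rfl⟩
  · rcases hL p hp with h | h
    · exact (hz p hp h).le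
    · exact (apply_eq_of_mem_affineSpan h z.2).le
  · simp only [ofPred_forall]
    refine isOpen_biInter_finset fun p _ => isOpen_iInter_of_finite fun _ => ?_
    exact isOpen_lt (p.1.continuous.comp continuous_subtype_val) continuous_const

theorem apply_eq_of_mem_intrinsicInterior_of_forall_le {x : X} (hx : x ∈ intrinsicInterior ℝ S)
    (hf : ∀ z ∈ S, f z ≤ c) (hfx : c ≤ f x) {z : X} (hz : z ∈ S) : f z = c := by
  obtain ⟨x', hx', rfl⟩ := hx
  let γ : ℝ → affineSpan ℝ S := fun t =>
    ⟨AffineMap.lineMap (x' : X) z t, AffineMap.lineMap_mem t x'.2 (subset_affineSpan ℝ S hz)⟩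
  have hγ : Continuous γ := Continuous.subtype_mk AffineMap.lineMap_continuous _
  have hγ0 : γ 0 = x' := by ext; simp [γ]
  have hev : ∀ᶠ t in 𝓝 (0 : ℝ), γ t ∈ ((↑) : affineSpan ℝ S → X) ⁻¹' S :=
    hγ.continuousAt.eventually_mem (hγ0 ▸ mem_interior_iff_mem_nhds.1 hx')
  obtain ⟨t, ht, ht0 : t < 0⟩ := ((hev.filter_mono nhdsWithin_le_nhds).and
    (self_mem_nhdsWithin : Iio (0 : ℝ) ∈ 𝓝[<] 0)).exists
  have hle : t * (f z - f x') + f x' ≤ c := by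
    simpa [γ, AffineMap.lineMap_apply] using hf _ ht
  nlinarith [hf z hz]

theorem affineSpan_eq_of_subset_of_finrank_le [FiniteDimensional ℝ (vectorSpan ℝ S)]
    (hT : T.Nonempty) (hTS : T ⊆ S)
    (hfin : Module.finrank ℝ (vectorSpan ℝ S) ≤ Module.finrank ℝ (vectorSpan ℝ T)) :
    affineSpan ℝ T = affineSpan ℝ S := by
  refine AffineSubspace.eq_of_direction_eq_of_nonempty_of_le ?_ (hT.affineSpan ℝ)
    (affineSpan_mono ℝ hTS)
  rw [direction_affineSpan, direction_affineSpan,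
    Submodule.eq_of_le_of_finrank_le (vectorSpan_mono ℝ hTS) hfin]

theorem IsConvexPolyhedron.finrank_inter_lt (hS : IsConvexPolyhedron S)
    (hT : IsConvexPolyhedron T)
    (hST : Module.finrank ℝ (vectorSpan ℝ S) = Module.finrank ℝ (vectorSpan ℝ T))
    (hdisj : Disjoint (intrinsicInterior ℝ S) (intrinsicInterior ℝ T))
    (hne : (S ∩ T).Nonempty) :
    Module.finrank ℝ (vectorSpan ℝ (S ∩ T)) < Module.finrank ℝ (vectorSpan ℝ S) := by
  classical
  by_contra! hcon
  have := hS.finiteDimensional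
  have := hT.finiteDimensional
  have hspanS := affineSpan_eq_of_subset_of_finrank_le hne inter_subset_left hcon
  have hspanT := affineSpan_eq_of_subset_of_finrank_le hne inter_subset_right (hST ▸ hcon)
  have hconv := hS.convex.inter hT.convex
  obtain ⟨-, A, L, -, hAS⟩ := hS
  obtain ⟨-, B, M, -, hBT⟩ := hT
  obtain ⟨x, hx, hxLM⟩ := exists_forall_lt_or_eqOn_of_convex hconv hne (L ∪ M) fun z hz p hp =>
    (Finset.mem_union.1 hp).elim ((hAS.le hz.1).2 p) ((hBT.le hz.2).2 p)
  have hxS : x ∈ intrinsicInterior ℝ S :=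
    mem_intrinsicInterior_of_forall_lt_or_eqOn hAS hx.1 fun p hp =>
      (hxLM p (Finset.mem_union_left _ hp)).imp_right fun h _ hz =>
        apply_eq_of_mem_affineSpan h (hspanS ▸ subset_affineSpan ℝ _ hz)
  have hxT : x ∈ intrinsicInterior ℝ T :=
    mem_intrinsicInterior_of_forall_lt_or_eqOn hBT hx.2 fun p hp =>
      (hxLM p (Finset.mem_union_right _ hp)).imp_right fun h _ hz =>
        apply_eq_of_mem_affineSpan h (hspanT ▸ subset_affineSpan ℝ _ hz)
  exact disjoint_left.1 hdisj hxS hxT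

end ConvexPolyhedra

namespace OrientedPolyhedron

variable {π : Fin k → X →L[ℝ] ℝ}

theorem finiteDimensional (S : OrientedPolyhedron X k) :
    FiniteDimensional ℝ (vectorSpan ℝ S.carrier) := S.isPolyhedron.finiteDimensional

theorem finrank_vectorSpan (S : OrientedPolyhedron X k) :
    Module.finrank ℝ (vectorSpan ℝ S.carrier) = k := by
  rw [← S.span_frame, finrank_span_eq_card S.linearIndependent, Fintype.card_fin]

theorem sub_mem_span (S : OrientedPolyhedron X k) {x y : X} (hx : x ∈ S.carrier)
    (hy : y ∈ S.carrier) : x - y ∈ Submodule.span ℝ (range S.frame) := by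
  rw [S.span_frame]
  exact vsub_mem_vectorSpan ℝ hx hy

theorem isCompact (S : OrientedPolyhedron X k) : IsCompact S.carrier := S.isPolyhedron.isCompact

theorem isClosed (S : OrientedPolyhedron X k) : IsClosed S.carrier := S.isPolyhedron.isClosed

theorem convex (S : OrientedPolyhedron X k) : Convex ℝ S.carrier := S.isPolyhedron.convex

theorem measurableSet_proj_image (S : OrientedPolyhedron X k) {ι : Type*} [Finite ι]
    (π : ι → X →L[ℝ] ℝ) : MeasurableSet (proj π '' S.carrier) :=
  (S.isCompact.image (proj π).continuous).measurableSet

theorem eventually_notMem_inter {S T : OrientedPolyhedron X k}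
    (h : Disjoint (intrinsicInterior ℝ S.carrier) (intrinsicInterior ℝ T.carrier))
    (π : Fin k → X →L[ℝ] ℝ) : ∀ᶠ x in generic π, x ∉ S.carrier ∩ T.carrier := by
  rw [eventually_notMem_generic]
  rcases (S.carrier ∩ T.carrier).eq_empty_or_nonempty with he | hne
  · simp [he]
  · have := (S.isPolyhedron.inter T.isPolyhedron).finiteDimensional
    refine volume_proj_image_eq_zero_of_finrank_lt ?_
    simpa [S.finrank_vectorSpan, T.finrank_vectorSpan] using
      S.isPolyhedron.finrank_inter_lt T.isPolyhedron
        (by rw [S.finrank_vectorSpan, T.finrank_vectorSpan]) h hne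

theorem volume_proj_image_subset (S : OrientedPolyhedron X k) (π : Fin k → X →L[ℝ] ℝ) {x₀ : X}
    (hx₀ : x₀ ∈ S.carrier) {T : Set X} (hT : T ⊆ S.carrier) :
    volume (proj π '' T) = ENNReal.ofReal |minor π S.frame| *
      volume {t : Fin k → ℝ | x₀ + ∑ j, t j • S.frame j ∈ T} :=
  volume_proj_image π S.frame x₀ fun _ hx => S.sub_mem_span (hT hx) hx₀

theorem eventually_notMem_of_minor_eq_zero (S : OrientedPolyhedron X k)
    (h : minor π S.frame = 0) : ∀ᶠ x in generic π, x ∉ S.carrier := by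
  obtain ⟨x₀, hx₀⟩ := S.nonempty
  rw [eventually_notMem_generic, S.volume_proj_image_subset π hx₀ subset_rfl, h]
  simp

theorem injOn_proj (S : OrientedPolyhedron X k) (h : minor π S.frame ≠ 0) :
    InjOn (proj π) S.carrier := fun x hx y hy hxy =>
  sub_eq_zero.1 (eq_zero_of_proj_eq_zero h (S.sub_mem_span hx hy) (by simp [hxy]))

theorem map_proj_vectorSpan_eq_top (S : OrientedPolyhedron X k) (h : minor π S.frame ≠ 0) :
    (vectorSpan ℝ S.carrier).map (proj π : X →ₗ[ℝ] (Fin k → ℝ)) = ⊤ := by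
  have := S.finiteDimensional
  have hinj : Function.Injective
      ((proj π : X →ₗ[ℝ] (Fin k → ℝ)).domRestrict (vectorSpan ℝ S.carrier)) := by
    rw [injective_iff_map_eq_zero]
    rintro ⟨x, hx⟩ hx0
    rw [← S.span_frame] at hx
    exact Subtype.ext (eq_zero_of_proj_eq_zero h hx hx0)
  refine Submodule.eq_top_of_finrank_eq ?_
  rw [← LinearMap.range_domRestrict, LinearMap.finrank_range_of_inj hinj, S.finrank_vectorSpan,
    Module.finrank_fin_fun]

theorem volume_proj_image_pos (S : OrientedPolyhedron X k) (h : minor π S.frame ≠ 0) :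
    0 < volume (proj π '' S.carrier) := by
  have hconv : Convex ℝ (proj π '' S.carrier) :=
    S.convex.linear_image (proj π : X →ₗ[ℝ] (Fin k → ℝ))
  have hspan : vectorSpan ℝ (proj π '' S.carrier) = ⊤ :=
    ((proj π : X →ₗ[ℝ] (Fin k → ℝ)).toAffineMap.map_vectorSpan).symm.trans
      (S.map_proj_vectorSpan_eq_top h)
  rw [← AffineSubspace.affineSpan_eq_top_iff_vectorSpan_eq_top_of_nonempty _ _ _
    (S.nonempty.image _), ← hconv.interior_nonempty_iff_affineSpan_eq_top] at hspan
  exact Measure.measure_pos_of_nonempty_interior _ hspan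

end OrientedPolyhedron

/-! ### Densities of chains -/

section Density

theorem toChain_eq_iff {P Q : FormalSum X G k} :
    P.toChain = Q.toChain ↔ P - Q ∈ relations X G k := by
  rw [FormalSum.toChain, FormalSum.toChain, eq_comm, QuotientAddGroup.eq, neg_add_eq_sub]

@[simp] theorem toChain_add (P Q : FormalSum X G k) :
    (P + Q).toChain = P.toChain + Q.toChain := rfl

@[simp] theorem toChain_sub (P Q : FormalSum X G k) :
    (P - Q).toChain = P.toChain - Q.toChain := rfl

@[simp] theorem toChain_zero : (0 : FormalSum X G k).toChain = 0 := rfl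

theorem toChain_sum {ι : Type*} (s : Finset ι) (F : ι → FormalSum X G k) :
    (∑ i ∈ s, F i : FormalSum X G k).toChain = ∑ i ∈ s, (F i).toChain :=
  map_sum (QuotientAddGroup.mk' (relations X G k)) F s

theorem eventually_eq_of_toChain_eq {ι H : Type*} [AddCommGroup H] {l : Filter ι}
    (φ : ι → FormalSum X G k →+ H)
    (hφ : ∀ R : FormalSum X G k, Relation R → ∀ᶠ x in l, φ x R = 0)
    {P Q : FormalSum X G k} (h : P.toChain = Q.toChain) : ∀ᶠ x in l, φ x P = φ x Q := by
  have hzero : ∀ R ∈ relations X G k, ∀ᶠ x in l, φ x R = 0 := by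
    intro R hR
    induction hR using AddSubgroup.closure_induction with
    | mem R hR => exact hφ R hR
    | zero => exact Eventually.of_forall fun x => map_zero (φ x)
    | add R T _ _ hR hT =>
      filter_upwards [hR, hT] with x hxR hxT
      rw [map_add, hxR, hxT, add_zero]
    | neg R _ hR =>
      filter_upwards [hR] with x hxR
      rw [map_neg, hxR, neg_zero]
  filter_upwards [hzero _ (toChain_eq_iff.1 h)] with x hx
  rwa [map_sub, sub_eq_zero] at hx

/-- The additive functional of formal sums that counts every polyhedron `S` with the integer
multiplicity `w S`. -/
def weightedSum (w : OrientedPolyhedron X k → ℤ) : FormalSum X G k →+ G :=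
  Finsupp.liftAddHom fun S => zsmulAddGroupHom (w S)

theorem weightedSum_apply (w : OrientedPolyhedron X k → ℤ) (P : FormalSum X G k) :
    weightedSum w P = P.sum fun S g => w S • g := rfl

@[simp] theorem weightedSum_single (w : OrientedPolyhedron X k → ℤ) (S : OrientedPolyhedron X k)
    (g : G) : weightedSum w (Finsupp.single S g) = w S • g :=
  Finsupp.liftAddHom_apply_single _ _ _

/-- The multiplicity with which the oriented polyhedron `S` covers the point `x`, the sign being
that of the projection `proj π` on `S`. -/
def multiplicity (π : Fin k → X →L[ℝ] ℝ) (x : X) (S : OrientedPolyhedron X k) : ℤ :=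
  S.carrier.indicator (fun _ => (SignType.sign (minor π S.frame) : ℤ)) x

/-- The value at `x` of the `G`-valued density of a formal sum, where every polyhedron is oriented
by the projection `proj π`. -/
def density (π : Fin k → X →L[ℝ] ℝ) (x : X) : FormalSum X G k →+ G :=
  weightedSum (multiplicity π x)

variable {π : Fin k → X →L[ℝ] ℝ} {x : X} {S : OrientedPolyhedron X k}

theorem multiplicity_of_mem (hx : x ∈ S.carrier) :
    multiplicity π x S = SignType.sign (minor π S.frame) :=
  indicator_of_mem hx _

theorem multiplicity_of_notMem (hx : x ∉ S.carrier) : multiplicity π x S = 0 :=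
  indicator_of_notMem hx _

theorem sign_minor_of_sameOrientation {v w : Fin k → X} (h : SameOrientation v w) :
    SignType.sign (minor π w) = SignType.sign (minor π v) := by
  obtain ⟨A, hA, hdet⟩ := h
  rw [minor_change_of_frame π hA, sign_mul, sign_pos hdet, one_mul]

theorem sign_minor_of_oppositeOrientation {v w : Fin k → X} (h : OppositeOrientation v w) :
    SignType.sign (minor π w) = -SignType.sign (minor π v) := by
  obtain ⟨A, hA, hdet⟩ := h
  rw [minor_change_of_frame π hA, sign_mul, sign_neg hdet, neg_one_mul]

theorem density_eq_zero_of_relation (π : Fin k → X →L[ℝ] ℝ) {R : FormalSum X G k}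
    (hR : Relation R) : ∀ᶠ x in generic π, density π x R = 0 := by
  cases hR with
  | same S T g hc ho =>
    refine Eventually.of_forall fun x => ?_
    rw [density, map_sub, weightedSum_single, weightedSum_single, multiplicity, multiplicity, hc,
      sign_minor_of_sameOrientation ho, sub_self]
  | opposite S T g hc ho =>
    refine Eventually.of_forall fun x => ?_
    rw [density, map_sub, weightedSum_single, weightedSum_single, multiplicity, multiplicity, hc,
      sign_minor_of_oppositeOrientation ho]
    simp only [SignType.coe_neg, indicator_neg, smul_neg, neg_smul, sub_self]
  | union S S₁ S₂ g hc hd h₁ h₂ =>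
    filter_upwards [OrientedPolyhedron.eventually_notMem_inter hd π] with x hx
    rw [density, map_sub, map_add, weightedSum_single, weightedSum_single, weightedSum_single,
      multiplicity, multiplicity, multiplicity, sign_minor_of_sameOrientation h₁,
      sign_minor_of_sameOrientation h₂, hc, indicator_union_of_notMem_inter hx, add_smul, sub_self]

theorem density_eq_of_toChain_eq (π : Fin k → X →L[ℝ] ℝ) {P Q : FormalSum X G k}
    (h : P.toChain = Q.toChain) : ∀ᶠ x in generic π, density π x P = density π x Q :=
  eventually_eq_of_toChain_eq _ (fun _ hR => density_eq_zero_of_relation π hR) h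

end Density

/-! ### Representations with disjoint summands -/

section HyperplaneArrangements

/-- The closed half-space `{p.1 ≤ p.2}`. The opposite half-space is `halfSpace (-p)`. -/
def halfSpace (p : (X →L[ℝ] ℝ) × ℝ) : Set X :=
  {x | p.1 x ≤ p.2}

/-- The set `T` lies on one side of the hyperplane `{p.1 = p.2}`. -/
def IsSided (p : (X →L[ℝ] ℝ) × ℝ) (T : Set X) : Prop :=
  T ⊆ halfSpace p ∨ T ⊆ halfSpace (-p)

/-- The set `T` is the intersection of its affine span with half-spaces from `H`. -/
def CutOutBy (H : Set ((X →L[ℝ] ℝ) × ℝ)) (T : Set X) : Prop :=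
  ∀ x ∈ affineSpan ℝ T, (∀ p ∈ H, T ⊆ halfSpace p → x ∈ halfSpace p) → x ∈ T

variable {p : (X →L[ℝ] ℝ) × ℝ} {H H' : Set ((X →L[ℝ] ℝ) × ℝ)} {S T : Set X} {x : X}

theorem mem_halfSpace_neg : x ∈ halfSpace (-p) ↔ p.2 ≤ p.1 x :=
  neg_le_neg_iff (a := p.1 x)

theorem nonempty_inter_of_not_subset_halfSpace_neg (h : ¬S ⊆ halfSpace (-p)) :
    (S ∩ {x | p.1 x < p.2}).Nonempty := by
  obtain ⟨x, hx, hxp⟩ := not_subset.1 h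
  exact ⟨x, hx, not_le.1 (mt mem_halfSpace_neg.2 hxp)⟩

theorem IsSided.mono (h : IsSided p S) (hT : T ⊆ S) : IsSided p T :=
  h.imp hT.trans hT.trans

theorem IsSided.neg (h : IsSided p T) : IsSided (-p) T := by
  rw [IsSided, neg_neg]
  exact h.symm

theorem IsSided.subset_halfSpace (h : IsSided p T) (hx : x ∈ intrinsicInterior ℝ T)
    (hxp : x ∈ halfSpace p) : T ⊆ halfSpace p := by
  refine h.elim id fun hT z hz => ?_
  have heq : (-p).1 z = (-p).2 :=
    apply_eq_of_mem_intrinsicInterior_of_forall_le hx hT (neg_le_neg hxp) hz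
  exact (neg_inj.1 heq).le

theorem IsSided.apply_eq (h : IsSided p T) (hx : x ∈ intrinsicInterior ℝ T)
    (hxp : p.1 x = p.2) {z : X} (hz : z ∈ T) : p.1 z = p.2 :=
  le_antisymm (h.subset_halfSpace hx hxp.le hz)
    (mem_halfSpace_neg.1 (h.neg.subset_halfSpace hx (mem_halfSpace_neg.2 hxp.ge) hz))

theorem CutOutBy.mono (h : CutOutBy H T) (hH : H ⊆ H') : CutOutBy H' T :=
  fun x hx hx' => h x hx fun p hp => hx' p (hH hp)

theorem CutOutBy.inter_halfSpace (hS : CutOutBy H S) (hp : p ∈ H) :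
    CutOutBy H (S ∩ halfSpace p) := fun x hx h =>
  ⟨hS x (affineSpan_mono ℝ inter_subset_left hx) fun q hq hSq =>
    h q hq (inter_subset_left.trans hSq), h p hp inter_subset_right⟩

theorem CutOutBy.subset_of_mem_intrinsicInterior (hS : CutOutBy H S) (hT : ∀ p ∈ H, IsSided p T)
    (hspan : affineSpan ℝ T ≤ affineSpan ℝ S) (hxS : x ∈ S) (hxT : x ∈ intrinsicInterior ℝ T) :
    T ⊆ S := fun z hz =>
  hS z (hspan (subset_affineSpan ℝ T hz)) fun p hp hSp =>
    (hT p hp).subset_halfSpace hxT (hSp hxS) hz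

theorem IsConvexPolyhedron.exists_cutOutBy (hS : IsConvexPolyhedron S) :
    ∃ L : Finset ((X →L[ℝ] ℝ) × ℝ), CutOutBy (L : Set ((X →L[ℝ] ℝ) × ℝ)) S := by
  obtain ⟨-, A, L, -, rfl⟩ := hS
  exact ⟨L, fun x hx h =>
    ⟨affineSpan_le.2 (fun y hy => hy.1) hx, fun p hp => h p hp fun z hz => hz.2 p hp⟩⟩

theorem exists_hyperplane_of_notMem {A : AffineSubspace ℝ X} [FiniteDimensional ℝ A.direction]
    (hA : (A : Set X).Nonempty) (hx : x ∉ A) :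
    ∃ p : (X →L[ℝ] ℝ) × ℝ, (∀ z ∈ A, p.1 z = p.2) ∧ p.1 x ≠ p.2 := by
  obtain ⟨a, ha⟩ := hA
  obtain ⟨f, u, hfx, hfA⟩ := geometric_hahn_banach_point_closed A.convex
    A.closed_of_finiteDimensional hx
  refine ⟨(f, f a), fun z hz => ?_, (hfx.trans (hfA a ha)).ne⟩
  by_contra hne
  have hmem := AffineMap.lineMap_mem ((u - f a) / (f z - f a)) ha hz
  have hlt := hfA _ hmem
  simp only [AffineMap.lineMap_apply, vsub_eq_sub, vadd_eq_add, map_add, map_smul, map_sub,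
    smul_eq_mul] at hlt
  rw [div_mul_cancel₀ _ (sub_ne_zero.2 hne)] at hlt
  linarith

theorem affineSpan_eq_or_exists_hyperplane (hT : T.Nonempty) (hS : S.Nonempty)
    [FiniteDimensional ℝ (vectorSpan ℝ T)]
    (hrank : Module.finrank ℝ (vectorSpan ℝ T) ≤ Module.finrank ℝ (vectorSpan ℝ S)) :
    affineSpan ℝ S = affineSpan ℝ T ∨
      ∃ p : (X →L[ℝ] ℝ) × ℝ, (∀ z ∈ T, p.1 z = p.2) ∧ ∃ z ∈ S, p.1 z ≠ p.2 := by
  have : FiniteDimensional ℝ (affineSpan ℝ T).direction := by rwa [direction_affineSpan]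
  by_cases hST : S ⊆ affineSpan ℝ T
  · have hle : affineSpan ℝ S ≤ affineSpan ℝ T := affineSpan_le.2 hST
    have hdir := AffineSubspace.direction_le hle
    left
    refine AffineSubspace.eq_of_direction_eq_of_nonempty_of_le ?_ (hS.affineSpan ℝ) hle
    rw [direction_affineSpan, direction_affineSpan] at hdir ⊢
    exact Submodule.eq_of_le_of_finrank_le hdir hrank
  · obtain ⟨x, hx, hxT⟩ := not_subset.1 hST
    obtain ⟨p, hp, hpx⟩ := exists_hyperplane_of_notMem (hT.affineSpan ℝ) hxT
    exact Or.inr ⟨p, fun z hz => hp z (subset_affineSpan ℝ T hz), x, hx, hpx⟩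

end HyperplaneArrangements

section DisjointSums

variable {p : (X →L[ℝ] ℝ) × ℝ}

theorem sameOrientation_refl (v : Fin k → X) : SameOrientation v v :=
  ⟨1, fun j => by simp [Matrix.one_apply], by simp⟩

theorem toChain_single_cut (S : OrientedPolyhedron X k) (g : G)
    (h₁ : (S.carrier ∩ {x | p.1 x < p.2}).Nonempty)
    (h₂ : (S.carrier ∩ {x | (-p).1 x < (-p).2}).Nonempty) :
    FormalSum.toChain (Finsupp.single S g) =
      FormalSum.toChain (Finsupp.single (cut S p.1 p.2 h₁) g) +
        FormalSum.toChain (Finsupp.single (cut S (-p).1 (-p).2 h₂) g) := by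
  rw [← toChain_add, toChain_eq_iff]
  refine AddSubgroup.subset_closure (Relation.union S _ _ g ?_ (disjoint_left.2 ?_)
    (sameOrientation_refl _) (sameOrientation_refl _))
  · change S.carrier = S.carrier ∩ halfSpace p ∪ S.carrier ∩ halfSpace (-p)
    rw [← inter_union_distrib_left, eq_comm, inter_eq_left]
    exact fun x _ => (le_total (p.1 x) p.2).imp id mem_halfSpace_neg.2
  · intro x hx hx'
    obtain ⟨z, hz, hzp : p.1 z < p.2⟩ := h₁
    have hxp : p.2 ≤ p.1 x := mem_halfSpace_neg.1 (intrinsicInterior_subset hx').2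
    exact hzp.ne (apply_eq_of_mem_intrinsicInterior_of_forall_le hx (fun z hz => hz.2) hxp
      ⟨hz, hzp.le⟩)

theorem exists_subdivision (H : Set ((X →L[ℝ] ℝ) × ℝ)) (hneg : ∀ p ∈ H, -p ∈ H)
    (L : Finset ((X →L[ℝ] ℝ) × ℝ)) (hL : ∀ p ∈ L, p ∈ H)
    (S : OrientedPolyhedron X k) (hS : CutOutBy H S.carrier) (g : G) :
    ∃ Q : FormalSum X G k, Q.toChain = FormalSum.toChain (Finsupp.single S g) ∧ ∀ T ∈ Q.support,
      T.carrier ⊆ S.carrier ∧ CutOutBy H T.carrier ∧ ∀ p ∈ L, IsSided p T.carrier := by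
  classical
  induction L using Finset.induction_on generalizing S with
  | empty =>
    refine ⟨Finsupp.single S g, rfl, fun T hT => ?_⟩
    rw [Finset.mem_singleton.1 (Finsupp.support_single_subset hT)]
    exact ⟨subset_rfl, hS, fun p hp => absurd hp (Finset.notMem_empty p)⟩
  | insert p L _ ih =>
    have hp : p ∈ H := hL p (Finset.mem_insert_self p L)
    replace ih := ih fun q hq => hL q (Finset.mem_insert_of_mem hq)
    by_cases hs : IsSided p S.carrier
    · obtain ⟨Q, hQ, hT⟩ := ih S hS
      refine ⟨Q, hQ, fun T hTQ => ?_⟩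
      obtain ⟨hTS, hcut, hsided⟩ := hT T hTQ
      exact ⟨hTS, hcut, Finset.forall_mem_insert _ _ _ |>.2 ⟨hs.mono hTS, hsided⟩⟩
    · rw [IsSided, not_or] at hs
      have h₁ := nonempty_inter_of_not_subset_halfSpace_neg hs.2
      have h₂ : (S.carrier ∩ {x | (-p).1 x < (-p).2}).Nonempty :=
        nonempty_inter_of_not_subset_halfSpace_neg (by rw [neg_neg]; exact hs.1)
      obtain ⟨Q₁, hQ₁, hT₁⟩ := ih (cut S p.1 p.2 h₁) (hS.inter_halfSpace hp)
      obtain ⟨Q₂, hQ₂, hT₂⟩ := ih (cut S (-p).1 (-p).2 h₂) (hS.inter_halfSpace (hneg p hp))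
      refine ⟨Q₁ + Q₂, ?_, fun T hT => ?_⟩
      · rw [toChain_single_cut S g h₁ h₂, toChain_add, hQ₁, hQ₂]
      rcases Finset.mem_union.1 (Finsupp.support_add hT) with hTQ | hTQ
      · obtain ⟨hTS, hcut, hsided⟩ := hT₁ T hTQ
        exact ⟨hTS.trans inter_subset_left, hcut, Finset.forall_mem_insert _ _ _ |>.2
          ⟨Or.inl (hTS.trans inter_subset_right), hsided⟩⟩
      · obtain ⟨hTS, hcut, hsided⟩ := hT₂ T hTQ
        exact ⟨hTS.trans inter_subset_left, hcut, Finset.forall_mem_insert _ _ _ |>.2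
          ⟨Or.inr (hTS.trans inter_subset_right), hsided⟩⟩

theorem exists_hyperplane_arrangement (s : Finset (OrientedPolyhedron X k)) :
    ∃ H : Finset ((X →L[ℝ] ℝ) × ℝ), (∀ p ∈ H, -p ∈ H) ∧
      (∀ S ∈ s, CutOutBy (H : Set ((X →L[ℝ] ℝ) × ℝ)) S.carrier) ∧
      ∀ S ∈ s, ∀ T ∈ s, affineSpan ℝ S.carrier = affineSpan ℝ T.carrier ∨
        ∃ p ∈ H, (∀ z ∈ T.carrier, p.1 z = p.2) ∧ ∃ z ∈ S.carrier, p.1 z ≠ p.2 := by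
  classical
  choose L hL using fun S : OrientedPolyhedron X k => S.isPolyhedron.exists_cutOutBy
  have hsep (S T : OrientedPolyhedron X k) := have := T.finiteDimensional
    affineSpan_eq_or_exists_hyperplane T.nonempty S.nonempty
      (T.finrank_vectorSpan.trans S.finrank_vectorSpan.symm).le
  choose! q hq using fun S T => or_iff_not_imp_left.1 (hsep S T)
  let K : Finset ((X →L[ℝ] ℝ) × ℝ) := s.biUnion L ∪ (s ×ˢ s).image fun ST => q ST.1 ST.2
  refine ⟨K ∪ K.image Neg.neg, fun p hp => ?_, fun S hS => (hL S).mono fun p hp => ?_,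
    fun S hS T hT => or_iff_not_imp_left.2 fun hne => ⟨q S T, ?_, hq S T hne⟩⟩
  · rcases Finset.mem_union.1 hp with hp | hp
    · exact Finset.mem_union_right _ (Finset.mem_image_of_mem _ hp)
    · obtain ⟨r, hr, rfl⟩ := Finset.mem_image.1 hp
      rw [neg_neg]
      exact Finset.mem_union_left _ hr
  · exact Finset.mem_union_left _ (Finset.mem_union_left _ (Finset.mem_biUnion.2 ⟨S, hS, hp⟩))
  · exact Finset.mem_union_left _ (Finset.mem_union_right _
      (Finset.mem_image.2 ⟨(S, T), Finset.mk_mem_product hS hT, rfl⟩))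

theorem exists_cells (P : FormalSum X G k) :
    ∃ Q : FormalSum X G k, Q.toChain = P.toChain ∧ ∀ T ∈ Q.support, ∀ T' ∈ Q.support,
      T.carrier = T'.carrier ∨
        Disjoint (intrinsicInterior ℝ T.carrier) (intrinsicInterior ℝ T'.carrier) := by
  classical
  obtain ⟨H, hneg, hcut, hsep⟩ := exists_hyperplane_arrangement P.support
  choose! Q hQ hcell using fun S hS =>
    exists_subdivision (H : Set ((X →L[ℝ] ℝ) × ℝ)) hneg H (fun p => id) S (hcut S hS) (P S)
  have hmem : ∀ T ∈ (∑ S ∈ P.support, Q S).support, ∃ S ∈ P.support, T ∈ (Q S).support :=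
    fun T hT => Finset.mem_biUnion.1 (Finsupp.support_finsetSum hT)
  refine ⟨∑ S ∈ P.support, Q S, ?_, fun T hT T' hT' => ?_⟩
  · rw [toChain_sum, Finset.sum_congr rfl hQ, ← toChain_sum]
    exact congrArg FormalSum.toChain P.sum_single
  obtain ⟨S, hS, hTS⟩ := hmem T hT
  obtain ⟨S', hS', hTS'⟩ := hmem T' hT'
  obtain ⟨hsub, hTcut, hTsided⟩ := hcell S hS T hTS
  obtain ⟨hsub', hTcut', hTsided'⟩ := hcell S' hS' T' hTS'
  rw [or_iff_not_imp_right, not_disjoint_iff]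
  rintro ⟨x, hx, hx'⟩
  have hspan : affineSpan ℝ T.carrier = affineSpan ℝ S.carrier := have := S.finiteDimensional
    affineSpan_eq_of_subset_of_finrank_le T.nonempty hsub
      (S.finrank_vectorSpan.trans T.finrank_vectorSpan.symm).le
  have hspan' : affineSpan ℝ T'.carrier = affineSpan ℝ S'.carrier := have := S'.finiteDimensional
    affineSpan_eq_of_subset_of_finrank_le T'.nonempty hsub'
      (S'.finrank_vectorSpan.trans T'.finrank_vectorSpan.symm).le
  have hspanS : affineSpan ℝ S.carrier = affineSpan ℝ S'.carrier := by
    refine (hsep S hS S' hS').resolve_right ?_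
    rintro ⟨p, hp, hpS', z, hz, hpz⟩
    have hpx : p.1 x = p.2 := hpS' x (hsub' (intrinsicInterior_subset hx'))
    refine hpz (apply_eq_of_mem_affineSpan (fun y hy => (hTsided p hp).apply_eq hx hpx hy) ?_)
    exact hspan ▸ subset_affineSpan ℝ _ hz
  have hspanT : affineSpan ℝ T.carrier = affineSpan ℝ T'.carrier := by
    rw [hspan, hspanS, hspan']
  exact Subset.antisymm
    (hTcut'.subset_of_mem_intrinsicInterior hTsided hspanT.le (intrinsicInterior_subset hx') hx)
    (hTcut.subset_of_mem_intrinsicInterior hTsided' hspanT.ge (intrinsicInterior_subset hx) hx')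

theorem exists_toChain_single_eq {S T : OrientedPolyhedron X k} (h : S.carrier = T.carrier)
    (g : G) : ∃ g' : G,
      FormalSum.toChain (Finsupp.single S g) = FormalSum.toChain (Finsupp.single T g') := by
  obtain ⟨A, hA, hdet⟩ := exists_change_of_frame T.linearIndependent (v := S.frame) fun j => by
    rw [S.span_frame, h, ← T.span_frame]
    exact Submodule.subset_span ⟨j, rfl⟩
  simp only [toChain_eq_iff]
  rcases hdet.lt_or_gt with hdet | hdet
  · have hrel := Relation.opposite (G := G) S T (-g) h ⟨A, hA, hdet⟩
    rw [neg_neg] at hrel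
    exact ⟨-g, AddSubgroup.subset_closure hrel⟩
  · exact ⟨g, AddSubgroup.subset_closure (Relation.same S T g h ⟨A, hA, hdet⟩)⟩

theorem exists_isDisjointSum (P : FormalSum X G k) :
    ∃ Q : FormalSum X G k, IsDisjointSum Q ∧ Q.toChain = P.toChain := by
  classical
  obtain ⟨Q, hQP, hQ⟩ := exists_cells P
  let rep (S : OrientedPolyhedron X k) : OrientedPolyhedron X k :=
    have : Nonempty (OrientedPolyhedron X k) := ⟨S⟩
    Function.invFun OrientedPolyhedron.carrier S.carrier
  have hrep (S : OrientedPolyhedron X k) : (rep S).carrier = S.carrier :=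
    have : Nonempty (OrientedPolyhedron X k) := ⟨S⟩
    Function.invFun_eq (f := OrientedPolyhedron.carrier) ⟨S, rfl⟩
  choose γ hγ using fun S => exists_toChain_single_eq (hrep S).symm (Q S)
  have hmem : ∀ S ∈ (∑ S ∈ Q.support, Finsupp.single (rep S) (γ S)).support,
      ∃ S' ∈ Q.support, S = rep S' := by
    intro S hS
    obtain ⟨S', hS', h⟩ := Finset.mem_biUnion.1 (Finsupp.support_finsetSum hS)
    exact ⟨S', hS', Finset.mem_singleton.1 (Finsupp.support_single_subset h)⟩
  refine ⟨∑ S ∈ Q.support, Finsupp.single (rep S) (γ S), fun S hS T hT hST => ?_, ?_⟩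
  · obtain ⟨S', hS', rfl⟩ := hmem S hS
    obtain ⟨T', hT', rfl⟩ := hmem T hT
    rw [hrep, hrep]
    exact (hQ S' hS' T' hT').resolve_left fun h => hST (by simp only [rep, h])
  · rw [← hQP, toChain_sum, ← Finset.sum_congr rfl fun S _ => hγ S, ← toChain_sum]
    exact congrArg FormalSum.toChain Q.sum_single

theorem toChain_eq_of_density_eq {P Q : FormalSum X G k}
    (h : ∀ π : Fin k → X →L[ℝ] ℝ, ∀ᶠ x in generic π, density π x P = density π x Q) :
    P.toChain = Q.toChain := by
  classical
  obtain ⟨R, hR, hRPQ⟩ := exists_isDisjointSum (P - Q)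
  suffices R = 0 by rwa [this, toChain_zero, toChain_sub, eq_comm, sub_eq_zero] at hRPQ
  by_contra hne
  obtain ⟨S, hS⟩ := Finsupp.support_nonempty_iff.2 hne
  obtain ⟨π, hπ⟩ := exists_minor_eq_one S.linearIndependent
  have hinter : ∀ᶠ x in generic π, ∀ T ∈ R.support, T ≠ S → x ∉ S.carrier ∩ T.carrier := by
    refine (Filter.eventually_all_finset _).2 fun T hT => ?_
    by_cases hTS : T = S
    · exact Eventually.of_forall fun x hne => absurd hTS hne
    · filter_upwards [OrientedPolyhedron.eventually_notMem_inter (hR hS hT (Ne.symm hTS)) π]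
        with x hx _ using hx
  have hzero : ∀ᶠ x in generic π, x ∉ S.carrier := by
    filter_upwards [hinter, h π, density_eq_of_toChain_eq π hRPQ] with x hx hPQ hRx hxS
    rw [map_sub, hPQ, sub_self, density, weightedSum_apply, Finsupp.sum,
      Finset.sum_eq_single_of_mem S hS fun T hT hTS => ?_, multiplicity_of_mem hxS, hπ, sign_one,
      SignType.coe_one, one_smul] at hRx
    · exact Finsupp.mem_support_iff.1 hS hRx
    · rw [multiplicity_of_notMem fun hxT => hx T hT hTS ⟨hxS, hxT⟩, zero_smul]
  rw [eventually_notMem_generic] at hzero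
  exact (S.volume_proj_image_pos (by rw [hπ]; exact one_ne_zero)).ne' hzero

end DisjointSums

/-! ### Feasible directions -/

section FeasibleCone

/-- The directions `d` such that `S` contains an initial piece of the open ray from `x` in the
direction `d`. -/
def feasibleCone (S : Set X) (x : X) : Set X :=
  {d | ∀ᶠ t in 𝓝[>] (0 : ℝ), x + t • d ∈ S}

variable {S T : Set X} {f : X →L[ℝ] ℝ} {r c : ℝ} {x d : X}

theorem mem_feasibleCone : d ∈ feasibleCone S x ↔ ∀ᶠ t in 𝓝[>] (0 : ℝ), x + t • d ∈ S := Iff.rfl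

theorem feasibleCone_mono (h : S ⊆ T) : feasibleCone S x ⊆ feasibleCone T x :=
  fun _ hd => (mem_feasibleCone.1 hd).mono fun _ ht => h ht

theorem feasibleCone_inter : feasibleCone (S ∩ T) x = feasibleCone S x ∩ feasibleCone T x :=
  ext fun _ => eventually_and (f := 𝓝[>] (0 : ℝ))

theorem smul_mem_feasibleCone (hc : 0 < c) (hd : d ∈ feasibleCone S x) :
    c • d ∈ feasibleCone S x := by
  have hlim : Tendsto (· * c) (𝓝[>] (0 : ℝ)) (𝓝[>] 0) := by
    refine tendsto_nhdsWithin_iff.2 ⟨?_, ?_⟩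
    · exact ((continuous_mul_const c).tendsto' 0 0 (zero_mul c)).mono_left nhdsWithin_le_nhds
    · filter_upwards [self_mem_nhdsWithin] with t ht using mul_pos ht hc
  exact (hlim.eventually hd).mono fun t ht => by rwa [smul_smul]

theorem smul_mem_feasibleCone_iff (hc : 0 < c) :
    c • d ∈ feasibleCone S x ↔ d ∈ feasibleCone S x := by
  refine ⟨fun h => ?_, smul_mem_feasibleCone hc⟩
  simpa only [inv_smul_smul₀ hc.ne'] using smul_mem_feasibleCone (inv_pos.2 hc) h

theorem mem_vectorSpan_of_mem_feasibleCone (hd : d ∈ feasibleCone S x) :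
    d ∈ vectorSpan ℝ S := by
  obtain ⟨t, ⟨ht, ht'⟩, ht0⟩ :=
    (((mem_feasibleCone.1 hd).and (smul_mem_feasibleCone two_pos hd)).and
      self_mem_nhdsWithin).exists
  have hmem := vsub_mem_vectorSpan ℝ ht' ht
  rw [vsub_eq_sub, add_sub_add_left_eq_sub, smul_comm, two_smul, add_sub_cancel_right] at hmem
  exact (Submodule.smul_mem_iff _ (ne_of_gt ht0)).1 hmem

theorem mem_feasibleCone_of_add_smul_mem (hS : Convex ℝ S) (hx : x ∈ S) (hc : 0 < c)
    (h : x + c • d ∈ S) : d ∈ feasibleCone S x := by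
  rw [← smul_mem_feasibleCone_iff hc]
  filter_upwards [Ioo_mem_nhdsGT one_pos] with t ht
  exact hS.add_smul_mem hx h ⟨ht.1.le, ht.2.le⟩

theorem mem_of_frequently_add_smul_mem (hS : IsClosed S)
    (h : ∃ᶠ t in 𝓝[>] (0 : ℝ), x + t • d ∈ S) : x ∈ S := by
  have hcont : Continuous fun t : ℝ => x + t • d := by fun_prop
  refine hS.closure_subset (mem_closure_of_frequently_of_tendsto h ?_)
  exact (hcont.tendsto' 0 x (by simp)).mono_left nhdsWithin_le_nhds

theorem mem_of_mem_feasibleCone (hS : IsClosed S) (hd : d ∈ feasibleCone S x) : x ∈ S :=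
  mem_of_frequently_add_smul_mem hS (mem_feasibleCone.1 hd).frequently

theorem mem_feasibleCone_of_frequently (hS : Convex ℝ S) (hS' : IsClosed S)
    (h : ∃ᶠ t in 𝓝[>] (0 : ℝ), x + t • d ∈ S) : d ∈ feasibleCone S x := by
  obtain ⟨t, ht, ht0⟩ := (h.and_eventually self_mem_nhdsWithin).exists
  exact mem_feasibleCone_of_add_smul_mem hS (mem_of_frequently_add_smul_mem hS' h) ht0 ht

theorem feasibleCone_union (hS : Convex ℝ S) (hS' : IsClosed S) (hT : Convex ℝ T)
    (hT' : IsClosed T) : feasibleCone (S ∪ T) x = feasibleCone S x ∪ feasibleCone T x := by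
  refine Subset.antisymm (fun d hd => ?_)
    (union_subset (feasibleCone_mono subset_union_left) (feasibleCone_mono subset_union_right))
  have hfreq : ∃ᶠ t in 𝓝[>] (0 : ℝ), x + t • d ∈ S ∨ x + t • d ∈ T :=
    (mem_feasibleCone.1 hd).frequently
  exact (frequently_or_distrib.1 hfreq).imp (mem_feasibleCone_of_frequently hS hS')
    (mem_feasibleCone_of_frequently hT hT')

theorem mem_feasibleCone_halfspace_of_lt (hx : f x < r) : d ∈ feasibleCone {z | f z ≤ r} x := by
  have hcont : Continuous fun t : ℝ => f (x + t • d) := by fun_prop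
  have hlim : Tendsto (fun t : ℝ => f (x + t • d)) (𝓝[>] 0) (𝓝 (f x)) :=
    (hcont.tendsto' 0 _ (by simp)).mono_left nhdsWithin_le_nhds
  exact (hlim.eventually_lt_const hx).mono fun _ ht => ht.le

theorem mem_feasibleCone_halfspace_iff_of_eq (hx : f x = r) :
    d ∈ feasibleCone {z | f z ≤ r} x ↔ f d ≤ 0 := by
  have hiff : ∀ t > (0 : ℝ), f (x + t • d) ≤ r ↔ f d ≤ 0 := fun t ht => by
    rw [map_add, map_smul, hx, add_le_iff_nonpos_right, smul_eq_mul, mul_nonpos_iff_pos_imp_nonpos]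
    simp [ht, ht.le]
  constructor
  · intro h
    obtain ⟨t, ht, ht0⟩ := ((mem_feasibleCone.1 h).and self_mem_nhdsWithin).exists
    exact (hiff t ht0).1 ht
  · intro h
    filter_upwards [self_mem_nhdsWithin] with t ht0 using (hiff t ht0).2 h

theorem feasibleCone_inter_halfspace_of_lt (hx : f x < r) :
    feasibleCone (S ∩ {z | f z ≤ r}) x = feasibleCone S x := by
  rw [feasibleCone_inter]
  exact inter_eq_left.2 fun _ _ => mem_feasibleCone_halfspace_of_lt hx

theorem feasibleCone_inter_halfspace_of_eq (hx : f x = r) :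
    feasibleCone (S ∩ {z | f z ≤ r}) x = feasibleCone S x ∩ {d | f d ≤ 0} := by
  rw [feasibleCone_inter]
  exact congrArg _ (ext fun _ => mem_feasibleCone_halfspace_iff_of_eq hx)

theorem mem_feasibleCone_of_constraints {A : AffineSubspace ℝ X}
    {L : Finset ((X →L[ℝ] ℝ) × ℝ)} (hS : S = {x | x ∈ A ∧ ∀ p ∈ L, p.1 x ≤ p.2}) (hx : x ∈ S)
    (hd : d ∈ vectorSpan ℝ S) (h : ∀ p ∈ L, p.1 x = p.2 → p.1 d ≤ 0) :
    d ∈ feasibleCone S x := by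
  subst hS
  have hdA : d ∈ A.direction := vectorSpan_mono ℝ (fun _ hz => hz.1) hd
  have hconstraint : ∀ p ∈ L, d ∈ feasibleCone {z | p.1 z ≤ p.2} x := fun p hp =>
    (hx.2 p hp).lt_or_eq.elim mem_feasibleCone_halfspace_of_lt
      fun hpx => (mem_feasibleCone_halfspace_iff_of_eq hpx).2 (h p hp hpx)
  simp only [mem_feasibleCone] at hconstraint
  filter_upwards [(eventually_all_finset L).2 hconstraint] with t ht
  refine ⟨?_, ht⟩
  rw [add_comm]
  exact AffineSubspace.vadd_mem_of_mem_direction (A.direction.smul_mem t hdA) hx.1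

end FeasibleCone

/-! ### The density of the boundary -/

section FiberDensity

/-- Every fibre of `proj π` in `S` is a segment in the direction `fiberDir π S.frame`; this is the
multiplicity of `x` as an end point of the segment through `x`: `1` at the end of the segment, `-1`
at its beginning. -/
def fiberMultiplicity (π : Fin k → X →L[ℝ] ℝ) (x : X) (S : OrientedPolyhedron X (k + 1)) : ℤ :=
  (feasibleCone S.carrier x).indicator 1 (-fiberDir π S.frame) -
    (feasibleCone S.carrier x).indicator 1 (fiberDir π S.frame)

/-- The value at `x` of the density of the boundary of a formal sum, read off from the fibres of
`proj π`. -/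
def fiberDensity (π : Fin k → X →L[ℝ] ℝ) (x : X) : FormalSum X G (k + 1) →+ G :=
  weightedSum (fiberMultiplicity π x)

variable {π : Fin k → X →L[ℝ] ℝ} {S T S₁ S₂ : OrientedPolyhedron X (k + 1)} {x : X}

theorem indicator_feasibleCone_smul {S : Set X} {c : ℝ} {d : X} (hc : 0 < c) :
    (feasibleCone S x).indicator (1 : X → ℤ) (c • d) = (feasibleCone S x).indicator 1 d :=
  indicator_eq_indicator (smul_mem_feasibleCone_iff hc) rfl

theorem fiberMultiplicity_of_notMem (hx : x ∉ S.carrier) : fiberMultiplicity π x S = 0 := by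
  have hcone : ∀ d, d ∉ feasibleCone S.carrier x := fun d hd =>
    hx (mem_of_mem_feasibleCone S.isClosed hd)
  rw [fiberMultiplicity, indicator_of_notMem (hcone _), indicator_of_notMem (hcone _), sub_zero]

theorem fiberMultiplicity_of_sameOrientation (h : SameOrientation S.frame T.frame) :
    fiberMultiplicity π x T = (feasibleCone T.carrier x).indicator 1 (-fiberDir π S.frame) -
      (feasibleCone T.carrier x).indicator 1 (fiberDir π S.frame) := by
  obtain ⟨A, hA, hdet⟩ := h
  rw [fiberMultiplicity, fiberDir_change_of_frame π hA, ← smul_neg,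
    indicator_feasibleCone_smul hdet, indicator_feasibleCone_smul hdet]

theorem fiberMultiplicity_of_oppositeOrientation (hc : S.carrier = T.carrier)
    (h : OppositeOrientation S.frame T.frame) :
    fiberMultiplicity π x T = -fiberMultiplicity π x S := by
  obtain ⟨A, hA, hdet⟩ := h
  have hdir : fiberDir π T.frame = -A.det • -fiberDir π S.frame := by
    rw [neg_smul_neg, fiberDir_change_of_frame π hA]
  rw [fiberMultiplicity, fiberMultiplicity, hdir, ← smul_neg, neg_neg,
    indicator_feasibleCone_smul (neg_pos.2 hdet),
    indicator_feasibleCone_smul (neg_pos.2 hdet), hc, neg_sub]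

theorem eventually_notMem_feasibleCone_inter
    (h : Disjoint (intrinsicInterior ℝ S.carrier) (intrinsicInterior ℝ T.carrier))
    (π : Fin k → X →L[ℝ] ℝ) {d : X} (hd : d ≠ 0) (hπ : proj π d = 0) :
    ∀ᶠ x in generic π, d ∉ feasibleCone (S.carrier ∩ T.carrier) x := by
  have hpoly := S.isPolyhedron.inter T.isPolyhedron
  have := hpoly.finiteDimensional
  by_cases hmem : d ∈ vectorSpan ℝ (S.carrier ∩ T.carrier)
  · have hne : (S.carrier ∩ T.carrier).Nonempty := by
      refine nonempty_iff_ne_empty.2 fun hempty => hd ?_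
      rwa [hempty, vectorSpan_empty, Submodule.mem_bot] at hmem
    have hrank := S.isPolyhedron.finrank_inter_lt T.isPolyhedron
      (S.finrank_vectorSpan.trans T.finrank_vectorSpan.symm) h hne
    rw [S.finrank_vectorSpan, Nat.lt_succ_iff] at hrank
    have hnull := volume_proj_image_eq_zero_of_mem (hrank.trans_eq (Fintype.card_fin k).symm)
      hmem hd hπ
    filter_upwards [eventually_notMem_generic.2 hnull] with x hx hcone
    exact hx (mem_of_mem_feasibleCone hpoly.isClosed hcone)
  · exact Eventually.of_forall fun x hx => hmem (mem_vectorSpan_of_mem_feasibleCone hx)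

theorem eventually_indicator_feasibleCone_union
    (hdisj : Disjoint (intrinsicInterior ℝ S.carrier) (intrinsicInterior ℝ T.carrier))
    (π : Fin k → X →L[ℝ] ℝ) {d : X} (hd : d ≠ 0) (hπ : proj π d = 0) :
    ∀ᶠ x in generic π, (feasibleCone (S.carrier ∪ T.carrier) x).indicator (1 : X → ℤ) d =
      (feasibleCone S.carrier x).indicator 1 d + (feasibleCone T.carrier x).indicator 1 d := by
  filter_upwards [eventually_notMem_feasibleCone_inter hdisj π hd hπ] with x hx
  rw [feasibleCone_union S.convex S.isClosed T.convex T.isClosed,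
    indicator_union_of_notMem_inter (by rwa [← feasibleCone_inter])]

theorem eventually_fiberMultiplicity_union (π : Fin k → X →L[ℝ] ℝ)
    (hc : S.carrier = S₁.carrier ∪ S₂.carrier)
    (hdisj : Disjoint (intrinsicInterior ℝ S₁.carrier) (intrinsicInterior ℝ S₂.carrier))
    (h₁ : SameOrientation S.frame S₁.frame) (h₂ : SameOrientation S.frame S₂.frame) :
    ∀ᶠ x in generic π,
      fiberMultiplicity π x S = fiberMultiplicity π x S₁ + fiberMultiplicity π x S₂ := by
  simp only [fiberMultiplicity_of_sameOrientation h₁, fiberMultiplicity_of_sameOrientation h₂]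
  rcases eq_or_ne (fiberDir π S.frame) 0 with hd | hd
  · refine Eventually.of_forall fun x => ?_
    rw [fiberMultiplicity, hd, neg_zero, sub_self, sub_self, sub_self, add_zero]
  · filter_upwards [eventually_indicator_feasibleCone_union hdisj π hd (proj_fiberDir π _),
      eventually_indicator_feasibleCone_union hdisj π (neg_ne_zero.2 hd)
        (by rw [map_neg, proj_fiberDir, neg_zero])] with x hx hx'
    rw [fiberMultiplicity, hc, hx, hx']
    abel

theorem fiberDensity_eq_zero_of_relation (π : Fin k → X →L[ℝ] ℝ) {R : FormalSum X G (k + 1)}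
    (hR : Relation R) : ∀ᶠ x in generic π, fiberDensity π x R = 0 := by
  cases hR with
  | same S T g hc ho =>
    refine Eventually.of_forall fun x => ?_
    rw [fiberDensity, map_sub, weightedSum_single, weightedSum_single,
      fiberMultiplicity_of_sameOrientation ho, fiberMultiplicity, hc, sub_self]
  | opposite S T g hc ho =>
    refine Eventually.of_forall fun x => ?_
    rw [fiberDensity, map_sub, weightedSum_single, weightedSum_single,
      fiberMultiplicity_of_oppositeOrientation hc ho, smul_neg, neg_smul, sub_self]
  | union S S₁ S₂ g hc hd h₁ h₂ =>
    filter_upwards [eventually_fiberMultiplicity_union π hc hd h₁ h₂] with x hx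
    rw [fiberDensity, map_sub, map_add, weightedSum_single, weightedSum_single,
      weightedSum_single, hx, add_smul, sub_self]

theorem fiberDensity_eq_of_toChain_eq (π : Fin k → X →L[ℝ] ℝ) {P Q : FormalSum X G (k + 1)}
    (h : P.toChain = Q.toChain) : ∀ᶠ x in generic π, fiberDensity π x P = fiberDensity π x Q :=
  eventually_eq_of_toChain_eq _ (fun _ hR => fiberDensity_eq_zero_of_relation π hR) h

end FiberDensity

/-! ### Facets and the boundary -/

section Facets

variable {S : OrientedPolyhedron X (k + 1)} {F F' : Set X} {f : X →L[ℝ] ℝ} {c : ℝ}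

theorem finrank_vectorSpan_level_lt {C : Set X} [FiniteDimensional ℝ (vectorSpan ℝ C)] {x y : X}
    (hx : x ∈ C) (hfx : f x = c) (hy : y ∈ C) (hfy : f y ≠ c) :
    Module.finrank ℝ (vectorSpan ℝ {z ∈ C | f z = c}) < Module.finrank ℝ (vectorSpan ℝ C) := by
  refine Submodule.finrank_lt_finrank_of_lt
    ((vectorSpan_mono ℝ fun z hz => hz.1).lt_of_ne fun h => hfy ?_)
  have hmem : y -ᵥ x ∈ vectorSpan ℝ {z ∈ C | f z = c} := h ▸ vsub_mem_vectorSpan ℝ hy hx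
  have hzero := apply_eq_zero_of_mem_vectorSpan (fun z hz => hz.2) hmem
  rwa [vsub_eq_sub, map_sub, hfx, sub_eq_zero] at hzero

theorem finiteDimensional_vectorSpan_of_subset {S T : Set X}
    [FiniteDimensional ℝ (vectorSpan ℝ S)] (h : T ⊆ S) :
    FiniteDimensional ℝ (vectorSpan ℝ T) :=
  Submodule.finiteDimensional_of_le (vectorSpan_mono ℝ h)

theorem exists_facet_eq_level (hF : F ∈ facets S) :
    ∃ (l : X →L[ℝ] ℝ) (c : ℝ), (∀ z ∈ S.carrier, l z ≤ c) ∧ F = {z ∈ S.carrier | l z = c} := by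
  obtain ⟨hexposed, ⟨x, hx⟩, -⟩ := hF
  obtain ⟨l, rfl⟩ := hexposed ⟨x, hx⟩
  exact ⟨l, l x, hx.2, ext fun z => and_congr_right fun hz =>
    ⟨fun h => (hx.2 z hz).antisymm (h x hx.1), fun h y hy => (hx.2 y hy).trans h.ge⟩⟩

theorem level_mem_facets (hf : ∀ z ∈ S.carrier, f z ≤ c)
    (hne : {z ∈ S.carrier | f z = c}.Nonempty)
    (hrank : Module.finrank ℝ (vectorSpan ℝ {z ∈ S.carrier | f z = c}) = k) :
    {z ∈ S.carrier | f z = c} ∈ facets S := by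
  obtain ⟨x, hx, hfx⟩ := id hne
  refine ⟨fun _ => ⟨f, ext fun z => and_congr_right fun hz => ?_⟩, hne, hrank⟩
  exact ⟨fun h y hy => (hf y hy).trans h.ge, fun h => (hf z hz).antisymm (hfx ▸ h x hx)⟩

theorem facet_subset (hF : F ∈ facets S) : F ⊆ S.carrier := by
  obtain ⟨l, c, -, rfl⟩ := exists_facet_eq_level hF
  exact fun z hz => hz.1

theorem exists_mem_diff_facet (hF : F ∈ facets S) : (S.carrier \ F).Nonempty := by
  refine sdiff_nonempty.2 fun h => ?_
  have hrank := hF.2.2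
  rw [(facet_subset hF).antisymm h, S.finrank_vectorSpan] at hrank
  exact k.succ_ne_self hrank

theorem facet_subset_of_le_finrank_inter (hF : F ∈ facets S) (hF' : F' ∈ facets S)
    (hne : (F ∩ F').Nonempty) (h : k ≤ Module.finrank ℝ (vectorSpan ℝ (F ∩ F'))) : F' ⊆ F := by
  have := (isPolyhedron_of_mem_facets hF').finiteDimensional
  have hspan := affineSpan_eq_of_subset_of_finrank_le hne inter_subset_right (hF'.2.2.trans_le h)
  obtain ⟨l, c, -, rfl⟩ := exists_facet_eq_level hF
  exact fun z hz => ⟨facet_subset hF' hz, apply_eq_of_mem_affineSpan (fun y hy => hy.1.2)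
    (hspan ▸ subset_affineSpan ℝ F' hz)⟩

theorem eventually_notMem_inter_facets (hF : F ∈ facets S) (hF' : F' ∈ facets S) (hne : F ≠ F')
    (π : Fin k → X →L[ℝ] ℝ) : ∀ᶠ x in generic π, x ∉ F ∩ F' := by
  rw [eventually_notMem_generic]
  rcases (F ∩ F').eq_empty_or_nonempty with hempty | hinter
  · simp [hempty]
  · have := ((isPolyhedron_of_mem_facets hF).inter
      (isPolyhedron_of_mem_facets hF')).finiteDimensional
    refine volume_proj_image_eq_zero_of_finrank_lt ?_
    rw [Fintype.card_fin]
    by_contra! hrank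
    refine hne (Subset.antisymm ?_ (facet_subset_of_le_finrank_inter hF hF' hinter hrank))
    rw [inter_comm] at hinter hrank
    exact facet_subset_of_le_finrank_inter hF' hF hinter hrank

theorem eventually_facet_unique (S : OrientedPolyhedron X (k + 1)) (π : Fin k → X →L[ℝ] ℝ) :
    ∀ᶠ x in generic π, ∀ F F' : facets S, x ∈ (F : Set X) → x ∈ (F' : Set X) → F' = F := by
  refine eventually_all.2 fun F => eventually_all.2 fun F' => ?_
  rcases eq_or_ne F' F with h | h
  · exact Eventually.of_forall fun _ _ _ => h
  · filter_upwards [eventually_notMem_inter_facets F.2 F'.2 (Subtype.coe_ne_coe.2 h.symm) π]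
      with x hx hF hF' using absurd ⟨hF, hF'⟩ hx

theorem eventually_eqOn_or_level_mem_facets (π : Fin k → X →L[ℝ] ℝ)
    (hf : ∀ z ∈ S.carrier, f z ≤ c) :
    ∀ᶠ x in generic π, x ∈ S.carrier → f x = c →
      (∀ z ∈ S.carrier, f z = c) ∨ {z ∈ S.carrier | f z = c} ∈ facets S := by
  have := S.finiteDimensional
  by_cases hall : ∀ z ∈ S.carrier, f z = c
  · exact Eventually.of_forall fun _ _ _ => Or.inl hall
  push Not at hall
  obtain ⟨z, hz, hfz⟩ := hall
  by_cases hrank : Module.finrank ℝ (vectorSpan ℝ {z ∈ S.carrier | f z = c}) = k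
  · exact Eventually.of_forall fun x hx hfx => Or.inr (level_mem_facets hf ⟨x, hx, hfx⟩ hrank)
  by_cases hlt : Module.finrank ℝ (vectorSpan ℝ {z ∈ S.carrier | f z = c}) < k
  · have : FiniteDimensional ℝ (vectorSpan ℝ {z ∈ S.carrier | f z = c}) :=
      finiteDimensional_vectorSpan_of_subset fun z hz => hz.1
    filter_upwards [eventually_notMem_generic.2 (volume_proj_image_eq_zero_of_finrank_lt
      (π := π) (hlt.trans_eq (Fintype.card_fin k).symm))] with x hlevel hx hfx
    exact absurd ⟨hx, hfx⟩ hlevel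
  · refine Eventually.of_forall fun x hx hfx => absurd ?_ hlt
    have hlt' := finrank_vectorSpan_level_lt hx hfx hz hfz
    rw [S.finrank_vectorSpan] at hlt'
    lia

theorem linearIndependent_cons_facet_frame (F : facets S) {x y : X} (hy : y ∈ (F : Set X))
    (hx : x ∈ S.carrier \ F) :
    LinearIndependent ℝ (Fin.cons (y - x) (facet S F).frame : Fin (k + 1) → X) := by
  obtain ⟨l, c, -, hF⟩ := exists_facet_eq_level F.2
  refine linearIndependent_finCons.2 ⟨(facet S F).linearIndependent, fun hmem => hx.2 ?_⟩
  rw [(facet S F).span_frame] at hmem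
  have hlF : ∀ z ∈ (F : Set X), l z = c := fun z hz => (hF.le hz).2
  have hzero := apply_eq_zero_of_mem_vectorSpan hlF hmem
  rw [map_sub, hlF y hy, sub_eq_zero] at hzero
  exact hF.ge ⟨hx.1, hzero.symm⟩

theorem cons_facet_frame_mem_span (F : facets S) {x y : X} (hy : y ∈ (F : Set X))
    (hx : x ∈ S.carrier) (j : Fin (k + 1)) :
    (Fin.cons (y - x) (facet S F).frame : Fin (k + 1) → X) j ∈
      Submodule.span ℝ (range S.frame) := by
  refine Fin.cases (S.sub_mem_span (facet_subset F.2 hy) hx) (fun j => ?_) j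
  rw [Fin.cons_succ, S.span_frame]
  refine vectorSpan_mono ℝ (facet_subset F.2) ?_
  exact (facet S F).span_frame.le (Submodule.subset_span ⟨j, rfl⟩)

theorem vectorSpan_eq_span_sup_vectorSpan_facet (F : facets S) {x y : X} (hy : y ∈ (F : Set X))
    (hx : x ∈ S.carrier \ F) :
    vectorSpan ℝ S.carrier = Submodule.span ℝ {y - x} ⊔ vectorSpan ℝ (F : Set X) := by
  have := S.finiteDimensional
  have hspan : vectorSpan ℝ (F : Set X) = Submodule.span ℝ (range (facet S F).frame) :=
    (facet S F).span_frame.symm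
  rw [hspan, ← Submodule.span_union, ← insert_eq, ← Fin.range_cons]
  refine (Submodule.eq_of_le_of_finrank_eq ?_ ?_).symm
  · rw [Submodule.span_le, ← S.span_frame]
    exact range_subset_iff.2 (cons_facet_frame_mem_span F hy hx.1)
  · rw [S.finrank_vectorSpan, finrank_span_eq_card (linearIndependent_cons_facet_frame F hy hx),
      Fintype.card_fin]

theorem apply_sub_pos_of_facet {l : X →L[ℝ] ℝ} (hl : ∀ z ∈ S.carrier, l z ≤ c)
    (hF : F = {z ∈ S.carrier | l z = c}) {x y : X} (hy : y ∈ F) (hx : x ∈ S.carrier \ F) :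
    0 < l (y - x) := by
  subst hF
  rw [map_sub, sub_pos, hy.2]
  exact (hl x hx.1).lt_of_ne fun h => hx.2 ⟨hx.1, h⟩

theorem apply_nonpos_iff_of_facet {l l' : X →L[ℝ] ℝ} {c' : ℝ} (F : facets S)
    (hl : ∀ z ∈ S.carrier, l z ≤ c) (hF : F = {z ∈ S.carrier | l z = c})
    (hl' : ∀ z ∈ S.carrier, l' z ≤ c') (hF' : F = {z ∈ S.carrier | l' z = c'})
    {d : X} (hd : d ∈ vectorSpan ℝ S.carrier) : l d ≤ 0 ↔ l' d ≤ 0 := by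
  obtain ⟨x, hx⟩ := exists_mem_diff_facet F.2
  obtain ⟨y, hy⟩ := F.2.2.1
  rw [vectorSpan_eq_span_sup_vectorSpan_facet F hy hx, Submodule.mem_sup] at hd
  obtain ⟨_, hn, v, hv, rfl⟩ := hd
  obtain ⟨a, rfl⟩ := Submodule.mem_span_singleton.1 hn
  have hnonpos : ∀ {m : X →L[ℝ] ℝ} {b : ℝ}, (∀ z ∈ S.carrier, m z ≤ b) →
      F = {z ∈ S.carrier | m z = b} → (m (a • (y - x) + v) ≤ 0 ↔ a ≤ 0) := fun hm hFm => by
    rw [map_add, apply_eq_zero_of_mem_vectorSpan (fun z hz => (hFm.le hz).2) hv, add_zero, map_smul,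
      smul_eq_mul]
    have hpos := apply_sub_pos_of_facet hm hFm hy hx
    exact ⟨fun h => nonpos_of_mul_nonpos_left h hpos,
      fun h => mul_nonpos_of_nonpos_of_nonneg h hpos.le⟩
  rw [hnonpos hl hF, hnonpos hl' hF']

theorem eventually_feasibleCone_eq_vectorSpan (S : OrientedPolyhedron X (k + 1))
    (π : Fin k → X →L[ℝ] ℝ) :
    ∀ᶠ x in generic π, x ∈ S.carrier → (∀ F ∈ facets S, x ∉ F) →
      feasibleCone S.carrier x = vectorSpan ℝ S.carrier := by
  obtain ⟨-, A, L, -, hS⟩ := id S.isPolyhedron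
  have hfaces := (eventually_all_finset L).2 fun p hp =>
    eventually_eqOn_or_level_mem_facets (S := S) π fun z hz => (hS.le hz).2 p hp
  filter_upwards [hfaces] with x hx hxS hxF
  refine Subset.antisymm (fun d => mem_vectorSpan_of_mem_feasibleCone) fun d hd => ?_
  refine mem_feasibleCone_of_constraints hS hxS hd fun p hp hpx => ?_
  rcases hx p hp hxS hpx with hconst | hfacet
  · exact (apply_eq_zero_of_mem_vectorSpan hconst hd).le
  · exact absurd ⟨hxS, hpx⟩ (hxF _ hfacet)

theorem eventually_mem_feasibleCone_iff_of_mem_facet (S : OrientedPolyhedron X (k + 1))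
    (π : Fin k → X →L[ℝ] ℝ) :
    ∀ᶠ x in generic π, ∀ F : facets S, x ∈ (F : Set X) → ∀ (l : X →L[ℝ] ℝ) (c : ℝ),
      (∀ z ∈ S.carrier, l z ≤ c) → F = {z ∈ S.carrier | l z = c} →
        ∀ d ∈ vectorSpan ℝ S.carrier, d ∈ feasibleCone S.carrier x ↔ l d ≤ 0 := by
  obtain ⟨-, A, L, -, hS⟩ := id S.isPolyhedron
  have hL : ∀ p ∈ L, ∀ z ∈ S.carrier, p.1 z ≤ p.2 := fun p hp z hz => (hS.le hz).2 p hp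
  have hfaces := (eventually_all_finset L).2 fun p hp =>
    eventually_eqOn_or_level_mem_facets (S := S) π (hL p hp)
  filter_upwards [hfaces, eventually_facet_unique S π] with x hx hunique F hxF l c hl hF d hd
  obtain ⟨hxS, hlx⟩ := hF.le hxF
  refine ⟨fun h => ?_, fun h => mem_feasibleCone_of_constraints hS hxS hd fun p hp hpx => ?_⟩
  · exact (mem_feasibleCone_halfspace_iff_of_eq hlx).1 (feasibleCone_mono hl h)
  · rcases hx p hp hxS hpx with hconst | hfacet
    · exact (apply_eq_zero_of_mem_vectorSpan hconst hd).le
    · have hFp := hunique F ⟨_, hfacet⟩ hxF ⟨hxS, hpx⟩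
      exact (apply_nonpos_iff_of_facet F hl hF (hL p hp) (congrArg Subtype.val hFp).symm hd).1 h

end Facets

section Boundary

variable {S : OrientedPolyhedron X (k + 1)}

open Classical in
/-- The sign of the orientation that `S` induces on its facet `F`, relative to the chosen
orientation of `facet S F`. -/
def inducedSign (S : OrientedPolyhedron X (k + 1)) (F : facets S) : ℤ :=
  if IsInducedOrientation S F then 1 else -1

theorem inducedSign_mul_self (F : facets S) : inducedSign S F * inducedSign S F = 1 := by
  rw [inducedSign]
  split_ifs <;> rfl

theorem boundary_single (S : OrientedPolyhedron X (k + 1)) (g : G) :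
    boundary (Finsupp.single S g) =
      ∑ F : facets S, Finsupp.single (facet S F) (inducedSign S F • g) := by
  rw [boundary, Finsupp.sum_single_index]
  · refine Finset.sum_congr rfl fun F _ => ?_
    rw [inducedSign, ite_smul, one_smul, neg_one_smul, apply_ite (Finsupp.single (facet S F))]
  · simp only [neg_zero, Finsupp.single_zero, ite_self, Finset.sum_const_zero]

theorem boundary_zero : boundary (0 : FormalSum X G (k + 1)) = 0 :=
  Finsupp.sum_zero_index

theorem boundary_add (P Q : FormalSum X G (k + 1)) :
    boundary (P + Q) = boundary P + boundary Q := by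
  classical
  refine Finsupp.sum_add_index' (fun S => ?_) fun S g h => ?_
  · simp only [neg_zero, Finsupp.single_zero, ite_self, Finset.sum_const_zero]
  · rw [← Finset.sum_add_distrib]
    refine Finset.sum_congr rfl fun F _ => ?_
    split_ifs
    · rw [Finsupp.single_add]
    · rw [neg_add, Finsupp.single_add]

theorem exists_outward_change_of_frame (F : facets S) :
    ∃ y ∈ (F : Set X), ∃ x ∈ S.carrier \ F, ∃ A : Matrix (Fin (k + 1)) (Fin (k + 1)) ℝ,
      (∀ j, (Fin.cons (y - x) (facet S F).frame : Fin (k + 1) → X) j = ∑ i, A i j • S.frame i) ∧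
      inducedSign S F = SignType.sign A.det := by
  by_cases hinduced : IsInducedOrientation S F
  · obtain ⟨y, hy, x, hx, A, hA, hdet⟩ := id hinduced
    refine ⟨y, hy, x, hx, A, hA, ?_⟩
    rw [inducedSign, if_pos hinduced, sign_pos hdet, SignType.coe_one]
  · obtain ⟨y, hy⟩ := F.2.2.1
    obtain ⟨x, hx⟩ := exists_mem_diff_facet F.2
    obtain ⟨A, hA, hdet⟩ := exists_change_of_frame (linearIndependent_cons_facet_frame F hy hx)
      (cons_facet_frame_mem_span F hy hx.1)
    have hneg : A.det < 0 :=
      hdet.lt_or_gt.resolve_right fun hpos => hinduced ⟨y, hy, x, hx, A, hA, hpos⟩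
    refine ⟨y, hy, x, hx, A, hA, ?_⟩
    rw [inducedSign, if_neg hinduced, sign_neg hneg, SignType.coe_neg_one]

theorem inducedSign_mul_sign_minor_facet (π : Fin k → X →L[ℝ] ℝ) (F : facets S)
    {l : X →L[ℝ] ℝ} {c : ℝ} (hl : ∀ z ∈ S.carrier, l z ≤ c)
    (hF : F = {z ∈ S.carrier | l z = c}) :
    inducedSign S F * SignType.sign (minor π (facet S F).frame) =
      SignType.sign (l (fiberDir π S.frame)) := by
  obtain ⟨y, hy, x, hx, A, hA, hsign⟩ := exists_outward_change_of_frame F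
  have hframe : ∀ i, l ((facet S F).frame i) = 0 := fun i =>
    apply_eq_zero_of_mem_vectorSpan (fun z hz => (hF.le hz).2)
      ((facet S F).span_frame.le (Submodule.subset_span ⟨i, rfl⟩))
  have hminor : l (y - x) * minor π (facet S F).frame = A.det * l (fiberDir π S.frame) := by
    rw [← minor_cons_cons π (y - x) hframe, minor_change_of_frame _ hA, apply_fiberDir]
  have hsign_minor : SignType.sign (minor π (facet S F).frame) =
      SignType.sign A.det * SignType.sign (l (fiberDir π S.frame)) := by
    rw [← sign_mul, ← hminor, sign_mul, sign_pos (apply_sub_pos_of_facet hl hF hy hx), one_mul]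
  rw [hsign_minor, SignType.coe_mul, ← hsign, ← mul_assoc, inducedSign_mul_self, one_mul]

theorem indicator_halfspace_sub_indicator_halfspace (l : X →L[ℝ] ℝ) (d : X) :
    {d | l d ≤ 0}.indicator (1 : X → ℤ) (-d) - {d | l d ≤ 0}.indicator 1 d =
      SignType.sign (l d) := by
  rcases lt_trichotomy (l d) 0 with h | h | h
  · simp [indicator, h.le, h.not_ge, sign_neg h]
  · simp [indicator, h]
  · simp [indicator, h.le, h.not_ge, sign_pos h]

theorem eventually_sum_inducedSign_mul_multiplicity (π : Fin k → X →L[ℝ] ℝ)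
    (S : OrientedPolyhedron X (k + 1)) :
    ∀ᶠ x in generic π, ∑ F : facets S, inducedSign S F * multiplicity π x (facet S F) =
      fiberMultiplicity π x S := by
  filter_upwards [eventually_facet_unique S π, eventually_feasibleCone_eq_vectorSpan S π,
    eventually_mem_feasibleCone_iff_of_mem_facet S π] with x hunique hinterior hboundary
  have hd : fiberDir π S.frame ∈ vectorSpan ℝ S.carrier :=
    S.span_frame ▸ fiberDir_mem_span π S.frame
  by_cases hF : ∃ F : facets S, x ∈ (F : Set X)
  · obtain ⟨F, hxF⟩ := hF
    obtain ⟨l, c, hl, hFl⟩ := exists_facet_eq_level F.2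
    have hcone := hboundary F hxF l c hl hFl
    rw [Finset.sum_eq_single_of_mem F (Finset.mem_univ _) fun F' _ hne => ?_,
      multiplicity_of_mem hxF, inducedSign_mul_sign_minor_facet π F hl hFl,
      ← indicator_halfspace_sub_indicator_halfspace, fiberMultiplicity]
    · exact congrArg₂ _ (indicator_eq_indicator (hcone _ (neg_mem hd)).symm rfl)
        (indicator_eq_indicator (hcone _ hd).symm rfl)
    · rw [multiplicity_of_notMem fun h => hne (hunique F F' hxF h), mul_zero]
  · push Not at hF
    rw [Finset.sum_eq_zero fun F _ => by
      rw [multiplicity_of_notMem (S := facet S F) (hF F), mul_zero]]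
    by_cases hx : x ∈ S.carrier
    · rw [fiberMultiplicity, hinterior hx fun F h => hF ⟨F, h⟩, indicator_of_mem (neg_mem hd),
        indicator_of_mem hd]
      simp
    · rw [fiberMultiplicity_of_notMem hx]

theorem density_boundary (π : Fin k → X →L[ℝ] ℝ) (P : FormalSum X G (k + 1)) :
    ∀ᶠ x in generic π, density π x (boundary P) = fiberDensity π x P := by
  induction P using Finsupp.induction_linear with
  | zero => simp [boundary_zero]
  | add P Q hP hQ =>
    filter_upwards [hP, hQ] with x hxP hxQ
    rw [boundary_add, map_add, map_add, hxP, hxQ]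
  | single S g =>
    filter_upwards [eventually_sum_inducedSign_mul_multiplicity π S] with x hx
    rw [boundary_single, map_sum, fiberDensity, weightedSum_single, ← hx, Finset.sum_smul]
    refine Finset.sum_congr rfl fun F _ => ?_
    rw [density, weightedSum_single, smul_smul, mul_comm]

end Boundary

/-! ### Slices by hyperplanes -/

section Restriction

variable {π : Fin k → X →L[ℝ] ℝ} {f : X →L[ℝ] ℝ} {r : ℝ} {x : X}

theorem restrict_zero : restrict f r (0 : FormalSum X G k) = 0 :=
  Finsupp.sum_zero_index

theorem restrict_add (f : X →L[ℝ] ℝ) (r : ℝ) (P Q : FormalSum X G k) :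
    restrict f r (P + Q) = restrict f r P + restrict f r Q := by
  classical
  refine Finsupp.sum_add_index' (fun S => ?_) fun S g h => ?_
  · simp only [Finsupp.single_zero, dite_eq_ite, ite_self]
  · split_ifs
    · rw [Finsupp.single_add]
    · rw [add_zero]

theorem restrict_single_of_nonempty {S : OrientedPolyhedron X k} (g : G)
    (h : (S.carrier ∩ {x | f x < r}).Nonempty) :
    restrict f r (Finsupp.single S g) = Finsupp.single (cut S f r h) g := by
  rw [restrict, Finsupp.sum_single_index, dif_pos h]
  rw [dif_pos h, Finsupp.single_zero]

theorem restrict_single_of_eq_empty {S : OrientedPolyhedron X k} (g : G)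
    (h : S.carrier ∩ {x | f x < r} = ∅) : restrict f r (Finsupp.single S g) = 0 := by
  rw [restrict, Finsupp.sum_single_index, dif_neg (not_nonempty_iff_eq_empty.2 h)]
  rw [dif_neg (not_nonempty_iff_eq_empty.2 h)]

theorem eventually_notMem_level (S : OrientedPolyhedron X k) (π : Fin k → X →L[ℝ] ℝ)
    {y : X} (hy : y ∈ S.carrier) (hfy : f y ≠ r) :
    ∀ᶠ x in generic π, x ∉ {z ∈ S.carrier | f z = r} := by
  rw [eventually_notMem_generic]
  rcases {z ∈ S.carrier | f z = r}.eq_empty_or_nonempty with hempty | ⟨x, hx, hfx⟩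
  · rw [hempty, image_empty, measure_empty]
  · have := S.finiteDimensional
    have : FiniteDimensional ℝ (vectorSpan ℝ {z ∈ S.carrier | f z = r}) :=
      finiteDimensional_vectorSpan_of_subset fun z hz => hz.1
    refine volume_proj_image_eq_zero_of_finrank_lt ?_
    exact (finrank_vectorSpan_level_lt hx hfx hy hfy).trans_eq
      (S.finrank_vectorSpan.trans (Fintype.card_fin k).symm)

theorem multiplicity_cut {S : OrientedPolyhedron X k} (h : (S.carrier ∩ {x | f x < r}).Nonempty)
    (hx : x ∉ {z ∈ S.carrier | f z = r}) :
    multiplicity π x (cut S f r h) = {z | f z < r}.indicator (fun z => multiplicity π z S) x := by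
  have hmem : x ∈ (cut S f r h).carrier ↔ x ∈ {z | f z < r} ∩ S.carrier :=
    ⟨fun hx' => ⟨lt_of_le_of_ne hx'.2 fun hr => hx ⟨hx'.1, hr⟩, hx'.1⟩,
      fun hx' => ⟨hx'.2, show f x ≤ r from le_of_lt hx'.1⟩⟩
  exact (indicator_eq_indicator hmem rfl).trans (congrFun (indicator_indicator _ _ _).symm x)

theorem density_restrict (π : Fin k → X →L[ℝ] ℝ) (f : X →L[ℝ] ℝ) (r : ℝ)
    (P : FormalSum X G k) : ∀ᶠ x in generic π,
      density π x (restrict f r P) = {z | f z < r}.indicator (fun z => density π z P) x := by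
  induction P using Finsupp.induction_linear with
  | zero => simp [restrict_zero]
  | add P Q hP hQ =>
    filter_upwards [hP, hQ] with x hxP hxQ
    simp only [restrict_add, map_add, indicator_add, hxP, hxQ]
  | single S g =>
    simp only [density, weightedSum_single, indicator_smul_const_apply]
    rcases (S.carrier ∩ {x | f x < r}).eq_empty_or_nonempty with hempty | hne
    · refine Eventually.of_forall fun x => ?_
      rw [restrict_single_of_eq_empty g hempty, map_zero, indicator_apply_eq_zero.2, zero_smul]
      exact fun hfx => multiplicity_of_notMem fun hx => hempty.le ⟨hx, hfx⟩
    · obtain ⟨y, hy, hfy⟩ := id hne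
      filter_upwards [eventually_notMem_level S π hy (ne_of_lt hfy)] with x hx
      rw [restrict_single_of_nonempty g hne, weightedSum_single, multiplicity_cut hne hx]

end Restriction

section RegularLevels

/-- The level `r` of `f` is in general position with respect to the polyhedron `S`: it does not
contain the minimizers or the maximizers of `f` on `S`, and it contains no face of `S` on which `f`
is constant. Almost every level is regular. -/
structure IsRegularLevel (S : Set X) (f : X →L[ℝ] ℝ) (r : ℝ) : Prop where
  not_isLeast : ¬IsLeast (f '' S) r
  not_isGreatest : ¬IsGreatest (f '' S) r
  exists_constraints : ∃ (A : AffineSubspace ℝ X) (L : Finset ((X →L[ℝ] ℝ) × ℝ)),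
    S = {x | x ∈ A ∧ ∀ p ∈ L, p.1 x ≤ p.2} ∧ ∀ p ∈ L, f '' {z ∈ S | p.1 z = p.2} ≠ {r}

variable {C : Set X} {f q : X →L[ℝ] ℝ} {r c : ℝ} {z : X}

theorem ae_isRegularLevel (hC : IsConvexPolyhedron C) (f : X →L[ℝ] ℝ) :
    ∀ᵐ r, IsRegularLevel C f r := by
  obtain ⟨-, A, L, -, hL⟩ := id hC
  have hnull : ∀ {s : Set ℝ}, s.Subsingleton → ∀ᵐ r, r ∉ s := fun hs =>
    measure_eq_zero_iff_ae_notMem.1 (hs.measure_zero volume)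
  have hleast : ∀ᵐ r, r ∉ {r | IsLeast (f '' C) r} := hnull fun _ hr _ hr' => hr.unique hr'
  have hgreatest : ∀ᵐ r, r ∉ {r | IsGreatest (f '' C) r} := hnull fun _ hr _ hr' => hr.unique hr'
  have hfaces : ∀ᵐ r, ∀ p ∈ L, r ∉ {r | f '' {z ∈ C | p.1 z = p.2} = {r}} :=
    (eventually_all_finset L).2 fun p _ => hnull fun _ hr _ hr' =>
      singleton_injective (hr.symm.trans hr')
  filter_upwards [hleast, hgreatest, hfaces] with r hleast hgreatest hfaces
  exact ⟨hleast, hgreatest, A, L, hL, hfaces⟩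

theorem IsRegularLevel.exists_lt (hr : IsRegularLevel C f r) (hz : z ∈ C) (hfz : f z = r) :
    ∃ y ∈ C, f y < r := by
  by_contra! h
  exact hr.not_isLeast ⟨⟨z, hz, hfz⟩, forall_mem_image.2 h⟩

theorem IsRegularLevel.exists_gt (hr : IsRegularLevel C f r) (hz : z ∈ C) (hfz : f z = r) :
    ∃ y ∈ C, r < f y := by
  by_contra! h
  exact hr.not_isGreatest ⟨⟨z, hz, hfz⟩, forall_mem_image.2 h⟩

theorem eventually_eqOn_of_image_level_ne (S : OrientedPolyhedron X (k + 1))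
    (π : Fin k → X →L[ℝ] ℝ) (h : f '' {z ∈ S.carrier | q z = c} ≠ {r}) :
    ∀ᶠ x in generic π, x ∈ S.carrier → f x = r → q x = c → ∀ z ∈ S.carrier, q z = c := by
  have := S.finiteDimensional
  have : FiniteDimensional ℝ (vectorSpan ℝ {z ∈ S.carrier | q z = c}) :=
    finiteDimensional_vectorSpan_of_subset fun z hz => hz.1
  have : FiniteDimensional ℝ (vectorSpan ℝ {z ∈ {z ∈ S.carrier | q z = c} | f z = r}) :=
    finiteDimensional_vectorSpan_of_subset fun z hz => hz.1
  by_cases hrank : Module.finrank ℝ (vectorSpan ℝ {z ∈ {z ∈ S.carrier | q z = c} | f z = r}) < k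
  · filter_upwards [eventually_notMem_generic.2 (volume_proj_image_eq_zero_of_finrank_lt
      (π := π) (hrank.trans_eq (Fintype.card_fin k).symm))] with x hlevel hx hfx hqx
    exact absurd ⟨⟨hx, hqx⟩, hfx⟩ hlevel
  · refine Eventually.of_forall fun x hx hfx hqx => ?_
    by_contra! hnot
    obtain ⟨z, hz, hqz⟩ := hnot
    have hface : ∃ y ∈ {z ∈ S.carrier | q z = c}, f y ≠ r := by
      by_contra! hconst
      exact h (eq_singleton_iff_nonempty_unique_mem.2
        ⟨⟨r, x, ⟨hx, hqx⟩, hfx⟩, forall_mem_image.2 hconst⟩)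
    obtain ⟨y, hy, hfy⟩ := hface
    have hlt := finrank_vectorSpan_level_lt hx hqx hz hqz
    have hlt' := finrank_vectorSpan_level_lt (C := {z ∈ S.carrier | q z = c}) ⟨hx, hqx⟩ hfx hy hfy
    rw [S.finrank_vectorSpan] at hlt
    lia

theorem IsRegularLevel.eventually_feasibleCone_eq_vectorSpan {S : OrientedPolyhedron X (k + 1)}
    (hr : IsRegularLevel S.carrier f r) (π : Fin k → X →L[ℝ] ℝ) :
    ∀ᶠ x in generic π, x ∈ S.carrier → f x = r →
      feasibleCone S.carrier x = vectorSpan ℝ S.carrier := by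
  obtain ⟨A, L, hS, hfaces⟩ := hr.exists_constraints
  filter_upwards [(eventually_all_finset L).2 fun p hp =>
    eventually_eqOn_of_image_level_ne S π (hfaces p hp)] with x hx hxS hfx
  refine Subset.antisymm (fun d => mem_vectorSpan_of_mem_feasibleCone) fun d hd => ?_
  exact mem_feasibleCone_of_constraints hS hxS hd fun p hp hpx =>
    (apply_eq_zero_of_mem_vectorSpan (hx p hp hxS hfx hpx) hd).le

end RegularLevels

section SliceDensity

variable {π : Fin k → X →L[ℝ] ℝ} {S : OrientedPolyhedron X (k + 1)} {f : X →L[ℝ] ℝ} {r : ℝ} {x : X}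

theorem fiberMultiplicity_cut_of_notMem_level (h : (S.carrier ∩ {x | f x < r}).Nonempty)
    (hx : x ∉ {z ∈ S.carrier | f z = r}) : fiberMultiplicity π x (cut S f r h) =
      {z | f z < r}.indicator (fun z => fiberMultiplicity π z S) x := by
  by_cases hlt : x ∈ {z | f z < r}
  · rw [indicator_of_mem hlt]
    exact congrArg (fun K : Set X => K.indicator 1 (-fiberDir π S.frame) -
      K.indicator 1 (fiberDir π S.frame)) (feasibleCone_inter_halfspace_of_lt hlt)
  · rw [indicator_of_notMem hlt]
    exact fiberMultiplicity_of_notMem fun hxS => hx ⟨hxS.1, hxS.2.antisymm (not_lt.1 hlt)⟩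

theorem fiberMultiplicity_cut_of_mem_level (h : (S.carrier ∩ {x | f x < r}).Nonempty)
    (hfx : f x = r) (hx : feasibleCone S.carrier x = vectorSpan ℝ S.carrier) :
    fiberMultiplicity π x (cut S f r h) = SignType.sign (f (fiberDir π S.frame)) := by
  have hd : fiberDir π S.frame ∈ vectorSpan ℝ S.carrier :=
    S.span_frame ▸ fiberDir_mem_span π S.frame
  have hcone : feasibleCone (cut S f r h).carrier x = ↑(vectorSpan ℝ S.carrier) ∩ {d | f d ≤ 0} :=
    hx ▸ feasibleCone_inter_halfspace_of_eq hfx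
  rw [← indicator_halfspace_sub_indicator_halfspace]
  rw [fiberMultiplicity, hcone]
  exact congrArg₂ _ (indicator_eq_indicator (and_iff_right (neg_mem hd)) rfl)
    (indicator_eq_indicator (and_iff_right hd) rfl)

theorem fiberMultiplicity_cut (h : (S.carrier ∩ {x | f x < r}).Nonempty)
    (hx : x ∈ S.carrier → f x = r → feasibleCone S.carrier x = vectorSpan ℝ S.carrier) :
    fiberMultiplicity π x (cut S f r h) =
      {z | f z < r}.indicator (fun z => fiberMultiplicity π z S) x +
        {z ∈ S.carrier | f z = r}.indicator
          (fun _ => (SignType.sign (f (fiberDir π S.frame)) : ℤ)) x := by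
  by_cases hlevel : x ∈ {z ∈ S.carrier | f z = r}
  · have hlt : x ∉ {z | f z < r} := hlevel.2.not_lt
    rw [indicator_of_mem hlevel, indicator_of_notMem hlt, zero_add,
      fiberMultiplicity_cut_of_mem_level h hlevel.2 (hx hlevel.1 hlevel.2)]
  · rw [indicator_of_notMem hlevel, add_zero, fiberMultiplicity_cut_of_notMem_level h hlevel]

theorem IsRegularLevel.eventually_fiberDensity_restrict (hr : IsRegularLevel S.carrier f r)
    (π : Fin k → X →L[ℝ] ℝ) (g : G) :
    ∀ᶠ x in generic π, fiberDensity π x (restrict f r (Finsupp.single S g)) =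
      {z | f z < r}.indicator (fun z => fiberMultiplicity π z S) x • g +
        {z ∈ S.carrier | f z = r}.indicator
          (fun _ => (SignType.sign (f (fiberDir π S.frame)) : ℤ)) x • g := by
  filter_upwards [hr.eventually_feasibleCone_eq_vectorSpan π] with x hx
  rcases (S.carrier ∩ {x | f x < r}).eq_empty_or_nonempty with hempty | hne
  · have hlevel : x ∉ {z ∈ S.carrier | f z = r} := by
      rintro ⟨hxS, hfx⟩
      obtain ⟨y, hy⟩ := hr.exists_lt hxS hfx
      exact hempty.le hy
    rw [restrict_single_of_eq_empty g hempty, map_zero, indicator_of_notMem hlevel, zero_smul,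
      add_zero, indicator_apply_eq_zero.2, zero_smul]
    exact fun hfx => fiberMultiplicity_of_notMem fun hxS => hempty.le ⟨hxS, hfx⟩
  · rw [restrict_single_of_nonempty g hne, fiberDensity, weightedSum_single,
      fiberMultiplicity_cut hne hx, add_smul]

theorem IsRegularLevel.density_slice (hr : IsRegularLevel S.carrier f r)
    (π : Fin k → X →L[ℝ] ℝ) (g : G) :
    ∀ᶠ x in generic π, density π x (slice f r (Finsupp.single S g)) =
      {z ∈ S.carrier | f z = r}.indicator
        (fun _ => (SignType.sign (f (fiberDir π S.frame)) : ℤ)) x • g := by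
  filter_upwards [density_boundary π (restrict f r (Finsupp.single S g)),
    density_restrict π f r (boundary (Finsupp.single S g)),
    density_boundary π (Finsupp.single S g), hr.eventually_fiberDensity_restrict π g]
    with x hcut hrestrict hboundary hdensity
  have hsub : {z | f z < r}.indicator (fun z => density π z (boundary (Finsupp.single S g))) x =
      {z | f z < r}.indicator (fun z => fiberMultiplicity π z S) x • g := by
    rw [← indicator_smul_const_apply]
    refine indicator_eq_indicator Iff.rfl ?_
    rw [hboundary, fiberDensity, weightedSum_single]
  rw [slice, map_sub, hcut, hrestrict, hdensity, hsub, add_sub_cancel_left]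

end SliceDensity

section LevelPolyhedra

variable {C : Set X} {f q : X →L[ℝ] ℝ} {r c : ℝ} {a b x z : X}

theorem exists_apply_add_smul_sub_eq (ha : f a < r) (hb : r < f b) :
    ∃ t ∈ Ioo (0 : ℝ) 1, f (a + t • (b - a)) = r := by
  have hab : 0 < f b - f a := sub_pos.2 (ha.trans hb)
  refine ⟨(r - f a) / (f b - f a), ⟨div_pos (sub_pos.2 ha) hab, ?_⟩, ?_⟩
  · rw [div_lt_one hab]
    exact sub_lt_sub_right hb _
  · rw [map_add, map_smul, map_sub, smul_eq_mul, div_mul_cancel₀ _ hab.ne', add_sub_cancel]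

theorem apply_eq_of_apply_add_smul_sub_eq {t : ℝ} (ht : t ∈ Ioo (0 : ℝ) 1) (ha : q a ≤ c)
    (hb : q b ≤ c) (h : q (a + t • (b - a)) = c) : q a = c ∧ q b = c := by
  rw [map_add, map_smul, map_sub, smul_eq_mul] at h
  exact ⟨by nlinarith [ht.1, ht.2], by nlinarith [ht.1, ht.2]⟩

theorem eqOn_of_eqOn_level (hC : Convex ℝ C) (hq : ∀ z ∈ C, q z ≤ c)
    (hlevel : ∀ z ∈ C, f z = r → q z = c) (ha : a ∈ C) (hfa : f a < r) (hb : b ∈ C)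
    (hfb : r < f b) (hz : z ∈ C) : q z = c := by
  have hends : ∀ a ∈ C, f a < r → ∀ b ∈ C, r < f b → q a = c ∧ q b = c := by
    intro a ha hfa b hb hfb
    obtain ⟨t, ht, hft⟩ := exists_apply_add_smul_sub_eq hfa hfb
    exact apply_eq_of_apply_add_smul_sub_eq ht (hq a ha) (hq b hb)
      (hlevel _ (hC.add_smul_sub_mem ha hb (Ioo_subset_Icc_self ht)) hft)
  rcases lt_trichotomy (f z) r with hlt | heq | hgt
  · exact (hends z hz hlt b hb hfb).1
  · exact hlevel z hz heq
  · exact (hends a ha hfa z hz hgt).2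

theorem IsConvexPolyhedron.level (hC : IsConvexPolyhedron C) (f : X →L[ℝ] ℝ) (r : ℝ) :
    IsConvexPolyhedron {z ∈ C | f z = r} := by
  have hlevel : {z ∈ C | f z = r} = (C ∩ {z | f z ≤ r}) ∩ {z | (-f) z ≤ -r} := by
    rw [inter_assoc]
    refine ext fun z => and_congr_right fun _ => le_antisymm_iff.trans (and_congr_right fun _ => ?_)
    exact neg_le_neg_iff.symm
  exact hlevel ▸ (hC.inter_halfspace f r).inter_halfspace (-f) (-r)

theorem IsConvexPolyhedron.vectorSpan_level (hC : IsConvexPolyhedron C) (ha : a ∈ C)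
    (hfa : f a < r) (hb : b ∈ C) (hfb : r < f b) :
    vectorSpan ℝ {z ∈ C | f z = r} = vectorSpan ℝ C ⊓ f.ker := by
  obtain ⟨-, A, L, -, hL⟩ := id hC
  obtain ⟨t, ht, hft⟩ := exists_apply_add_smul_sub_eq hfa hfb
  have hne : {z ∈ C | f z = r}.Nonempty :=
    ⟨_, hC.convex.add_smul_sub_mem ha hb (Ioo_subset_Icc_self ht), hft⟩
  obtain ⟨x, ⟨hx, hfx⟩, hstrict⟩ := exists_forall_lt_or_eqOn_of_convex (hC.level f r).convex hne L
    fun z hz => (hL.le hz.1).2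
  refine le_antisymm (le_inf (vectorSpan_mono ℝ fun z hz => hz.1) fun d hd =>
    apply_eq_zero_of_mem_vectorSpan (fun z hz => hz.2) hd) ?_
  rintro d ⟨hd, hfd : f d = 0⟩
  have hcone : d ∈ feasibleCone C x := mem_feasibleCone_of_constraints hL hx hd fun p hp hpx => by
    have hlevel : ∀ z ∈ C, f z = r → p.1 z = p.2 := fun z hz hfz =>
      (hstrict p hp).resolve_left hpx.not_lt z ⟨hz, hfz⟩
    have hall : ∀ z ∈ C, p.1 z = p.2 := fun z =>
      eqOn_of_eqOn_level hC.convex (fun z hz => (hL.le hz).2 p hp) hlevel ha hfa hb hfb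
    exact (apply_eq_zero_of_mem_vectorSpan hall hd).le
  refine mem_vectorSpan_of_mem_feasibleCone (x := x) (mem_feasibleCone.2 ?_)
  filter_upwards [mem_feasibleCone.1 hcone] with s hs
  exact ⟨hs, by rw [map_add, map_smul, hfd, smul_zero, add_zero, hfx]⟩

theorem finrank_inf_ker_add_one {W : Submodule ℝ X} [FiniteDimensional ℝ W] {d : X} (hd : d ∈ W)
    (hfd : f d ≠ 0) :
    Module.finrank ℝ (W ⊓ f.ker : Submodule ℝ X) + 1 = Module.finrank ℝ W := by
  have hne : f.toLinearMap ∘ₗ W.subtype ≠ 0 := fun h => hfd (LinearMap.congr_fun h ⟨d, hd⟩)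
  rw [← Module.Dual.finrank_ker_add_one_of_ne_zero hne, LinearMap.ker_comp,
    ← Submodule.map_comap_subtype, Submodule.finrank_map_subtype_eq]

variable {S : OrientedPolyhedron X (k + 1)} {T : OrientedPolyhedron X k}

theorem exists_orientedPolyhedron_level (ha : a ∈ S.carrier) (hfa : f a < r) (hb : b ∈ S.carrier)
    (hfb : r < f b) : ∃ T : OrientedPolyhedron X k, T.carrier = {z ∈ S.carrier | f z = r} := by
  have := S.finiteDimensional
  have hspan := S.isPolyhedron.vectorSpan_level ha hfa hb hfb
  have hba : f (b - a) ≠ 0 := by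
    rw [map_sub]
    exact (sub_pos.2 (hfa.trans hfb)).ne'
  have hrank : Module.finrank ℝ (vectorSpan ℝ {z ∈ S.carrier | f z = r}) = k := by
    have hadd := finrank_inf_ker_add_one (vsub_mem_vectorSpan ℝ hb ha) hba
    rw [← hspan, S.finrank_vectorSpan] at hadd
    exact Nat.succ_injective hadd
  obtain ⟨w, hw, hw_span⟩ := exists_frame (S.isPolyhedron.level f r) hrank
  obtain ⟨t, ht, hft⟩ := exists_apply_add_smul_sub_eq hfa hfb
  exact ⟨⟨_, S.isPolyhedron.level f r,
    ⟨_, S.convex.add_smul_sub_mem ha hb (Ioo_subset_Icc_self ht), hft⟩, w, hw, hw_span⟩, rfl⟩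

theorem exists_apply_fiberDir_eq_mul_minor (hT : T.carrier = {z ∈ S.carrier | f z = r})
    (ha : a ∈ S.carrier) (hfa : f a ≠ r) :
    ∃ c : ℝ, c ≠ 0 ∧ ∀ π : Fin k → X →L[ℝ] ℝ, f (fiberDir π S.frame) = c * minor π T.frame := by
  obtain ⟨b, hb⟩ := T.nonempty
  rw [hT] at hb
  have hn : f (b - a) ≠ 0 := by
    rw [map_sub, hb.2]
    exact sub_ne_zero.2 hfa.symm
  have hframe : ∀ i, T.frame i ∈ vectorSpan ℝ {z ∈ S.carrier | f z = r} := fun i =>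
    hT ▸ T.span_frame.le (Submodule.subset_span ⟨i, rfl⟩)
  have hker : ∀ d ∈ vectorSpan ℝ {z ∈ S.carrier | f z = r}, f d = 0 := fun d hd =>
    apply_eq_zero_of_mem_vectorSpan (fun z hz => hz.2) hd
  have hli : LinearIndependent ℝ (Fin.cons (b - a) T.frame : Fin (k + 1) → X) := by
    refine linearIndependent_finCons.2 ⟨T.linearIndependent, fun hmem => hn (hker _ ?_)⟩
    rwa [T.span_frame, hT] at hmem
  obtain ⟨A, hA, hdet⟩ := exists_change_of_frame (v := S.frame) hli fun j => by
    refine Fin.cases (S.sub_mem_span hb.1 ha) (fun j => ?_) j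
    rw [Fin.cons_succ, S.span_frame]
    exact vectorSpan_mono ℝ (fun z hz => hz.1) (hframe j)
  refine ⟨A.det⁻¹ * f (b - a), mul_ne_zero (inv_ne_zero hdet) hn, fun π => ?_⟩
  rw [apply_fiberDir, mul_assoc, ← minor_cons_cons π (b - a) fun i => hker _ (hframe i),
    minor_change_of_frame _ hA, inv_mul_cancel_left₀ hdet]

theorem IsRegularLevel.toChain_slice (hr : IsRegularLevel S.carrier f r) (g : G)
    (hT : T.carrier = {z ∈ S.carrier | f z = r})
    (hc : ∀ π : Fin k → X →L[ℝ] ℝ, f (fiberDir π S.frame) = c * minor π T.frame) :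
    (slice f r (Finsupp.single S g)).toChain =
      FormalSum.toChain (Finsupp.single T ((SignType.sign c : ℤ) • g)) := by
  refine toChain_eq_of_density_eq fun π => ?_
  filter_upwards [hr.density_slice π g] with x hx
  rw [hx, ← hT, hc, sign_mul, SignType.coe_mul, density, weightedSum_single, smul_smul, mul_comm,
    multiplicity, indicator_mul_const]

theorem IsRegularLevel.toChain_slice_of_level_eq_empty (hr : IsRegularLevel S.carrier f r) (g : G)
    (h : {z ∈ S.carrier | f z = r} = ∅) : (slice f r (Finsupp.single S g)).toChain = 0 := by
  rw [← toChain_zero]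
  refine toChain_eq_of_density_eq fun π => ?_
  filter_upwards [hr.density_slice π g] with x hx
  rw [hx, h, indicator_of_notMem (notMem_empty x), zero_smul, map_zero]

end LevelPolyhedra

/-! ### Volumes of projections and the mass of simple chains -/

section ProjVolume

/-- The `k`-dimensional mass of a set: the supremum of the Lebesgue measures of its images in `ℝᵏ`
under the maps whose components have norm `1`. -/
def projVolume (k : ℕ) (S : Set X) : ℝ≥0∞ :=
  ⨆ (π : Fin k → X →L[ℝ] ℝ) (_ : ∀ i, ‖π i‖ = 1), volume (proj π '' S)

theorem volume_proj_image_le_projVolume {π : Fin k → X →L[ℝ] ℝ} (hπ : ∀ i, ‖π i‖ = 1)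
    (S : Set X) : volume (proj π '' S) ≤ projVolume k S :=
  le_iSup₂ (f := fun (π : Fin k → X →L[ℝ] ℝ) (_ : ∀ i, ‖π i‖ = 1) => volume (proj π '' S)) π hπ

theorem projVolume_empty (k : ℕ) : projVolume k (∅ : Set X) = 0 := by
  simp [projVolume]

theorem projVolume_zero {S : Set X} (hS : S.Nonempty) : projVolume 0 S = 1 := by
  have hvolume (π : Fin 0 → X →L[ℝ] ℝ) : volume (proj π '' S) = 1 := by
    rw [Subsingleton.eq_univ_of_nonempty (hS.image (proj π)), volume_pi, Measure.pi_of_empty]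
    simp
  simp [projVolume, hvolume]

variable (f : X →L[ℝ] ℝ) (π : Fin k → X →L[ℝ] ℝ) {S : Set X}

theorem volume_proj_cons_image (hS : IsCompact S) :
    volume (proj (Fin.cons f π : Fin (k + 1) → X →L[ℝ] ℝ) '' S) =
      volume (f.prod (proj π) '' S) := by
  have hpreserving := volume_preserving_piFinSuccAbove (fun _ : Fin (k + 1) => ℝ) 0
  rw [← hpreserving.measure_preimage
    (hS.image (f.prod (proj π)).continuous).measurableSet.nullMeasurableSet,
    ← MeasurableEquiv.image_symm, image_image]
  refine congrArg volume (image_congr fun z _ => ?_)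
  trans (Fin.cons (f z) (proj π z) : Fin (k + 1) → ℝ)
  · ext i
    refine Fin.cases ?_ (fun i => ?_) i <;> rfl
  · exact (Fin.insertNth_zero' (f z) (proj π z)).symm

theorem preimage_mk_image_prod_proj (S : Set X) (r : ℝ) :
    Prod.mk r ⁻¹' (f.prod (proj π) '' S) = proj π '' {z ∈ S | f z = r} := by
  ext y
  simp [Prod.ext_iff, and_assoc]

theorem measurable_volume_proj_level (hS : IsCompact S) :
    Measurable fun r => volume (proj π '' {z ∈ S | f z = r}) := by
  simpa only [preimage_mk_image_prod_proj] using
    measurable_measure_prodMk_left (ν := (volume : Measure (Fin k → ℝ)))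
      (hS.image (f.prod (proj π)).continuous).measurableSet

theorem lintegral_volume_proj_level (hS : IsCompact S) :
    ∫⁻ r, volume (proj π '' {z ∈ S | f z = r}) =
      volume (proj (Fin.cons f π : Fin (k + 1) → X →L[ℝ] ℝ) '' S) := by
  rw [volume_proj_cons_image f π hS, Measure.volume_eq_prod,
    Measure.prod_apply (hS.image (f.prod (proj π)).continuous).measurableSet]
  simp only [preimage_mk_image_prod_proj]

variable {f} in
theorem volume_proj_level_eq {w : Fin k → X}
    (hw : vectorSpan ℝ S ⊓ f.ker ≤ Submodule.span ℝ (range w)) {π₀ : Fin k → X →L[ℝ] ℝ}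
    (hπ₀ : minor π₀ w = 1) (r : ℝ) :
    volume (proj π '' {z ∈ S | f z = r}) =
      ENNReal.ofReal |minor π w| * volume (proj π₀ '' {z ∈ S | f z = r}) := by
  rcases {z ∈ S | f z = r}.eq_empty_or_nonempty with hempty | ⟨x₀, hx₀, hfx₀⟩
  · simp [hempty]
  · have hsub : ∀ x ∈ {z ∈ S | f z = r}, x - x₀ ∈ Submodule.span ℝ (range w) := by
      rintro x ⟨hx, hfx⟩
      refine hw ⟨vsub_mem_vectorSpan ℝ hx hx₀, ?_⟩
      change f (x - x₀) = 0
      rw [map_sub, hfx, hfx₀, sub_self]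
    rw [volume_proj_image π w x₀ hsub, volume_proj_image π₀ w x₀ hsub, hπ₀, abs_one,
      ENNReal.ofReal_one, one_mul]

variable {f} in
theorem exists_linearIndependent_inf_ker_le_span {W : Submodule ℝ X}
    (hW : Module.finrank ℝ W = k + 1) {d : X} (hd : d ∈ W) (hfd : f d ≠ 0) :
    ∃ w : Fin k → X, LinearIndependent ℝ w ∧ W ⊓ f.ker ≤ Submodule.span ℝ (range w) := by
  have := Module.finite_of_finrank_eq_succ hW
  have hrank : Module.finrank ℝ (W ⊓ f.ker : Submodule ℝ X) = k :=
    Nat.succ_injective ((finrank_inf_ker_add_one hd hfd).trans hW)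
  let b := Module.finBasisOfFinrankEq ℝ _ hrank
  refine ⟨_, b.linearIndependent.map' _ (Submodule.ker_subtype _), ?_⟩
  rw [range_comp, Submodule.span_image, b.span_eq, Submodule.map_top, Submodule.range_subtype]

theorem lintegral_projVolume_level (S : OrientedPolyhedron X (k + 1)) :
    ∫⁻ r, projVolume k {z ∈ S.carrier | f z = r} =
      ⨆ (π : Fin k → X →L[ℝ] ℝ) (_ : ∀ i, ‖π i‖ = 1),
        volume (proj (Fin.cons f π : Fin (k + 1) → X →L[ℝ] ℝ) '' S.carrier) := by
  simp_rw [← lintegral_volume_proj_level f _ S.isCompact]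
  refine le_antisymm ?_ (iSup₂_le fun π hπ =>
    lintegral_mono fun r => volume_proj_image_le_projVolume hπ _)
  by_cases hconst : ∃ d ∈ vectorSpan ℝ S.carrier, f d ≠ 0
  · obtain ⟨d, hd, hfd⟩ := hconst
    obtain ⟨w, hw, hle⟩ := exists_linearIndependent_inf_ker_le_span S.finrank_vectorSpan hd hfd
    obtain ⟨π₀, hπ₀⟩ := exists_minor_eq_one hw
    have hmeasurable := measurable_volume_proj_level f π₀ S.isCompact
    have hlevel (π : Fin k → X →L[ℝ] ℝ) : ∫⁻ r, volume (proj π '' {z ∈ S.carrier | f z = r}) =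
        ENNReal.ofReal |minor π w| * ∫⁻ r, volume (proj π₀ '' {z ∈ S.carrier | f z = r}) := by
      rw [← lintegral_const_mul _ hmeasurable]
      exact lintegral_congr (volume_proj_level_eq π hle hπ₀)
    -- The levels of `f` are parallel, so the ratio of two projected volumes does not depend on `r`.
    have hsup (r : ℝ) : projVolume k {z ∈ S.carrier | f z = r} =
        (⨆ (π : Fin k → X →L[ℝ] ℝ) (_ : ∀ i, ‖π i‖ = 1), ENNReal.ofReal |minor π w|) *
          volume (proj π₀ '' {z ∈ S.carrier | f z = r}) := by
      rw [ENNReal.iSup_mul]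
      refine iSup_congr fun π => ?_
      rw [ENNReal.iSup_mul, volume_proj_level_eq π hle hπ₀]
    rw [lintegral_congr hsup, lintegral_const_mul _ hmeasurable, ENNReal.iSup_mul]
    refine iSup_mono fun π => ?_
    rw [ENNReal.iSup_mul, hlevel π]
  · push Not at hconst
    obtain ⟨x₀, hx₀⟩ := S.nonempty
    have hzero : ∀ᵐ r, projVolume k {z ∈ S.carrier | f z = r} = 0 := by
      filter_upwards [Measure.ae_ne volume (f x₀)] with r hr
      have hempty : {z ∈ S.carrier | f z = r} = ∅ := by
        refine eq_empty_of_forall_notMem fun z hz => hr ?_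
        rw [← hz.2, ← sub_eq_zero, ← map_sub]
        exact hconst _ (vsub_mem_vectorSpan ℝ hz.1 hx₀)
      rw [hempty, projVolume_empty]
    rw [lintegral_congr_ae hzero, lintegral_zero]
    exact zero_le

end ProjVolume

section ProjDensity

/-- The density at `y` of the image under `proj π` of the part of `P` in `U`, every summand being
counted with the norm of its coefficient. -/
def projDensity (π : Fin k → X →L[ℝ] ℝ) (U : Set X) (P : FormalSum X G k) (y : Fin k → ℝ) :
    ℝ≥0∞ :=
  ∑ S ∈ P.support, (proj π '' (S.carrier ∩ U)).indicator 1 y * ‖P S‖ₑ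

variable {π : Fin k → X →L[ℝ] ℝ} {U : Set X} {S : OrientedPolyhedron X k} {Z : Finset X}
  {y : Fin k → ℝ}

theorem OrientedPolyhedron.measurableSet_proj_image_inter (S : OrientedPolyhedron X k)
    (π : Fin k → X →L[ℝ] ℝ) (hU : IsClosed U) : MeasurableSet (proj π '' (S.carrier ∩ U)) :=
  ((S.isCompact.inter_right hU).image (proj π).continuous).measurableSet

theorem measurable_projDensity (π : Fin k → X →L[ℝ] ℝ) (hU : IsClosed U) (P : FormalSum X G k) :
    Measurable (projDensity π U P) :=
  Finset.measurable_fun_sum _ fun S _ =>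
    (measurable_one.indicator (S.measurableSet_proj_image_inter π hU)).mul_const _

theorem lintegral_projDensity (π : Fin k → X →L[ℝ] ℝ) (hU : IsClosed U) (P : FormalSum X G k) :
    ∫⁻ y, projDensity π U P y =
      ∑ S ∈ P.support, ‖P S‖ₑ * volume (proj π '' (S.carrier ∩ U)) := by
  have hmeasurable (S : OrientedPolyhedron X k) : Measurable fun y =>
      (proj π '' (S.carrier ∩ U)).indicator (1 : (Fin k → ℝ) → ℝ≥0∞) y :=
    measurable_one.indicator (S.measurableSet_proj_image_inter π hU)
  simp only [projDensity]
  rw [lintegral_finsetSum _ fun S _ => (hmeasurable S).mul_const _]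
  refine Finset.sum_congr rfl fun S _ => ?_
  rw [lintegral_mul_const _ (hmeasurable S),
    lintegral_indicator_one (S.measurableSet_proj_image_inter π hU), mul_comm]

theorem enorm_zsmul_le (n : ℤ) (g : G) : ‖n • g‖ₑ ≤ ‖n‖ₑ * ‖g‖ₑ := by
  rw [← ofReal_norm, ← ofReal_norm n, ← ofReal_norm g, ← ENNReal.ofReal_mul (norm_nonneg n)]
  exact ENNReal.ofReal_le_ofReal (norm_zsmul_le n g)

theorem enorm_sign_smul {c : ℝ} (hc : c ≠ 0) (g : G) : ‖(SignType.sign c : ℤ) • g‖ₑ = ‖g‖ₑ := by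
  rcases hc.lt_or_gt with hneg | hpos
  · rw [sign_neg hneg, SignType.coe_neg_one, neg_one_zsmul, enorm_neg]
  · rw [sign_pos hpos, SignType.coe_one, one_zsmul]

theorem enorm_weightedSum_le (w : OrientedPolyhedron X k → ℤ) (P : FormalSum X G k) :
    ‖weightedSum w P‖ₑ ≤ ∑ S ∈ P.support, ‖w S‖ₑ * ‖P S‖ₑ :=
  (enorm_sum_le _ _).trans (Finset.sum_le_sum fun S _ => enorm_zsmul_le (w S) (P S))

theorem sum_weightedSum (Z : Finset X) (w : X → OrientedPolyhedron X k → ℤ)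
    (P : FormalSum X G k) :
    ∑ x ∈ Z, weightedSum (w x) P = weightedSum (fun S => ∑ x ∈ Z, w x S) P := by
  simp only [weightedSum_apply, Finsupp.sum, Finset.sum_smul]
  exact Finset.sum_comm

theorem sum_multiplicity_of_mem (hminor : minor π S.frame ≠ 0) (hZ : ∀ x ∈ Z, proj π x = y)
    {x₀ : X} (hx₀Z : x₀ ∈ Z) (hx₀ : x₀ ∈ S.carrier) :
    ∑ x ∈ Z, multiplicity π x S = SignType.sign (minor π S.frame) := by
  rw [Finset.sum_eq_single_of_mem x₀ hx₀Z, multiplicity_of_mem hx₀]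
  refine fun x hxZ hne => multiplicity_of_notMem fun hx => hne ?_
  exact S.injOn_proj hminor hx hx₀ ((hZ x hxZ).trans (hZ x₀ hx₀Z).symm)

theorem enorm_sum_multiplicity_le (hZU : ∀ x ∈ Z, x ∈ U) (hZ : ∀ x ∈ Z, proj π x = y)
    (S : OrientedPolyhedron X k) :
    ‖∑ x ∈ Z, multiplicity π x S‖ₑ ≤ (proj π '' (S.carrier ∩ U)).indicator 1 y := by
  by_cases hminor : minor π S.frame = 0
  · simp [multiplicity, hminor]
  by_cases hmeet : ∃ x ∈ Z, x ∈ S.carrier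
  · obtain ⟨x, hxZ, hxS⟩ := hmeet
    have hy : y ∈ proj π '' (S.carrier ∩ U) := ⟨x, ⟨hxS, hZU x hxZ⟩, hZ x hxZ⟩
    rw [sum_multiplicity_of_mem hminor hZ hxZ hxS, indicator_of_mem hy, Pi.one_apply]
    cases SignType.sign (minor π S.frame) <;> simp
  · push Not at hmeet
    rw [Finset.sum_eq_zero fun x hxZ => multiplicity_of_notMem (hmeet x hxZ), enorm_zero]
    exact zero_le

theorem enorm_sum_density_le (hZU : ∀ x ∈ Z, x ∈ U) (hZ : ∀ x ∈ Z, proj π x = y)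
    (P : FormalSum X G k) : ‖∑ x ∈ Z, density π x P‖ₑ ≤ projDensity π U P y := by
  simp only [density, sum_weightedSum]
  refine (enorm_weightedSum_le _ P).trans (Finset.sum_le_sum fun S _ => ?_)
  exact mul_le_mul_left (enorm_sum_multiplicity_le hZU hZ S) _

end ProjDensity

section SimpleMass

theorem enorm_mul_volume_proj_image_le {T : OrientedPolyhedron X k} {g : G} {Q : FormalSum X G k}
    (h : Q.toChain = FormalSum.toChain (Finsupp.single T g)) (π : Fin k → X →L[ℝ] ℝ) :
    ‖g‖ₑ * volume (proj π '' T.carrier) ≤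
      ∑ S ∈ Q.support, ‖Q S‖ₑ * volume (proj π '' S.carrier) := by
  by_cases hminor : minor π T.frame = 0
  · have hnull := eventually_notMem_generic.1 (T.eventually_notMem_of_minor_eq_zero hminor)
    simp [hnull]
  have hpoint : ∀ᵐ y, (proj π '' T.carrier).indicator (fun _ => ‖g‖ₑ) y ≤
      projDensity π univ Q y := by
    filter_upwards [eventually_generic.1 (density_eq_of_toChain_eq π h)] with y hy
    refine indicator_apply_le' ?_ fun _ => zero_le
    rintro ⟨x, hx, rfl⟩
    have hnorm : ‖density π x Q‖ₑ = ‖g‖ₑ := by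
      rw [hy x rfl, density, weightedSum_single, multiplicity_of_mem hx, enorm_sign_smul hminor]
    simpa [hnorm] using enorm_sum_density_le (Z := {x}) (U := univ) (π := π) (y := proj π x)
      (by simp) (by simp) Q
  have hintegral := lintegral_mono_ae hpoint
  rw [lintegral_indicator_const (T.measurableSet_proj_image π),
    lintegral_projDensity π isClosed_univ] at hintegral
  simpa only [inter_univ] using hintegral

theorem isDisjointSum_single (T : OrientedPolyhedron X k) (g : G) :
    IsDisjointSum (Finsupp.single T g : FormalSum X G k) :=
  (Set.subsingleton_singleton.anti fun _ hS =>
    Finset.mem_singleton.1 (Finsupp.support_single_subset hS)).pairwise _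

theorem massOfSimple_zero (m : OrientedPolyhedron X k → G → ℝ≥0∞) : massOfSimple m 0 = 0 :=
  le_antisymm ((iInf₂_le 0 ⟨fun _ hS => absurd hS (Finset.notMem_empty _), toChain_zero⟩).trans
    Finsupp.sum_zero_index.le) zero_le

variable {m : OrientedPolyhedron X k → G → ℝ≥0∞}

theorem massOfSimple_single (hm : ∀ S g, m S g = ‖g‖ₑ * projVolume k S.carrier)
    (T : OrientedPolyhedron X k) (g : G) :
    massOfSimple m (FormalSum.toChain (Finsupp.single T g)) = ‖g‖ₑ * projVolume k T.carrier := by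
  refine le_antisymm ?_ (le_iInf₂ fun Q hQ => ?_)
  · refine (iInf₂_le (Finsupp.single T g) ⟨isDisjointSum_single T g, rfl⟩).trans ?_
    rw [Finsupp.sum_single_index (by rw [hm, enorm_zero, zero_mul]), hm]
  · simp_rw [projVolume, ENNReal.mul_iSup]
    refine iSup₂_le fun π hπ => (enorm_mul_volume_proj_image_le hQ.2 π).trans ?_
    refine Finset.sum_le_sum fun S _ => ?_
    rw [hm S]
    exact mul_le_mul_right (volume_proj_image_le_projVolume hπ _) _

theorem massOfSimple_slice (hm : ∀ S g, m S g = ‖g‖ₑ * projVolume k S.carrier)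
    {S : OrientedPolyhedron X (k + 1)} (g : G) {f : X →L[ℝ] ℝ} {r : ℝ}
    (hr : IsRegularLevel S.carrier f r) :
    massOfSimple m (slice f r (Finsupp.single S g)).toChain =
      ‖g‖ₑ * projVolume k {z ∈ S.carrier | f z = r} := by
  rcases {z ∈ S.carrier | f z = r}.eq_empty_or_nonempty with hempty | ⟨z, hz, hfz⟩
  · rw [hr.toChain_slice_of_level_eq_empty g hempty, massOfSimple_zero, hempty, projVolume_empty,
      mul_zero]
  · obtain ⟨a, ha, hfa⟩ := hr.exists_lt hz hfz
    obtain ⟨b, hb, hfb⟩ := hr.exists_gt hz hfz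
    obtain ⟨T, hT⟩ := exists_orientedPolyhedron_level ha hfa hb hfb
    obtain ⟨c, hc, hcT⟩ := exists_apply_fiberDir_eq_mul_minor hT ha hfa.ne
    rw [hr.toChain_slice g hT hcT, massOfSimple_single hm, enorm_sign_smul hc, hT]

theorem simpleMass_eq (k : ℕ) (S : OrientedPolyhedron X k) (g : G) :
    simpleMass k S g = ‖g‖ₑ * projVolume k S.carrier := by
  induction k generalizing g with
  | zero => rw [simpleMass, projVolume_zero S.nonempty, mul_one]
  | succ k ih =>
    have hslice (f : X →L[ℝ] ℝ) :
        ∫⁻ r, massOfSimple (simpleMass k) (slice f r (Finsupp.single S g)).toChain =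
          ‖g‖ₑ * ⨆ (π : Fin k → X →L[ℝ] ℝ) (_ : ∀ i, ‖π i‖ = 1),
            volume (proj (Fin.cons f π : Fin (k + 1) → X →L[ℝ] ℝ) '' S.carrier) := by
      rw [← lintegral_projVolume_level, ← lintegral_const_mul' _ _ enorm_ne_top]
      refine lintegral_congr_ae ?_
      filter_upwards [ae_isRegularLevel S.isPolyhedron f] with r hr
      exact massOfSimple_slice ih g hr
    simp_rw [simpleMass, hslice, projVolume, ENNReal.mul_iSup]
    refine le_antisymm (iSup₂_le fun f hf => iSup₂_le fun π hπ => ?_) (iSup₂_le fun π hπ => ?_)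
    · exact le_iSup₂_of_le (Fin.cons f π) (Fin.cases hf hπ) le_rfl
    · refine le_iSup₂_of_le (π 0) (hπ 0) (le_iSup₂_of_le (Fin.tail π) (fun i => hπ i.succ) ?_)
      rw [Fin.cons_self_tail]

end SimpleMass

/-! ### Fibres and sublevel sets -/

section Fiber

variable {π : Fin k → X →L[ℝ] ℝ} {e : X →L[ℝ] ℝ} {y : Fin k → ℝ} {p q : X}
  {S : OrientedPolyhedron X (k + 1)} {h : X → ℝ} {t : ℝ}

theorem mem_feasibleCone_iff_ne {C : Set X} (hC : Convex ℝ C) {x d : X} {c : ℝ}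
    (hx : x ∈ C) (hq : q ∈ C) (hd : 0 < e d) (hqx : q = x + c • d)
    (hmax : ∀ t : ℝ, x + t • d ∈ C → e (x + t • d) ≤ e q) :
    d ∈ feasibleCone C x ↔ x ≠ q := by
  constructor
  · rintro hcone rfl
    obtain ⟨t, ht, ht0⟩ := ((mem_feasibleCone.1 hcone).and self_mem_nhdsWithin).exists
    have hle := hmax t ht
    rw [map_add, map_smul, smul_eq_mul] at hle
    have hpos : 0 < t * e d := mul_pos ht0 hd
    linarith
  · intro hne
    have hle := hmax 0 (by rwa [zero_smul, add_zero])
    rw [zero_smul, add_zero, hqx, map_add, map_smul, smul_eq_mul, le_add_iff_nonneg_right] at hle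
    have hc : c ≠ 0 := by
      rintro rfl
      exact hne (by rw [hqx, zero_smul, add_zero])
    exact mem_feasibleCone_of_add_smul_mem hC hx
      ((nonneg_of_mul_nonneg_left hle hd).lt_of_ne' hc) (hqx ▸ hq)

/-- The points of a polyhedron that `proj π` maps to `y`. -/
def OrientedPolyhedron.fiber (S : OrientedPolyhedron X (k + 1)) (π : Fin k → X →L[ℝ] ℝ)
    (y : Fin k → ℝ) : Set X :=
  {z ∈ S.carrier | proj π z = y}

theorem OrientedPolyhedron.isCompact_fiber (S : OrientedPolyhedron X (k + 1))
    (π : Fin k → X →L[ℝ] ℝ) (y : Fin k → ℝ) : IsCompact (S.fiber π y) :=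
  S.isCompact.inter_right (isClosed_eq (proj π).continuous continuous_const)

theorem OrientedPolyhedron.convex_fiber (S : OrientedPolyhedron X (k + 1))
    (π : Fin k → X →L[ℝ] ℝ) (y : Fin k → ℝ) : Convex ℝ (S.fiber π y) :=
  S.convex.inter ((convex_singleton y).linear_preimage (proj π : X →ₗ[ℝ] (Fin k → ℝ)))

theorem OrientedPolyhedron.exists_eq_add_smul_fiberDir {x x' : X}
    (hd : fiberDir π S.frame ≠ 0) (hx : x ∈ S.fiber π y) (hx' : x' ∈ S.fiber π y) :
    ∃ c : ℝ, x' = x + c • fiberDir π S.frame := by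
  obtain ⟨c, hc⟩ := exists_eq_smul_fiberDir hd (S.sub_mem_span hx'.1 hx.1)
    (by rw [map_sub, hx'.2, hx.2, sub_self])
  exact ⟨c, by rw [← hc, add_sub_cancel]⟩

/-- The points `p` and `q` are the end points of the fibre of `S` over `y`, in the sense that the
fibre multiplicities are `1` at `q`, `-1` at `p`, and `0` elsewhere; if the fibre carries no
multiplicity, then `p = q` is arbitrary. -/
structure IsFiberEndpoints (π : Fin k → X →L[ℝ] ℝ) (y : Fin k → ℝ)
    (S : OrientedPolyhedron X (k + 1)) (p q : X) : Prop where
  eq_or_proj_eq : p = q ∨ proj π p = y ∧ proj π q = y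
  fiberMultiplicity_eq : ∀ x, proj π x = y →
    fiberMultiplicity π x S = ({q} : Set X).indicator 1 x - ({p} : Set X).indicator 1 x

theorem isFiberEndpoints_of_isMinOn_of_isMaxOn (he : 0 < e (fiberDir π S.frame))
    (hp : p ∈ S.fiber π y) (hq : q ∈ S.fiber π y) (hmin : IsMinOn e (S.fiber π y) p)
    (hmax : IsMaxOn e (S.fiber π y) q) : IsFiberEndpoints π y S p q := by
  classical
  refine ⟨Or.inr ⟨hp.2, hq.2⟩, fun x hxy => ?_⟩
  by_cases hx : x ∈ S.carrier
  · have hd : fiberDir π S.frame ≠ 0 := fun hd => he.ne' (by rw [hd, map_zero])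
    have hline (t : ℝ) (ht : x + t • fiberDir π S.frame ∈ S.carrier) :
        x + t • fiberDir π S.frame ∈ S.fiber π y :=
      ⟨ht, by rw [map_add, map_smul, proj_fiberDir, smul_zero, add_zero, hxy]⟩
    obtain ⟨a, ha⟩ := OrientedPolyhedron.exists_eq_add_smul_fiberDir hd ⟨hx, hxy⟩ hq
    obtain ⟨b, hb⟩ := OrientedPolyhedron.exists_eq_add_smul_fiberDir hd ⟨hx, hxy⟩ hp
    have hforward : fiberDir π S.frame ∈ feasibleCone S.carrier x ↔ x ≠ q :=
      mem_feasibleCone_iff_ne S.convex hx hq.1 he ha fun t ht => hmax (hline t ht)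
    have hbackward : -fiberDir π S.frame ∈ feasibleCone S.carrier x ↔ x ≠ p := by
      refine mem_feasibleCone_iff_ne (e := -e) (c := -b) S.convex hx hp.1 ?_ ?_ fun t ht => ?_
      · rwa [neg_apply, map_neg, neg_neg]
      · rwa [neg_smul_neg]
      · rw [smul_neg, ← neg_smul] at ht ⊢
        exact neg_le_neg (hmin (hline _ ht))
    simp only [fiberMultiplicity, indicator_apply, hforward, hbackward, mem_singleton_iff,
      Pi.one_apply]
    grind
  · have hxq : x ∉ ({q} : Set X) := fun hxq => hx (hxq ▸ hq.1)
    have hxp : x ∉ ({p} : Set X) := fun hxp => hx (hxp ▸ hp.1)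
    rw [fiberMultiplicity_of_notMem hx, indicator_of_notMem hxq, indicator_of_notMem hxp, sub_self]

theorem preimage_mk_right_image_prod_proj (S : OrientedPolyhedron X (k + 1))
    (e : X →L[ℝ] ℝ) (π : Fin k → X →L[ℝ] ℝ) (y : Fin k → ℝ) :
    (fun r => (r, y)) ⁻¹' (e.prod (proj π) '' S.carrier) = e '' S.fiber π y := by
  ext r
  simp [OrientedPolyhedron.fiber, Prod.ext_iff, and_assoc, and_comm (a := e _ = r)]

theorem measurable_volume_image_fiber (S : OrientedPolyhedron X (k + 1)) (e : X →L[ℝ] ℝ)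
    (π : Fin k → X →L[ℝ] ℝ) : Measurable fun y => volume (e '' S.fiber π y) := by
  simpa only [preimage_mk_right_image_prod_proj] using
    measurable_measure_prodMk_right (μ := (volume : Measure ℝ))
      (S.isCompact.image (e.prod (proj π)).continuous).measurableSet

theorem lintegral_volume_image_fiber (S : OrientedPolyhedron X (k + 1)) (e : X →L[ℝ] ℝ)
    (π : Fin k → X →L[ℝ] ℝ) :
    ∫⁻ y, volume (e '' S.fiber π y) =
      volume (proj (Fin.cons e π : Fin (k + 1) → X →L[ℝ] ℝ) '' S.carrier) := by
  rw [volume_proj_cons_image e π S.isCompact, Measure.volume_eq_prod,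
    Measure.prod_apply_symm (S.isCompact.image (e.prod (proj π)).continuous).measurableSet]
  simp only [preimage_mk_right_image_prod_proj]

theorem edist_le_volume_image_fiber (hd : fiberDir π S.frame ≠ 0)
    (he : e (fiberDir π S.frame) = ‖fiberDir π S.frame‖) (hp : p ∈ S.fiber π y)
    (hq : q ∈ S.fiber π y) : edist p q ≤ volume (e '' S.fiber π y) := by
  obtain ⟨c, rfl⟩ := OrientedPolyhedron.exists_eq_add_smul_fiberDir hd hp hq
  have hconvex : (e '' S.fiber π y).OrdConnected :=
    ((S.convex_fiber π y).linear_image (e : X →ₗ[ℝ] ℝ)).ordConnected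
  refine le_trans (le_of_eq ?_) (measure_mono
    (hconvex.uIcc_subset (mem_image_of_mem e hp) (mem_image_of_mem e hq)))
  rw [Real.volume_interval, ← map_sub, add_sub_cancel_left, map_smul, he, smul_eq_mul, abs_mul,
    abs_norm, edist_dist, dist_self_add_right, norm_smul, Real.norm_eq_abs]

theorem exists_isFiberEndpoints_edist_le (S : OrientedPolyhedron X (k + 1))
    (hπ : ∀ i, ‖π i‖ = 1) :
    ∃ ρ : (Fin k → ℝ) → ℝ≥0∞, Measurable ρ ∧ ∫⁻ y, ρ y ≤ projVolume (k + 1) S.carrier ∧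
      ∀ y, ∃ p q, IsFiberEndpoints π y S p q ∧ edist p q ≤ ρ y := by
  by_cases hd : fiberDir π S.frame = 0
  · refine ⟨0, measurable_zero, by simp, fun y => ⟨0, 0, ⟨Or.inl rfl, fun x _ => ?_⟩, by simp⟩⟩
    rw [fiberMultiplicity, hd, neg_zero, sub_self, sub_self]
  obtain ⟨e, he1, he⟩ := exists_dual_vector ℝ (fiberDir π S.frame) (norm_ne_zero_iff.2 hd)
  refine ⟨fun y => volume (e '' S.fiber π y), measurable_volume_image_fiber S e π, ?_,
    fun y => ?_⟩
  · rw [lintegral_volume_image_fiber]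
    exact volume_proj_image_le_projVolume (Fin.cases he1 hπ) _
  rcases (S.fiber π y).eq_empty_or_nonempty with hempty | hne
  · refine ⟨0, 0, ⟨Or.inl rfl, fun x hx => ?_⟩, by simp⟩
    have hxS : x ∉ S.carrier := fun hxS => hempty.subset ⟨hxS, hx⟩
    rw [fiberMultiplicity_of_notMem hxS, sub_self]
  · have hcompact := S.isCompact_fiber π y
    obtain ⟨p, hp, hmin⟩ := hcompact.exists_isMinOn hne e.continuous.continuousOn
    obtain ⟨q, hq, hmax⟩ := hcompact.exists_isMaxOn hne e.continuous.continuousOn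
    exact ⟨p, q,
      isFiberEndpoints_of_isMinOn_of_isMaxOn (he ▸ norm_pos_iff.2 hd) hp hq hmin hmax,
      edist_le_volume_image_fiber hd he hp hq⟩

theorem IsFiberEndpoints.enorm_sum_fiberMultiplicity_le (hpq : IsFiberEndpoints π y S p q)
    {Z : Finset X} (hZ : ∀ x ∈ Z, proj π x = y) (hp : p ∈ Z ↔ proj π p = y ∧ h p < t)
    (hq : q ∈ Z ↔ proj π q = y ∧ h q < t) :
    ‖∑ x ∈ Z, fiberMultiplicity π x S‖ₑ ≤ (uIoc (h p) (h q)).indicator 1 t := by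
  classical
  rw [Finset.sum_congr rfl fun x hx => hpq.fiberMultiplicity_eq x (hZ x hx)]
  rcases hpq.eq_or_proj_eq with rfl | ⟨hpy, hqy⟩
  · simp
  rw [hpy, eq_self, true_and] at hp
  rw [hqy, eq_self, true_and] at hq
  simp only [indicator_apply, mem_singleton_iff, Finset.sum_sub_distrib, Pi.one_apply,
    Finset.sum_ite_eq', hp, hq, mem_uIoc]
  split_ifs <;> simp <;> grind

theorem enorm_sum_fiberDensity_le {p q : OrientedPolyhedron X (k + 1) → X}
    (hpq : ∀ S, IsFiberEndpoints π y S (p S) (q S)) {Q : FormalSum X G (k + 1)} {Z : Finset X}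
    (hZ : ∀ x ∈ Z, proj π x = y)
    (hp : ∀ S ∈ Q.support, p S ∈ Z ↔ proj π (p S) = y ∧ h (p S) < t)
    (hq : ∀ S ∈ Q.support, q S ∈ Z ↔ proj π (q S) = y ∧ h (q S) < t) :
    ‖∑ x ∈ Z, fiberDensity π x Q‖ₑ ≤
      ∑ S ∈ Q.support, (uIoc (h (p S)) (h (q S))).indicator 1 t * ‖Q S‖ₑ := by
  simp only [fiberDensity, sum_weightedSum]
  refine (enorm_weightedSum_le _ Q).trans (Finset.sum_le_sum fun S hS => ?_)
  exact mul_le_mul_left ((hpq S).enorm_sum_fiberMultiplicity_le hZ (hp S hS) (hq S hS)) _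

end Fiber

section LocalEstimate

theorem volume_uIoc_le_edist {Y : Type*} [PseudoEMetricSpace Y] {h : Y → ℝ}
    (hh : LipschitzWith 1 h) (p q : Y) :
    volume (uIoc (h p) (h q)) ≤ edist p q := by
  rw [Real.volume_uIoc, ← Real.dist_eq, ← edist_dist, edist_comm]
  simpa using hh p q

variable {π : Fin k → X →L[ℝ] ℝ} {y : Fin k → ℝ} {h : X → ℝ} {δ : ℝ} {P₀ P R : FormalSum X G k}
  {Q : FormalSum X G (k + 1)} {S₀ : OrientedPolyhedron X k} {x₀ : X}

theorem enorm_sum_density_eq {Z : Finset X} (hminor : minor π S₀.frame ≠ 0)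
    (hZ : ∀ x ∈ Z, proj π x = y) (hx₀Z : x₀ ∈ Z) (hx₀ : x₀ ∈ S₀.carrier)
    (hmiss : ∀ T ∈ P₀.support, T ≠ S₀ → ∀ x ∈ Z, x ∉ T.carrier) :
    ‖∑ x ∈ Z, density π x P₀‖ₑ = ‖P₀ S₀‖ₑ := by
  simp only [density, sum_weightedSum]
  rw [weightedSum_apply, Finsupp.sum, Finset.sum_eq_single S₀,
    sum_multiplicity_of_mem hminor hZ hx₀Z hx₀, enorm_sign_smul hminor]
  · intro T hT hne
    rw [Finset.sum_eq_zero fun x hx => multiplicity_of_notMem (hmiss T hT hne x hx), zero_smul]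
  · intro hS₀
    rw [Finsupp.notMem_support_iff.1 hS₀, smul_zero]

/- The identity of densities is summed over the points of the fibre over `y` below level `t`. There
the isolated summand `S₀` has exactly one point, while a summand of `Q` contributes only if `t`
separates the values of `h` at the end points of its fibre. -/
theorem enorm_le_projDensity_add_sum_uIoc {t : ℝ} (ht : t ∈ Ioc 0 δ)
    (hminor : minor π S₀.frame ≠ 0)
    (hsep : ∀ T ∈ P₀.support, T ≠ S₀ → ∀ x ∈ T.carrier, δ < h x) (hx₀ : x₀ ∈ S₀.carrier)
    (hhx₀ : h x₀ ≤ 0) (hx₀y : proj π x₀ = y)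
    (hdensity : ∀ x, proj π x = y →
      density π x P₀ = density π x P + density π x R - fiberDensity π x Q)
    {p q : OrientedPolyhedron X (k + 1) → X} (hpq : ∀ S, IsFiberEndpoints π y S (p S) (q S)) :
    ‖P₀ S₀‖ₑ ≤ projDensity π {x | h x ≤ δ} P y + projDensity π univ R y +
      ∑ S ∈ Q.support, (uIoc (h (p S)) (h (q S))).indicator 1 t * ‖Q S‖ₑ := by
  classical
  let Z := {x ∈ insert x₀ (Q.support.image p ∪ Q.support.image q) | proj π x = y ∧ h x < t}
  have hproj : ∀ x ∈ Z, proj π x = y := fun x hx => (Finset.mem_filter.1 hx).2.1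
  have hlevel : ∀ x ∈ Z, h x < t := fun x hx => (Finset.mem_filter.1 hx).2.2
  have hx₀Z : x₀ ∈ Z :=
    Finset.mem_filter.2 ⟨Finset.mem_insert_self _ _, hx₀y, hhx₀.trans_lt ht.1⟩
  have hp : ∀ S ∈ Q.support, p S ∈ Z ↔ proj π (p S) = y ∧ h (p S) < t := fun S hS =>
    Finset.mem_filter.trans (and_iff_right (Finset.mem_insert_of_mem
      (Finset.mem_union_left _ (Finset.mem_image_of_mem p hS))))
  have hq : ∀ S ∈ Q.support, q S ∈ Z ↔ proj π (q S) = y ∧ h (q S) < t := fun S hS =>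
    Finset.mem_filter.trans (and_iff_right (Finset.mem_insert_of_mem
      (Finset.mem_union_right _ (Finset.mem_image_of_mem q hS))))
  have hmiss : ∀ T ∈ P₀.support, T ≠ S₀ → ∀ x ∈ Z, x ∉ T.carrier := fun T hT hne x hx hxT =>
    ((hlevel x hx).trans_le ht.2).not_gt (hsep T hT hne x hxT)
  have hsum : ∑ x ∈ Z, density π x P₀ =
      ∑ x ∈ Z, density π x P + ∑ x ∈ Z, density π x R - ∑ x ∈ Z, fiberDensity π x Q := by
    rw [← Finset.sum_add_distrib, ← Finset.sum_sub_distrib]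
    exact Finset.sum_congr rfl fun x hx => hdensity x (hproj x hx)
  rw [← enorm_sum_density_eq hminor hproj hx₀Z hx₀ hmiss, hsum]
  refine enorm_sub_le.trans (add_le_add ((enorm_add_le _ _).trans (add_le_add ?_ ?_)) ?_)
  · exact enorm_sum_density_le (fun x hx => ((hlevel x hx).trans_le ht.2).le) hproj P
  · exact enorm_sum_density_le (fun x _ => mem_univ x) hproj R
  · exact enorm_sum_fiberDensity_le hpq hproj hp hq

theorem ofReal_mul_enorm_le_projDensity_add_sum_edist (hh : LipschitzWith 1 h)
    (hminor : minor π S₀.frame ≠ 0)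
    (hsep : ∀ T ∈ P₀.support, T ≠ S₀ → ∀ x ∈ T.carrier, δ < h x) (hx₀ : x₀ ∈ S₀.carrier)
    (hhx₀ : h x₀ ≤ 0) (hx₀y : proj π x₀ = y)
    (hdensity : ∀ x, proj π x = y →
      density π x P₀ = density π x P + density π x R - fiberDensity π x Q)
    {p q : OrientedPolyhedron X (k + 1) → X} (hpq : ∀ S, IsFiberEndpoints π y S (p S) (q S)) :
    ENNReal.ofReal δ * ‖P₀ S₀‖ₑ ≤
      ENNReal.ofReal δ * (projDensity π {x | h x ≤ δ} P y + projDensity π univ R y) +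
        ∑ S ∈ Q.support, ‖Q S‖ₑ * edist (p S) (q S) := by
  have hmeasurable (S : OrientedPolyhedron X (k + 1)) :
      Measurable ((uIoc (h (p S)) (h (q S))).indicator (1 : ℝ → ℝ≥0∞)) :=
    measurable_one.indicator measurableSet_uIoc
  have hlevels := setLIntegral_mono' (μ := volume) measurableSet_Ioc fun t ht =>
    enorm_le_projDensity_add_sum_uIoc ht hminor hsep hx₀ hhx₀ hx₀y hdensity hpq
  rw [setLIntegral_const, lintegral_add_left measurable_const, setLIntegral_const,
    Real.volume_Ioc, sub_zero, mul_comm, mul_comm _ (ENNReal.ofReal δ),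
    lintegral_finsetSum _ fun S _ => (hmeasurable S).mul_const _] at hlevels
  refine hlevels.trans (add_le_add_right (Finset.sum_le_sum fun S _ => ?_) _)
  refine (setLIntegral_le_lintegral _ _).trans ?_
  rw [lintegral_mul_const _ (hmeasurable S), lintegral_indicator_one measurableSet_uIoc, mul_comm]
  exact mul_le_mul_right (volume_uIoc_le_edist hh _ _) _

theorem ofReal_mul_enorm_mul_volume_le (hπ : ∀ i, ‖π i‖ = 1) (hh : LipschitzWith 1 h)
    (hsep : ∀ T ∈ P₀.support, T ≠ S₀ → ∀ x ∈ T.carrier, δ < h x) {K : Set X} (hK : IsCompact K)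
    (hKS : K ⊆ S₀.carrier) (hKh : ∀ x ∈ K, h x ≤ 0)
    (hdensity : ∀ᶠ x in generic π,
      density π x P₀ = density π x P + density π x R - fiberDensity π x Q) :
    ENNReal.ofReal δ * (‖P₀ S₀‖ₑ * volume (proj π '' K)) ≤
      ENNReal.ofReal δ *
        (∑ S ∈ P.support, ‖P S‖ₑ * volume (proj π '' (S.carrier ∩ {x | h x ≤ δ})) +
          R.sum (simpleMass k)) + Q.sum (simpleMass (k + 1)) := by
  by_cases hminor : minor π S₀.frame = 0
  · have hnull := eventually_notMem_generic.1 (S₀.eventually_notMem_of_minor_eq_zero hminor)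
    rw [measure_mono_null (image_mono hKS) hnull, mul_zero, mul_zero]
    exact zero_le
  choose ρ hρ hρle p q hpq hlength using
    fun S : OrientedPolyhedron X (k + 1) => exists_isFiberEndpoints_edist_le S hπ
  have hclosed : IsClosed {x | h x ≤ δ} := isClosed_le hh.continuous continuous_const
  have hmeasurable : Measurable fun y =>
      projDensity π {x | h x ≤ δ} P y + projDensity π univ R y :=
    (measurable_projDensity π hclosed P).add (measurable_projDensity π isClosed_univ R)
  have hfiber : ∀ᵐ y, (proj π '' K).indicator (fun _ => ENNReal.ofReal δ * ‖P₀ S₀‖ₑ) y ≤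
      ENNReal.ofReal δ * (projDensity π {x | h x ≤ δ} P y + projDensity π univ R y) +
        ∑ S ∈ Q.support, ‖Q S‖ₑ * ρ S y := by
    filter_upwards [eventually_generic.1 hdensity] with y hy
    refine indicator_apply_le' ?_ fun _ => zero_le
    rintro ⟨x₀, hx₀, hx₀y⟩
    refine (ofReal_mul_enorm_le_projDensity_add_sum_edist hh hminor hsep (hKS hx₀) (hKh x₀ hx₀)
      hx₀y hy fun S => hpq S y).trans (add_le_add_right (Finset.sum_le_sum fun S _ => ?_) _)
    exact mul_le_mul_right (hlength S y) _
  have hintegral := lintegral_mono_ae hfiber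
  rw [lintegral_indicator_const (hK.image (proj π).continuous).measurableSet, mul_assoc,
    lintegral_add_left (hmeasurable.const_mul _), lintegral_const_mul _ hmeasurable,
    lintegral_add_left (measurable_projDensity π hclosed P), lintegral_projDensity π hclosed,
    lintegral_projDensity π isClosed_univ,
    lintegral_finsetSum _ fun S _ => (hρ S).const_mul _] at hintegral
  refine hintegral.trans ?_
  simp only [Finsupp.sum, simpleMass_eq, inter_univ]
  gcongr with S _ S _
  · exact volume_proj_image_le_projVolume hπ _
  · rw [lintegral_const_mul _ (hρ S)]
    exact mul_le_mul_right (hρle S) _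

end LocalEstimate

/-! ### Lower semicontinuity -/

section Separation

theorem sum_volume_proj_image_inter_le {ι : Type*} (s : Finset ι) {π : ι → Fin k → X →L[ℝ] ℝ}
    (hπ : ∀ i ∈ s, ∀ j, ‖π i j‖ = 1) {U : ι → Set X} (hU : ∀ i ∈ s, IsClosed (U i))
    (hdisj : (s : Set ι).PairwiseDisjoint U) (S : OrientedPolyhedron X k) :
    ∑ i ∈ s, volume (proj (π i) '' (S.carrier ∩ U i)) ≤ projVolume k S.carrier := by
  obtain ⟨x₀, hx₀⟩ := S.nonempty
  let param (t : Fin k → ℝ) : X := x₀ + ∑ j, t j • S.frame j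
  have hparam : Continuous param := by fun_prop
  let c := ⨆ (π : Fin k → X →L[ℝ] ℝ) (_ : ∀ i, ‖π i‖ = 1), ENNReal.ofReal |minor π S.frame|
  have hvolume : projVolume k S.carrier = c * volume (param ⁻¹' S.carrier) := by
    simp_rw [projVolume, c, ENNReal.iSup_mul]
    exact iSup_congr fun π => iSup_congr fun _ => S.volume_proj_image_subset π hx₀ subset_rfl
  have hpiece : ∀ i ∈ s, volume (proj (π i) '' (S.carrier ∩ U i)) ≤
      c * volume (param ⁻¹' (S.carrier ∩ U i)) := fun i hi => by
    rw [S.volume_proj_image_subset (π i) hx₀ inter_subset_left]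
    exact mul_le_mul_left (le_iSup₂ (f := fun (π : Fin k → X →L[ℝ] ℝ) (_ : ∀ i, ‖π i‖ = 1) =>
      ENNReal.ofReal |minor π S.frame|) (π i) (hπ i hi)) _
  have hmeasurable : ∀ i ∈ s, MeasurableSet (param ⁻¹' (S.carrier ∩ U i)) := fun i hi =>
    ((S.isClosed.inter (hU i hi)).preimage hparam).measurableSet
  have hpreimage : (s : Set ι).PairwiseDisjoint fun i => param ⁻¹' (S.carrier ∩ U i) :=
    fun i hi j hj hij =>
      ((hdisj hi hj hij).mono inter_subset_right inter_subset_right).preimage param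
  refine (Finset.sum_le_sum hpiece).trans ?_
  rw [hvolume, ← Finset.mul_sum, ← measure_biUnion_finset hpreimage hmeasurable]
  exact mul_le_mul_right (measure_mono (iUnion₂_subset fun i _ =>
    preimage_mono inter_subset_left)) _

theorem exists_lipschitz_sublevel_subset_cthickening {Y : Type*} [PseudoMetricSpace Y]
    (K : Set Y) :
    ∃ h : Y → ℝ, LipschitzWith 1 h ∧ (∀ x ∈ K, h x ≤ 0) ∧
      ∀ δ ∈ Ioo (0 : ℝ) 1, {x | h x ≤ δ} ⊆ Metric.cthickening δ K := by
  rcases K.eq_empty_or_nonempty with rfl | hne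
  · exact ⟨fun _ => 1, LipschitzWith.const' 1, by simp, fun δ hδ x hx => absurd hx hδ.2.not_ge⟩
  · exact ⟨fun x => Metric.infDist x K, Metric.lipschitz_infDist_pt K,
      fun x hx => (Metric.infDist_zero_of_mem hx).le, fun δ hδ x hx =>
        (ENNReal.le_ofReal_iff_toReal_le (Metric.infEDist_ne_top hne) hδ.1.le).2 hx⟩

theorem exists_separating_functions {Y ι : Type*} [PseudoMetricSpace Y] (s : Finset ι)
    {C K : ι → Set Y} (hC : ∀ i ∈ s, IsClosed (C i)) (hK : ∀ i ∈ s, IsCompact (K i))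
    (hKC : ∀ i ∈ s, K i ⊆ C i) (hdisj : ∀ i ∈ s, ∀ j ∈ s, j ≠ i → Disjoint (K i) (C j)) :
    ∃ (δ : ℝ) (h : ι → Y → ℝ), 0 < δ ∧ (∀ i, LipschitzWith 1 (h i)) ∧
      (∀ i, ∀ x ∈ K i, h i x ≤ 0) ∧
      (∀ i ∈ s, ∀ j ∈ s, j ≠ i → ∀ x ∈ C j, δ < h i x) ∧
      (s : Set ι).PairwiseDisjoint fun i => {x | h i x ≤ δ} := by
  choose h hlip hzero hsub using fun i => exists_lipschitz_sublevel_subset_cthickening (K i)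
  have hthick : ∀ᶠ δ in 𝓝[>] (0 : ℝ), ∀ i ∈ s, ∀ j ∈ s, j ≠ i →
      Disjoint (Metric.cthickening δ (K i)) (Metric.cthickening δ (C j)) := by
    simp_rw [Filter.eventually_all_finset, eventually_imp_distrib_left]
    intro i hi j hj hne
    obtain ⟨δ, hδ, hδdisj⟩ := (hdisj i hi j hj hne).exists_cthickenings (hK i hi) (hC j hj)
    filter_upwards [Ioo_mem_nhdsGT hδ] with δ' hδ'
    exact hδdisj.mono (Metric.cthickening_mono hδ'.2.le _) (Metric.cthickening_mono hδ'.2.le _)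
  obtain ⟨δ, hδdisj, hδ⟩ := (hthick.and (Ioo_mem_nhdsGT (one_pos (α := ℝ)))).exists
  refine ⟨δ, h, hδ.1, hlip, hzero, fun i hi j hj hne x hx => ?_, fun i hi j hj hne => ?_⟩
  · by_contra! hle
    exact disjoint_left.1 (hδdisj i hi j hj hne) (hsub i δ hδ hle)
      (Metric.self_subset_cthickening _ hx)
  · exact (hδdisj i hi j hj hne.symm).mono (hsub i δ hδ)
      ((hsub j δ hδ).trans (Metric.cthickening_subset_of_subset δ (hKC j hj)))

end Separation

section IsolatedPiece

/-- A compact part of the summand `S` of `P` that misses the other summands, together with a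
projection to `ℝᵏ` that measures it. -/
structure IsolatedPiece (P : FormalSum X G k) (S : OrientedPolyhedron X k) where
  carrier : Set X
  isCompact : IsCompact carrier
  subset : carrier ⊆ S.carrier
  disjoint : ∀ T ∈ P.support, T ≠ S → Disjoint carrier T.carrier
  projection : Fin k → X →L[ℝ] ℝ
  norm_projection : ∀ i, ‖projection i‖ = 1

/-- The Lebesgue measure of the projection of an isolated piece. -/
def IsolatedPiece.volume {P : FormalSum X G k} {S : OrientedPolyhedron X k}
    (K : IsolatedPiece P S) : ℝ≥0∞ :=
  MeasureTheory.volume (proj K.projection '' K.carrier)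

variable {P : FormalSum X G k} {S : OrientedPolyhedron X k}

instance : Nonempty (IsolatedPiece P S) := by
  choose π hπ _ using fun i => exists_dual_vector ℝ (S.frame i)
    (norm_ne_zero_iff.2 (S.linearIndependent.ne_zero i))
  exact ⟨∅, isCompact_empty, empty_subset _, fun _ _ _ => empty_disjoint _, π, hπ⟩

theorem exists_isolatedPiece_lt_volume (hP : IsDisjointSum P) (hS : S ∈ P.support)
    {π : Fin k → X →L[ℝ] ℝ} (hπ : ∀ i, ‖π i‖ = 1) {b : ℝ≥0∞}
    (hb : b < volume (proj π '' S.carrier)) : ∃ K : IsolatedPiece P S, b < K.volume := by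
  classical
  let overlap := ⋃ T ∈ P.support.erase S, proj π '' (S.carrier ∩ T.carrier)
  have hnull : volume overlap = 0 := by
    refine (measure_biUnion_null_iff (P.support.erase S).countable_toSet).2 fun T hT => ?_
    obtain ⟨hne, hT⟩ := Finset.mem_erase.1 hT
    exact eventually_notMem_generic.1
      (OrientedPolyhedron.eventually_notMem_inter (hP hS hT hne.symm) π)
  have hmeasurable : MeasurableSet overlap := Finset.measurableSet_biUnion _ fun T _ =>
    S.measurableSet_proj_image_inter π T.isClosed
  rw [← measure_sdiff_null hnull] at hb
  obtain ⟨C, hCsub, hC, hbC⟩ :=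
    ((S.measurableSet_proj_image π).diff hmeasurable).exists_lt_isCompact hb
  have hdisj : ∀ T ∈ P.support, T ≠ S → Disjoint (S.carrier ∩ proj π ⁻¹' C) T.carrier :=
    fun T hT hne => disjoint_left.2 fun x hx hxT => (hCsub hx.2).2
      (mem_iUnion₂.2 ⟨T, Finset.mem_erase.2 ⟨hne, hT⟩, x, ⟨hx.1, hxT⟩, rfl⟩)
  refine ⟨⟨S.carrier ∩ proj π ⁻¹' C,
    S.isCompact.inter_right (hC.isClosed.preimage (proj π).continuous), inter_subset_left, hdisj,
    π, hπ⟩, ?_⟩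
  rwa [IsolatedPiece.volume, image_inter_preimage,
    inter_eq_self_of_subset_right (hCsub.trans sdiff_subset)]

theorem iSup_volume_isolatedPiece (hP : IsDisjointSum P) (hS : S ∈ P.support) :
    ⨆ K : IsolatedPiece P S, K.volume = projVolume k S.carrier := by
  refine le_antisymm (iSup_le fun K => ?_) (iSup₂_le fun π hπ => le_of_forall_lt fun b hb => ?_)
  · exact (measure_mono (image_mono K.subset)).trans
      (volume_proj_image_le_projVolume K.norm_projection _)
  · obtain ⟨K, hK⟩ := exists_isolatedPiece_lt_volume hP hS hπ hb
    exact hK.trans_le (le_iSup IsolatedPiece.volume K)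

theorem IsDisjointSum.sum_simpleMass_eq_iSup (hP : IsDisjointSum P) :
    P.sum (simpleMass k) =
      ⨆ K : ∀ S, IsolatedPiece P S, ∑ S ∈ P.support, ‖P S‖ₑ * (K S).volume := by
  have hsimple : ∀ S ∈ P.support, simpleMass k S (P S) =
      ⨆ K : ∀ S, IsolatedPiece P S, ‖P S‖ₑ * (K S).volume := fun S hS => by
    rw [simpleMass_eq, ← iSup_volume_isolatedPiece hP hS, ← ENNReal.mul_iSup,
      (Function.surjective_eval S).iSup_comp]
  rw [Finsupp.sum, Finset.sum_congr rfl hsimple]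
  refine ENNReal.finsetSum_iSup fun K K' => ?_
  have hlarger : ∀ S, ∃ L : IsolatedPiece P S,
      (K S).volume ≤ L.volume ∧ (K' S).volume ≤ L.volume := fun S =>
    (le_total (K S).volume (K' S).volume).elim (fun h => ⟨K' S, h, le_rfl⟩)
      fun h => ⟨K S, le_rfl, h⟩
  choose L hL using hlarger
  exact ⟨L, fun S => ⟨mul_le_mul_right (hL S).1 _, mul_le_mul_right (hL S).2 _⟩⟩

end IsolatedPiece

section Semicontinuity

theorem mass_toChain_le (P : FormalSum X G k) (hP : IsDisjointSum P) :
    mass P.toChain ≤ P.sum (simpleMass k) :=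
  iInf₂_le P ⟨hP, rfl⟩

theorem le_add_mul_mass {a c N : ℝ≥0∞} (hN₀ : N ≠ 0) (hN : N ≠ ⊤) {P : PolyhedralChain X G k}
    (h : ∀ Q : FormalSum X G k, Q.toChain = P → c ≤ a + N * Q.sum (simpleMass k)) :
    c ≤ a + N * mass P := by
  rw [mass, massOfSimple, iInf_subtype', ENNReal.mul_iInf_of_ne hN₀ hN, ENNReal.add_iInf]
  exact le_iInf fun Q => h Q Q.2.2

theorem eventually_density_eq_of_toChain_eq {P₀ P R : FormalSum X G k}
    {Q Q' : FormalSum X G (k + 1)}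
    (hR : R.toChain = (boundary Q).toChain - (P.toChain - P₀.toChain))
    (hQ' : Q'.toChain = Q.toChain) (π : Fin k → X →L[ℝ] ℝ) :
    ∀ᶠ x in generic π, density π x P₀ = density π x P + density π x R - fiberDensity π x Q' := by
  have hchain : (P + R).toChain = (P₀ + boundary Q).toChain := by
    rw [toChain_add, toChain_add, hR]
    abel
  filter_upwards [density_eq_of_toChain_eq π hchain, density_boundary π Q,
    fiberDensity_eq_of_toChain_eq π hQ'] with x hsum hboundary hfiber
  rw [map_add, map_add] at hsum
  rw [hsum, hboundary, hfiber, add_sub_cancel_right]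

theorem exists_mul_sum_volume_isolatedPiece_le {P₀ : FormalSum X G k}
    (K : ∀ S, IsolatedPiece P₀ S) :
    ∃ D : ℝ≥0∞, D ≠ 0 ∧ D ≠ ⊤ ∧ ∀ (P R : FormalSum X G k) (Q : FormalSum X G (k + 1)),
      (∀ π, ∀ᶠ x in generic π,
        density π x P₀ = density π x P + density π x R - fiberDensity π x Q) →
      D * ∑ S ∈ P₀.support, ‖P₀ S‖ₑ * (K S).volume ≤
        D * (P.sum (simpleMass k) + P₀.support.card * R.sum (simpleMass k)) +
          P₀.support.card * Q.sum (simpleMass (k + 1)) := by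
  obtain ⟨δ, h, hδ, hlip, hzero, hsep, hdisj⟩ := exists_separating_functions P₀.support
    (C := fun S => S.carrier) (K := fun S => (K S).carrier) (fun S _ => S.isClosed)
    (fun S _ => (K S).isCompact) (fun S _ => (K S).subset) (fun S _ => (K S).disjoint)
  refine ⟨ENNReal.ofReal δ, (ENNReal.ofReal_pos.2 hδ).ne', ENNReal.ofReal_ne_top,
    fun P R Q hdensity => ?_⟩
  have hlocal : ∀ S ∈ P₀.support, ENNReal.ofReal δ * (‖P₀ S‖ₑ * (K S).volume) ≤
      ENNReal.ofReal δ * (∑ T ∈ P.support,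
        ‖P T‖ₑ * volume (proj (K S).projection '' (T.carrier ∩ {x | h S x ≤ δ})) +
          R.sum (simpleMass k)) + Q.sum (simpleMass (k + 1)) := fun S hS =>
    ofReal_mul_enorm_mul_volume_le (K S).norm_projection (hlip S) (hsep S hS) (K S).isCompact
      (K S).subset (hzero S) (hdensity _)
  have hdisjoint : ∑ S ∈ P₀.support, ∑ T ∈ P.support,
      ‖P T‖ₑ * volume (proj (K S).projection '' (T.carrier ∩ {x | h S x ≤ δ})) ≤
        P.sum (simpleMass k) := by
    rw [Finset.sum_comm]
    refine Finset.sum_le_sum fun T _ => ?_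
    rw [← Finset.mul_sum, simpleMass_eq]
    exact mul_le_mul_right (sum_volume_proj_image_inter_le _ (fun S _ => (K S).norm_projection)
      (fun S _ => isClosed_le (hlip S).continuous continuous_const) hdisj T) _
  rw [Finset.mul_sum]
  refine (Finset.sum_le_sum hlocal).trans ?_
  rw [Finset.sum_add_distrib, ← Finset.mul_sum, Finset.sum_add_distrib, Finset.sum_const,
    Finset.sum_const, nsmul_eq_mul, nsmul_eq_mul]
  gcongr

theorem exists_sum_volume_isolatedPiece_le {P₀ : FormalSum X G k} (K : ∀ S, IsolatedPiece P₀ S) :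
    ∃ N : ℝ≥0∞, N ≠ ⊤ ∧ ∀ P : PolyhedralChain X G k,
      ∑ S ∈ P₀.support, ‖P₀ S‖ₑ * (K S).volume ≤ mass P + N * flatNorm (P - P₀.toChain) := by
  obtain ⟨D, hD₀, hD, hle⟩ := exists_mul_sum_volume_isolatedPiece_le K
  let n : ℝ≥0∞ := (P₀.support.card : ℝ≥0∞)
  have hn : n ≠ ⊤ := ENNReal.natCast_ne_top _
  have hDn : D⁻¹ * n ≠ ⊤ := ENNReal.mul_ne_top (ENNReal.inv_ne_top.2 hD₀) hn
  let N := 1 + n + D⁻¹ * n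
  have hN₀ : N ≠ 0 := by simp [N]
  have hN : N ≠ ⊤ := ENNReal.add_ne_top.2 ⟨ENNReal.add_ne_top.2 ⟨ENNReal.one_ne_top, hn⟩, hDn⟩
  refine ⟨N, hN, fun P => ?_⟩
  rw [flatNorm, ENNReal.mul_iInf_of_ne hN₀ hN, ENNReal.add_iInf]
  refine le_iInf fun Q => ?_
  rw [mul_add, ← add_assoc]
  refine le_add_mul_mass hN₀ hN fun R hR => ?_
  rw [add_right_comm]
  refine le_add_mul_mass hN₀ hN fun Q' hQ' => ?_
  rw [add_assoc, add_comm, ← one_mul (mass P)]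
  refine le_add_mul_mass one_ne_zero ENNReal.one_ne_top fun P' hP' => ?_
  have hP₀ := hle P' R Q' (eventually_density_eq_of_toChain_eq (hP' ▸ hR) hQ')
  rw [ENNReal.mul_le_iff_le_inv hD₀ hD, mul_add, ← mul_assoc, ENNReal.inv_mul_cancel hD₀ hD,
    one_mul, ← mul_assoc] at hP₀
  calc ∑ S ∈ P₀.support, ‖P₀ S‖ₑ * (K S).volume
      ≤ P'.sum (simpleMass k) + n * R.sum (simpleMass k) +
          D⁻¹ * n * Q'.sum (simpleMass (k + 1)) := hP₀
    _ ≤ P'.sum (simpleMass k) + N * R.sum (simpleMass k) + N * Q'.sum (simpleMass (k + 1)) := by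
        gcongr
        · exact le_add_self.trans le_self_add
        · exact le_add_self
    _ = _ := by rw [one_mul]; abel

theorem le_liminf_of_le_add {ι : Type*} {l : Filter ι} {u ε : ι → ℝ≥0∞} {c : ℝ≥0∞}
    (h : ∀ i, c ≤ u i + ε i) (hε : Tendsto ε l (𝓝 0)) : c ≤ liminf u l := by
  rcases l.eq_or_neBot with rfl | _
  · simp
  have hlim : Tendsto (fun i => c - ε i) l (𝓝 c) := by
    simpa only [tsub_zero] using
      ENNReal.Tendsto.sub (tendsto_const_nhds (x := c)) hε (Or.inr ENNReal.zero_ne_top)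
  rw [← hlim.liminf_eq]
  exact liminf_le_liminf (Eventually.of_forall fun i => tsub_le_iff_right.2 (h i))

end Semicontinuity

end FlatChains

end

theorem mainTheorem2_general {X G : Type*} [NormedAddCommGroup X] [NormedSpace ℝ X]
    [NormedAddCommGroup G] {k : ℕ} {ι : Type*} {l : Filter ι}
    (P : ι → FlatChains.PolyhedralChain X G k) (P₀ : FlatChains.PolyhedralChain X G k)
    (hP : Tendsto (fun i => FlatChains.flatNorm (P i - P₀)) l (𝓝 0)) :
    FlatChains.mass P₀ ≤ liminf (fun i => FlatChains.mass (P i)) l := by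
  obtain ⟨A, rfl⟩ := QuotientAddGroup.mk_surjective P₀
  obtain ⟨B, hB, hchain⟩ := FlatChains.exists_isDisjointSum A
  have hAB : QuotientAddGroup.mk A = B.toChain := hchain.symm
  rw [hAB] at hP ⊢
  refine (FlatChains.mass_toChain_le B hB).trans ?_
  rw [hB.sum_simpleMass_eq_iSup]
  refine iSup_le fun K => ?_
  obtain ⟨N, hN, hle⟩ := FlatChains.exists_sum_volume_isolatedPiece_le K
  refine FlatChains.le_liminf_of_le_add (fun i => hle (P i)) ?_
  simpa only [mul_zero] using ENNReal.Tendsto.const_mul hP (Or.inr hN)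

theorem mainTheorem2 {X G : Type*} [NormedAddCommGroup X] [NormedSpace ℝ X] [CompleteSpace X]
    [NormedAddCommGroup G] [CompleteSpace G] (k : ℕ)
    (P : ℕ → FlatChains.PolyhedralChain X G k) (P₀ : FlatChains.PolyhedralChain X G k)
    (hP : Tendsto (fun j => FlatChains.flatNorm (P j - P₀)) atTop (𝓝 0)) :
    FlatChains.mass P₀ ≤ liminf (fun j => FlatChains.mass (P j)) atTop :=
  mainTheorem2_general P P₀ hP
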